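/- Let $F\in\mathbb{C}[x,y]$ and let $\eta_i$ ($i\ge 1$) be polynomial one-forms on $\mathbb{C}^2$ such that $\sum_{i\ge1}\epsilon^i\eta_i$ converges for small $\epsilon$, uniformly on compact subsets of $\mathbb{C}^2$. A value $t\in\mathbb{C}$ is typical if $F$ is a $C^\infty$ trivial fibration over a neighbourhood of $t$; let $\Sigma$ be the set of values that are not typical. Let $t_0\in\mathbb{C}\setminus\Sigma$, $p_0\in F^{-1}(t_0)$, $\pi_1=\pi_1(F^{-1}(t_0),p_0)$ and $\gamma\in\pi_1$. For a loop $\delta\in\pi_1$ and a germ at $t_0$ of an analytic transversal $t\mapsto p(t)$ with $F(p(t))=t$, $p(t_0)=p_0$, let $\Delta_\delta(t,\epsilon)=\sum_{i}M_{i,\delta}(t)\epsilon^i$ be the displacement function (the holonomy along $\delta$ minus the identity, on the transversal parametrized by $t$) of the foliation $dF+\sum_{i\ge1}\epsilon^i\eta_i=0$; it is an analytic germ at $(t_0,0)$. Suppose that $\Delta_\gamma\not\equiv0$ and let $M_\mu=M_{\mu,\gamma}$ be the first nonzero Melnikov function along $\gamma$, that is, $M_{i,\gamma}\equiv0$ near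 $t_0$ for $i<\mu$ and $M_{\mu,\gamma}\not\equiv 0$ near $t_0$. Let $\mathcal{O}\lhd\pi_1$ be the smallest normal subgroup containing all $Mon_\alpha(\gamma)$, where $Mon_\alpha$ is the monodromy (transport of loops in the fibers of $F$) along a loop $\alpha$ of $\mathbb{C}^2\setminus F^{-1}(\Sigma)$ based at $p_0$. Put $K=[\mathcal{O},\pi_1]$, $H_1(\mathcal{O})=\mathcal{O}/K$, $\mathbb{C}H_1(\mathcal{O})=H_1(\mathcal{O})\otimes_{\mathbb{Z}}\mathbb{C}$, $L_1=\pi_1$, $L_{i+1}=[L_i,\pi_1]$. The torsion-free orbit depth of $\gamma$ is $$k=\min\Big(\big\{j\ge1 : \tfrac{K(\mathcal{O}\cap L_{j+1})}{K}\otimes_{\mathbb{Z}}\mathbb{C}=0\big\}\cup\{+\infty\}\Big).$$ Then: 1. $M_\mu$ is base point independent: for every path $\beta$ in $F^{-1}(t_0)$ from $p_0$ to a point $p_1$ and every analytic transversal through $p_1$ parametrized by the values of $F$, the displacement function along $\beta^{-1}\gamma\beta$ exists, its first nonzero Melnikov function has the same order $\mu$, and it coincides with $M_\mu$ as a germ at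 $t_0$. 2. $M_\mu$ defines a linear functional $\mathbf{M}_{\mu,t_0}$ on $\mathbb{C}H_1(\mathcal{O})(t_0)$: there is a linear functional $\mathbf{M}_{\mu,t_0}:\mathbb{C}H_1(\mathcal{O})\to\mathbb{C}$ such that, for all $\delta\in\mathcal{O}$ and all transversals through $p_0$, the displacement function along $\delta$ exists and $\mathbf{M}_{\mu,t_0}([\delta]\otimes1)=M_{\mu,\delta}(t_0)$. For every path $\beta$ as in 1, the map $\delta\mapsto\beta^{-1}\delta\beta$ sends $\mathcal{O}$ into the orbit subgroup of $\beta^{-1}\gamma\beta$ in $\pi_1(F^{-1}(t_0),p_1)$, and the analogous functional at $p_1$ exists and takes the same value on the class of $\beta^{-1}\delta\beta$ as $\mathbf{M}_{\mu,t_0}$ on the class of $\delta$. 3. If $k<\infty$, then $\mathbf{M}_{\mu,t_0}$ vanishes on (the classes of the elements of) $\mathcal{O}\cap L_{k+1}$. -/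

import Mathlib

open scoped Topology TensorProduct unitInterval ContDiff commutatorElement

noncomputable section

namespace Melnikov

/-! ### The fibration defined by a polynomial -/

/-- The affine plane `ℂ²`. -/
abbrev Plane : Type := Fin 2 → ℂ

/-- The fiber `{F = t}` with the topology induced from `ℂ²`. -/
abbrev Fiber (F : MvPolynomial (Fin 2) ℂ) (t : ℂ) : Type :=
  {x : Plane // MvPolynomial.eval x F = t}

/-- `t₀` is a typical value of `F`: over a neighbourhood `D` of `t₀` the map `F` is a `C^∞` trivial
fibration. The trivialization is written as a smooth transport `T x s` of the point `x` to the
fiber over `s`; the product structure is `x ↦ (T x t₀, F x)`, with inverse `(m, s) ↦ T m s`. -/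
def IsTypicalValue (F : MvPolynomial (Fin 2) ℂ) (t₀ : ℂ) : Prop :=
  ∃ (D : Set ℂ) (T : Plane → ℂ → Plane), IsOpen D ∧ t₀ ∈ D ∧
    ContDiffOn ℝ ∞ (fun z : Plane × ℂ => T z.1 z.2)
      {z | MvPolynomial.eval z.1 F ∈ D ∧ z.2 ∈ D} ∧
    ∀ x : Plane, MvPolynomial.eval x F ∈ D →
      T x (MvPolynomial.eval x F) = x ∧
      ∀ s ∈ D, MvPolynomial.eval (T x s) F = s ∧ ∀ s' ∈ D, T (T x s) s' = T x s'

/-- `γ'` is obtained from `γ` by transport along the closed path `α` of the total space: there is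
a continuous family of loops `H (u, ·)` in the fibers `{F = F (α u)}` with base points `α u` which
starts at a representative of `γ` and ends at a representative of `γ'`. -/
def IsMonodromy (F : MvPolynomial (Fin 2) ℂ) {t₀ : ℂ} (p₀ : Fiber F t₀)
    (α : Path (p₀ : Plane) (p₀ : Plane)) (γ γ' : FundamentalGroup (Fiber F t₀) p₀) : Prop :=
  ∃ (H : C(I × I, Plane)) (c c' : Path p₀ p₀),
    (∀ u, H (u, 0) = α u ∧ H (u, 1) = α u) ∧
    (∀ u s, MvPolynomial.eval (H (u, s)) F = MvPolynomial.eval (α u) F) ∧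
    (∀ s, H (0, s) = (c s : Plane) ∧ H (1, s) = (c' s : Plane)) ∧
    FundamentalGroup.fromPath (Path.Homotopic.Quotient.mk c) = γ ∧
    FundamentalGroup.fromPath (Path.Homotopic.Quotient.mk c') = γ'

/-- The orbit `𝒪` of `γ` under monodromy: the smallest normal subgroup of the fundamental group of
the fiber which contains the images of `γ` under the monodromy along all closed paths, based at
`p₀`, of the complement of the atypical fibers. -/
def orbit (F : MvPolynomial (Fin 2) ℂ) {t₀ : ℂ} (p₀ : Fiber F t₀)
    (γ : FundamentalGroup (Fiber F t₀) p₀) : Subgroup (FundamentalGroup (Fiber F t₀) p₀) :=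
  Subgroup.normalClosure {γ' | ∃ α : Path (p₀ : Plane) (p₀ : Plane),
    (∀ u, IsTypicalValue F (MvPolynomial.eval (α u) F)) ∧ IsMonodromy F p₀ α γ γ'}

instance orbit_normal (F : MvPolynomial (Fin 2) ℂ) {t₀ : ℂ} (p₀ : Fiber F t₀)
    (γ : FundamentalGroup (Fiber F t₀) p₀) : (orbit F p₀ γ).Normal :=
  Subgroup.normalClosure_normal

/-- The change of base point `γ ↦ β⁻¹ γ β` along a path `β` in the fiber. -/
abbrev changeBase {F : MvPolynomial (Fin 2) ℂ} {t₀ : ℂ} {p₀ p₁ : Fiber F t₀} (β : Path p₀ p₁) :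
    FundamentalGroup (Fiber F t₀) p₀ ≃* FundamentalGroup (Fiber F t₀) p₁ :=
  FundamentalGroup.fundamentalGroupMulEquivOfPath β

/-! ### The first homology of the orbit and the torsion-free depth -/

section Group

variable {G : Type*} [Group G]

/-- The subgroup `K = [𝒪, G]`, seen as a subgroup of `𝒪`. -/
abbrev commutatorIn (O : Subgroup G) : Subgroup O :=
  (⁅O, (⊤ : Subgroup G)⁆).subgroupOf O

/-- `H₁(𝒪) = 𝒪 / K`. -/
abbrev OrbitH1 (O : Subgroup G) [O.Normal] : Type _ := O ⧸ commutatorIn O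

instance orbitH1CommGroup (O : Subgroup G) [O.Normal] : CommGroup (OrbitH1 O) :=
  { (inferInstance : Group (O ⧸ commutatorIn O)) with
    mul_comm := by
      intro a b
      induction a using QuotientGroup.induction_on with
      | H a =>
        induction b using QuotientGroup.induction_on with
        | H b =>
          refine QuotientGroup.eq.2 ?_
          rw [Subgroup.mem_subgroupOf]
          have h := Subgroup.commutator_mem_commutator (H₁ := O) (H₂ := ⊤)
            (O.inv_mem b.2) (Subgroup.mem_top ((a : G)⁻¹))
          have e : (((a * b)⁻¹ * (b * a) : O) : G) = ⁅(b : G)⁻¹, (a : G)⁻¹⁆ := by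
            simp [commutatorElement_def, mul_assoc]
          rw [e]
          exact h }

/-- The quotient map `𝒪 → H₁(𝒪)`. -/
def toOrbitH1 (O : Subgroup G) [O.Normal] : O →* OrbitH1 O :=
  QuotientGroup.mk' (commutatorIn O)

/-- The complex vector space `ℂ H₁(𝒪) = H₁(𝒪) ⊗ ℂ`. -/
abbrev ComplexOrbitH1 (O : Subgroup G) [O.Normal] : Type _ :=
  ℂ ⊗[ℤ] Additive (OrbitH1 O)

/-- The class in `ℂ H₁(𝒪)` of an element of `𝒪`. -/
def orbitClass (O : Subgroup G) [O.Normal] (δ : O) : ComplexOrbitH1 O :=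
  (1 : ℂ) ⊗ₜ[ℤ] Additive.ofMul (toOrbitH1 O δ)

variable (G) in
/-- The lower central sequence `L₁ = G`, `L_{i+1} = [L_i, G]`, indexed from `1`. -/
def lowerCentral (i : ℕ) : Subgroup G := (⊤ : Subgroup G).lowerCentralSeries (i - 1)

/-- The subgroup `K (𝒪 ∩ L_i) / K` of `H₁(𝒪)`. -/
def orbitFiltration (O : Subgroup G) [O.Normal] (i : ℕ) : Subgroup (OrbitH1 O) :=
  ((lowerCentral G i).subgroupOf O).map (toOrbitH1 O)

/-- The torsion-free depth: the least `j ≥ 1` with `(K (𝒪 ∩ L_{j+1}) / K) ⊗ ℂ = 0`, and `⊤` if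
there is none. -/
def torsionFreeDepth (O : Subgroup G) [O.Normal] : ℕ∞ :=
  sInf {k : ℕ∞ | ∃ j : ℕ, k = j ∧ 1 ≤ j ∧
    Subsingleton (ℂ ⊗[ℤ] Additive (orbitFiltration O (j + 1)))}

end Group

/-! ### Displacement and Melnikov functions -/

/-- The value at the point `x` and the vector `v` of the one-form `dF + ∑_{i ≥ 1} ε^i η_i`, where
`η_i = η i 0 dx + η i 1 dy` (the term `η 0` is not used). -/
def deformedForm (F : MvPolynomial (Fin 2) ℂ) (η : ℕ → Fin 2 → MvPolynomial (Fin 2) ℂ) (ε : ℂ)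
    (x v : Plane) : ℂ :=
  ∑ k : Fin 2, (MvPolynomial.eval x (MvPolynomial.pderiv k F) +
    ∑' i : ℕ, ε ^ (i + 1) * MvPolynomial.eval x (η (i + 1) k)) * v k

/-- The series `∑_{i ≥ 1} ε^i η_i` converges for small `ε`, locally uniformly on `ℂ²` (the radius
of convergence may depend on the compact set). -/
def IsConvergentDeformation (η : ℕ → Fin 2 → MvPolynomial (Fin 2) ℂ) : Prop :=
  ∀ C : Set Plane, IsCompact C → ∃ r > 0, ∃ B : ℝ, ∀ x ∈ C, ∀ i ≥ 1, ∀ k : Fin 2,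
    ‖MvPolynomial.eval x (η i k)‖ * r ^ i ≤ B

/-- `p` is (a germ at `t₀` of) an analytic transversal through the point `p₀` of the fiber over
`t₀`, parametrized by the values of `F`. -/
def IsTransversal (F : MvPolynomial (Fin 2) ℂ) {t₀ : ℂ} (p₀ : Fiber F t₀) (p : ℂ → Plane) :
    Prop :=
  AnalyticAt ℂ p t₀ ∧ p t₀ = p₀ ∧ ∀ᶠ t in 𝓝 t₀, MvPolynomial.eval (p t) F = t

/-- `Δ t ε` is (a representative of the germ at `(t₀, 0)` of) the displacement function along the
loop `δ` of the foliation `dF + ∑ ε^i η_i = 0`, on the transversal `p`: there is a continuous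
family of paths `s ↦ H s t ε`, `0 ≤ s ≤ 1`, tangent to the foliation with parameter `ε`, which
start at the point `p t` of the transversal, end at the point `p (t + Δ t ε)` of the transversal,
and for `ε = 0`, `t = t₀` form a loop of the class `δ`. Thus `t ↦ t + Δ t ε` is the first return
map (holonomy) along `δ`. -/
def IsDisplacement (F : MvPolynomial (Fin 2) ℂ) (η : ℕ → Fin 2 → MvPolynomial (Fin 2) ℂ)
    {t₀ : ℂ} (p₀ : Fiber F t₀) (p : ℂ → Plane) (δ : FundamentalGroup (Fiber F t₀) p₀)
    (Δ : ℂ → ℂ → ℂ) : Prop :=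
  AnalyticAt ℂ (fun z : ℂ × ℂ => Δ z.1 z.2) (t₀, 0) ∧ Δ t₀ 0 = 0 ∧
  ∃ U ∈ 𝓝 t₀, ∃ V ∈ 𝓝 (0 : ℂ), ∃ (H H' : ℝ → ℂ → ℂ → Plane) (c : Path p₀ p₀),
    ContinuousOn (fun z : ℝ × ℂ × ℂ => H z.1 z.2.1 z.2.2) (Set.Icc 0 1 ×ˢ U ×ˢ V) ∧
    ContinuousOn (fun z : ℝ × ℂ × ℂ => H' z.1 z.2.1 z.2.2) (Set.Icc 0 1 ×ˢ U ×ˢ V) ∧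
    (∀ t ∈ U, ∀ ε ∈ V,
      (∀ s ∈ Set.Icc (0 : ℝ) 1,
        HasDerivWithinAt (fun s => H s t ε) (H' s t ε) (Set.Icc 0 1) s ∧
        deformedForm F η ε (H s t ε) (H' s t ε) = 0) ∧
      H 0 t ε = p t ∧ H 1 t ε = p (t + Δ t ε)) ∧
    (∀ s : I, H s t₀ 0 = (c s : Plane)) ∧
    FundamentalGroup.fromPath (Path.Homotopic.Quotient.mk c) = δ

/-- The `i`-th Melnikov function: the coefficient `M_i` of `Δ(t, ε) = ∑ M_i(t) ε^i`. -/
def melnikov (Δ : ℂ → ℂ → ℂ) (i : ℕ) (t : ℂ) : ℂ :=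
  iteratedDeriv i (fun ε => Δ t ε) 0 / (i.factorial : ℂ)

/-- `M_μ` is the first Melnikov function whose germ at `t₀` is not zero. -/
def IsFirstNonzero (t₀ : ℂ) (Δ : ℂ → ℂ → ℂ) (μ : ℕ) : Prop :=
  (∀ i < μ, ∀ᶠ t in 𝓝 t₀, melnikov Δ i t = 0) ∧ ¬ ∀ᶠ t in 𝓝 t₀, melnikov Δ μ t = 0

/-- The linear functional `ℳ` on `ℂ H₁(𝒪)`, `𝒪` the orbit of `γ`, is the functional defined by the
Melnikov function of order `μ`: its value on the class of a loop `δ` of `𝒪` is the value at `t₀` of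
`M_μ` along `δ`, computed on any transversal through `p₀`. -/
def IsMelnikovFunctional (F : MvPolynomial (Fin 2) ℂ) (η : ℕ → Fin 2 → MvPolynomial (Fin 2) ℂ)
    {t₀ : ℂ} (p₀ : Fiber F t₀) (γ : FundamentalGroup (Fiber F t₀) p₀) (μ : ℕ)
    (ℳ : ComplexOrbitH1 (orbit F p₀ γ) →ₗ[ℂ] ℂ) : Prop :=
  ∀ (p : ℂ → Plane), IsTransversal F p₀ p → ∀ δ : orbit F p₀ γ,
    (∃ Δ, IsDisplacement F η p₀ p δ Δ) ∧
    ∀ Δ, IsDisplacement F η p₀ p δ Δ → ℳ (orbitClass (orbit F p₀ γ) δ) = melnikov Δ μ t₀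

end Melnikov

end

/-!
The holonomy of the foliation `dF + ∑ ε^i η_i = 0` is studied through its first integrals. Near a
regular point the foliation has a flow box, analytic in the point and in `ε`
(`exists_flowBox`), hence a first integral `Φ (y, ε)` which equals `F` for `ε = 0`; it is unique up
to composition with a germ `g (t, ε)` which is the identity for `ε = 0`. The fiber over a typical
value consists of regular points, so a first integral can be continued along every path of the
fiber, and the result depends only on the homotopy class of the path. Along a loop `δ` the first
integral `Φ` becomes `g_δ (Φ, ε)`, and first integrals being constant along tangent paths, the
displacement function is governed by the germ `g_δ`: the holonomy map `t + Δ (t, ε)` is conjugate to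
the inverse of `g_δ` (`IsHolonomyMap.exists_conj`). Conversely, tangent paths inside flow boxes can
be glued to a family of tangent paths above any path of the fiber (`exists_isHolonomyMap`), so
displacement functions always exist.

All these germs are the identity for `ε = 0`. If `g_δ = t + ε ^ μ (m_δ + O(ε))`, then `m_δ` is
additive in `δ`, and conjugating `g_δ` by another such germ does not change `m_δ`
(`HasLeadingTerm.comp`, `HasLeadingTerm.conj`). As `-m_δ` is the Melnikov function of order `μ`, this
gives the independence of the base point and of the transversal.

The loops `δ` with `g_δ - t` divisible by `ε ^ μ` form a normal subgroup of the fundamental group.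
It contains the orbit of `γ`, because it is stable under monodromy: `g_δ - t` is divisible by
`ε ^ μ` if and only if the difference between the continuation of `Φ` along the loop and `Φ` is, and
the divisibility of an analytic function by `ε ^ μ` is a locally constant condition on the point
(`eventually_isDivisibleAt_iff`, `IsMonodromy.exists_hasLoopLeadingTerm`). So `δ ↦ -m_δ (t₀)` is
defined on the orbit `𝒪`, additive and invariant under conjugation by the fundamental group; it
kills `[𝒪, π₁]` and defines the linear functional on `ℂ H₁(𝒪)` (`exists_functional`). Orbits at
different base points correspond to each other since a loop can be slid along a path of the fiber
(`changeBase_mem_orbit`). Finally, when the torsion-free depth is `k`, the classes of the elements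
of `𝒪 ∩ L_{k+1}` come from a space `K (𝒪 ∩ L_{k+1}) / K ⊗ ℂ` which is zero.
-/

noncomputable section

namespace Melnikov

/-! ### Analytic maps between spaces of continuous maps -/

section Pointwise

variable {K E F : Type*} [TopologicalSpace K] [CompactSpace K]
  [NormedAddCommGroup E] [NormedSpace ℂ E] [NormedAddCommGroup F] [NormedSpace ℂ F]

/-- A continuous multilinear map acting pointwise on continuous maps. -/
def pointwiseMultilinear (K : Type*) [TopologicalSpace K] [CompactSpace K] {n : ℕ}
    (p : E [×n]→L[ℂ] F) : C(K, E) [×n]→L[ℂ] C(K, F) :=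
  MultilinearMap.mkContinuous
    { toFun := fun v => ⟨fun s => p fun i => v i s, by fun_prop⟩
      map_update_add' := by
        intro _ v i x y
        ext s
        have h : ∀ z : C(K, E), (fun j => Function.update v i z j s) =
            Function.update (fun j => v j s) i (z s) := by
          intro z; ext j
          by_cases hj : j = i
          · subst hj; simp
          · simp [hj]
        simp [h]
      map_update_smul' := by
        intro _ v i c x
        ext s
        have h : ∀ z : C(K, E), (fun j => Function.update v i z j s) =
            Function.update (fun j => v j s) i (z s) := by
          intro z; ext j
          by_cases hj : j = i
          · subst hj; simp
          · simp [hj]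
        simp [h] } ‖p‖ (by
      intro v
      refine (ContinuousMap.norm_le _ (by positivity)).2 fun s => ?_
      refine (p.le_opNorm _).trans ?_
      gcongr with i
      exact (v i).norm_coe_le_norm s)

lemma norm_pointwiseMultilinear_le {n : ℕ} (p : E [×n]→L[ℂ] F) :
    ‖pointwiseMultilinear K p‖ ≤ ‖p‖ :=
  MultilinearMap.mkContinuous_norm_le _ (norm_nonneg _) _

/-- Composition with an analytic map is an analytic operator on continuous maps on a compact space:
the power series of the operator acts pointwise. -/
lemma exists_analyticAt_postcomp [CompleteSpace F] {f : E → F} {x : E} (hf : AnalyticAt ℂ f x) :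
    ∃ N : C(K, E) → C(K, F), AnalyticAt ℂ N (ContinuousMap.const K x) ∧
      ∀ᶠ y in 𝓝 (ContinuousMap.const K x), ∀ s, N y s = f (y s) := by
  obtain ⟨p, r, hp⟩ := hf
  let q : FormalMultilinearSeries ℂ C(K, E) C(K, F) := fun n => pointwiseMultilinear K (p n)
  have hr : r ≤ q.radius := hp.r_le.trans
    (FormalMultilinearSeries.radius_le_of_le fun n => norm_pointwiseMultilinear_le (p n))
  have hq := (q.hasFPowerSeriesOnBall (hp.r_pos.trans_le hr))
  refine ⟨fun y => q.sum (y - ContinuousMap.const K x), ?_, ?_⟩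
  · have h0 : AnalyticAt ℂ q.sum (ContinuousMap.const K x - ContinuousMap.const K x) := by
      rw [sub_self]; exact hq.analyticAt
    exact h0.comp_of_eq (by fun_prop) rfl
  · filter_upwards [Metric.eball_mem_nhds _ hp.r_pos] with y hy s
    have hy' : y - ContinuousMap.const K x ∈ Metric.eball (0 : C(K, E)) q.radius := by
      have := Metric.eball_subset_eball hr hy
      rwa [Metric.mem_eball, edist_eq_enorm_sub, sub_zero, ← edist_eq_enorm_sub]
    have h1 := (q.hasSum hy').map (ContinuousMap.evalCLM ℂ s) (ContinuousMap.evalCLM ℂ s).continuous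
    have hys : y s - x ∈ Metric.eball (0 : E) r := by
      rw [Metric.mem_eball, edist_eq_enorm_sub] at hy ⊢
      rw [sub_zero]
      refine lt_of_le_of_lt ?_ hy
      have := (y - ContinuousMap.const K x).norm_coe_le_norm s
      simpa [enorm_le_iff_norm_le] using this
    have h2 := hp.hasSum hys
    rw [add_sub_cancel] at h2
    exact h1.unique h2

end Pointwise

/-! ### Analytic local flows -/

section Flow

variable {E : Type*} [NormedAddCommGroup E] [NormedSpace ℂ E]

/-- The primitive vanishing at `0` of a continuous map on the unit interval, as a bounded
operator. -/
def primitiveCLM (E : Type*) [NormedAddCommGroup E] [NormedSpace ℂ E] : C(I, E) →L[ℂ] C(I, E) :=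
  LinearMap.mkContinuous
    { toFun := fun y => ⟨fun s => ∫ r in (0 : ℝ)..s, y (Set.projIcc 0 1 zero_le_one r), by
        have h : Continuous fun r => y (Set.projIcc 0 1 zero_le_one r) :=
          y.continuous.comp continuous_projIcc
        exact (intervalIntegral.continuous_primitive (fun a b => h.intervalIntegrable a b) 0).comp
          continuous_subtype_val⟩
      map_add' := by
        intro y y'
        ext s
        have h : ∀ y : C(I, E), IntervalIntegrable
            (fun r => y (Set.projIcc 0 1 zero_le_one r)) MeasureTheory.volume 0 s := fun y =>
          (y.continuous.comp continuous_projIcc).intervalIntegrable _ _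
        simpa using intervalIntegral.integral_add (h y) (h y')
      map_smul' := by
        intro c y
        ext s
        simp } 1 (by
      intro y
      refine (ContinuousMap.norm_le _ (by positivity)).2 fun s => ?_
      have := intervalIntegral.norm_integral_le_of_norm_le_const (a := 0) (b := (s : ℝ)) (C := ‖y‖)
        (f := fun r => y (Set.projIcc 0 1 zero_le_one r)) fun r _ => y.norm_coe_le_norm _
      refine this.trans ?_
      rw [sub_zero, abs_of_nonneg s.2.1, one_mul]
      exact mul_le_of_le_one_right (norm_nonneg _) s.2.2)

lemma primitiveCLM_apply (y : C(I, E)) (s : I) :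
    primitiveCLM E y s = ∫ r in (0 : ℝ)..s, y (Set.projIcc 0 1 zero_le_one r) := rfl

/-- An analytic vector field has an analytic local flow `ψ (w, z)`, in complex time `z`. The paths
`s ↦ ψ (w, s z)` are found by applying the implicit function theorem to the integral equation
`y = w + z ∫ X(y)` in the Banach space of continuous paths. -/
lemma exists_analyticAt_flow [CompleteSpace E] {X : E → E} {x : E} (hX : AnalyticAt ℂ X x) :
    ∃ ψ : E × ℂ → E, AnalyticAt ℂ ψ (x, 0) ∧ (∀ᶠ w in 𝓝 x, ψ (w, 0) = w) ∧
      ∀ᶠ v : E × ℂ in 𝓝 (x, 0), HasDerivAt (fun z => ψ (v.1, z)) (X (ψ v)) v.2 := by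
  obtain ⟨N, hN, hNX⟩ := exists_analyticAt_postcomp (K := I) hX
  let cst : E →L[ℂ] C(I, E) := ContinuousLinearMap.const ℂ I
  have hcst : ∀ w s, cst w s = w := fun w s => rfl
  let G : (E × ℂ) × C(I, E) → C(I, E) := fun v =>
    v.2 - cst v.1.1 - v.1.2 • primitiveCLM E (N v.2)
  let u : (E × ℂ) × C(I, E) := ((x, 0), cst x)
  have hNu : AnalyticAt ℂ (fun v : (E × ℂ) × C(I, E) => N v.2) u :=
    hN.comp_of_eq analyticAt_snd rfl
  have hG : AnalyticAt ℂ G u := by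
    have h1 : AnalyticAt ℂ (fun v : (E × ℂ) × C(I, E) => primitiveCLM E (N v.2)) u :=
      ((primitiveCLM E).analyticAt _).comp hNu
    have h2 : AnalyticAt ℂ (fun v : (E × ℂ) × C(I, E) => v.1.2) u :=
      analyticAt_snd.comp analyticAt_fst
    have h3 : AnalyticAt ℂ (fun v : (E × ℂ) × C(I, E) => v.2 - cst v.1.1) u := by
      have : AnalyticAt ℂ (fun v : (E × ℂ) × C(I, E) => cst v.1.1) u :=
        (cst.analyticAt _).comp (f := fun v : (E × ℂ) × C(I, E) => v.1.1)
          (analyticAt_fst.comp analyticAt_fst)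
      exact (analyticAt_snd).sub this
    exact h3.sub (h2.smul h1)
  have hGu : G u = 0 := by simp [G, u]
  have hcd : ContDiffAt ℂ ω G u := hG.contDiffAt
  have hinv : (fderiv ℂ G u ∘L .inr ℂ (E × ℂ) C(I, E)).IsInvertible := by
    have h1 : HasFDerivAt (fun y : C(I, E) => G ((x, 0), y))
        (fderiv ℂ G u ∘L .inr ℂ (E × ℂ) C(I, E)) (cst x) :=
      HasFDerivAt.comp (f := fun y : C(I, E) => ((x, (0 : ℂ)), y)) (g := G) (cst x)
        hG.differentiableAt.hasFDerivAt (hasFDerivAt_prodMk_right _ _)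
    have h2 : HasFDerivAt (fun y : C(I, E) => G ((x, 0), y))
        (ContinuousLinearMap.id ℂ C(I, E)) (cst x) := by
      have : (fun y : C(I, E) => G ((x, 0), y)) = fun y => y - cst x := by
        funext y; simp [G]
      rw [this]
      exact (hasFDerivAt_id _).sub_const _
    rw [h1.unique h2]
    exact ⟨ContinuousLinearEquiv.refl ℂ _, rfl⟩
  have hω : (ω : WithTop ℕ∞) ≠ 0 := by simp
  let Y := hcd.implicitFunction hω hinv
  have hYa : AnalyticAt ℂ Y (x, 0) := (hcd.contDiffAt_implicitFunction hω hinv).analyticAt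
  have hY0 : Y (x, 0) = cst x := hcd.implicitFunction_apply_self hω hinv
  -- the integral equation, with the vector field in place of the operator `N`
  have hYc : Filter.Tendsto Y (𝓝 (x, 0)) (𝓝 (cst x)) := by
    have := hYa.continuousAt.tendsto
    rwa [hY0] at this
  have hYeq : ∀ᶠ v in 𝓝 ((x, 0) : E × ℂ), ∀ s : I, Y v s = v.1 +
      v.2 • ∫ r in (0 : ℝ)..s, X (Y v (Set.projIcc 0 1 zero_le_one r)) := by
    filter_upwards [hcd.eventually_apply_implicitFunction hω hinv, hYc.eventually hNX]
      with v hv hv' s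
    rw [hGu] at hv
    have this : Y v s - v.1 - v.2 • ∫ r in (0 : ℝ)..s,
        N (Y v) (Set.projIcc 0 1 zero_le_one r) = 0 := DFunLike.congr_fun hv s
    simp only [hv'] at this
    rw [sub_sub, sub_eq_zero] at this
    exact this
  -- rescaling the time
  have hscale : ∀ᶠ v in 𝓝 ((x, 0) : E × ℂ), ∀ s : I, Y v s = Y (v.1, (s : ℂ) * v.2) 1 := by
    have huniq := hcd.eventually_apply_eq_iff_implicitFunction hω hinv
    obtain ⟨ρ, hρ, hball⟩ := Metric.eventually_nhds_iff_ball.1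
      (huniq.and (((continuous_snd.tendsto u)).eventually hNX))
    filter_upwards [hYeq, hYc.eventually (Metric.ball_mem_nhds _ hρ), hYc.eventually hNX,
      Metric.ball_mem_nhds _ hρ] with v hv hvρ hvN hvx s
    let y' : C(I, E) := ⟨fun r => Y v (s * r), by fun_prop⟩
    have hmem : ((v.1, (s : ℂ) * v.2), y') ∈ Metric.ball u ρ := by
      rw [Metric.mem_ball, Prod.dist_eq, max_lt_iff] at hvx
      rw [Metric.mem_ball, Prod.dist_eq, Prod.dist_eq, max_lt_iff, max_lt_iff]
      refine ⟨⟨hvx.1, ?_⟩, ?_⟩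
      · refine lt_of_le_of_lt ?_ hvx.2
        simp only [u, dist_zero_right, norm_mul, Complex.norm_real, Real.norm_eq_abs]
        rw [abs_of_nonneg s.2.1]
        exact mul_le_of_le_one_left (norm_nonneg _) s.2.2
      · refine lt_of_le_of_lt ((ContinuousMap.dist_le dist_nonneg).2 fun r => ?_) hvρ
        exact ContinuousMap.dist_apply_le_dist (f := Y v) (g := cst x) (s * r)
    obtain ⟨hiff, hN'⟩ := hball _ hmem
    have hG0 : G ((v.1, (s : ℂ) * v.2), y') = G u := by
      rw [hGu]
      ext r
      simp only [G, ContinuousMap.sub_apply, hcst, ContinuousMap.smul_apply, primitiveCLM_apply,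
        ContinuousMap.zero_apply]
      simp only at hN'
      simp only [hN']
      have h1 : y' r = v.1 + v.2 • ∫ q in (0 : ℝ)..(s * r : ℝ),
          X (Y v (Set.projIcc 0 1 zero_le_one q)) := by
        have := hv (s * r)
        simpa [y'] using this
      have h2 := intervalIntegral.smul_integral_comp_mul_left (a := 0) (b := (r : ℝ))
        (fun q => X (Y v (Set.projIcc 0 1 zero_le_one q))) (s : ℝ)
      have h3 : ∫ q in (0 : ℝ)..r, X (Y v (Set.projIcc 0 1 zero_le_one ((s : ℝ) * q))) =
          ∫ q in (0 : ℝ)..r, X (y' (Set.projIcc 0 1 zero_le_one q)) := by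
        refine intervalIntegral.integral_congr fun q hq => ?_
        rw [Set.uIcc_of_le r.2.1] at hq
        have hq' : q ∈ Set.Icc (0 : ℝ) 1 := ⟨hq.1, hq.2.trans r.2.2⟩
        have hsq : (s : ℝ) * q ∈ Set.Icc (0 : ℝ) 1 := unitInterval.mul_mem s.2 hq'
        simp only [y', Set.projIcc_of_mem zero_le_one hq', Set.projIcc_of_mem zero_le_one hsq]
        rfl
      rw [mul_zero] at h2
      rw [h1, ← h2, h3, mul_comm (s : ℂ) v.2, mul_smul]
      rw [show ((s : ℂ) • ∫ q in (0 : ℝ)..r, X (y' (Set.projIcc 0 1 zero_le_one q))) =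
        (s : ℝ) • ∫ q in (0 : ℝ)..r, X (y' (Set.projIcc 0 1 zero_le_one q)) from
        Complex.coe_smul _ _]
      abel
    have := hiff.1 hG0
    have h1 := DFunLike.congr_fun this 1
    simp only [y', ContinuousMap.coe_mk, mul_one] at h1
    exact h1.symm
  let ψ : E × ℂ → E := fun v => Y v 1
  have hψ : AnalyticAt ℂ ψ (x, 0) :=
    ((ContinuousMap.evalCLM ℂ (1 : I) : C(I, E) →L[ℂ] E).analyticAt _).comp hYa
  have hψx : ψ (x, 0) = x := by simp only [ψ, hY0]; rfl
  have hline : ∀ v : E × ℂ, AnalyticAt ℂ ψ v →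
      HasDerivAt (fun z => ψ (v.1, z)) (fderiv ℂ ψ v (0, 1)) v.2 := by
    intro v hv
    have := HasFDerivAt.comp_hasDerivAt (f := fun z : ℂ => (v.1, z)) v.2
      (l := ψ) hv.differentiableAt.hasFDerivAt ((hasDerivAt_const _ _).prodMk (hasDerivAt_id _))
    exact this
  have hne : ∀ᶠ v in 𝓝 ((x, 0) : E × ℂ), v.2 ≠ 0 → fderiv ℂ ψ v (0, 1) = X (ψ v) := by
    filter_upwards [hYeq, hscale, hψ.eventually_analyticAt,
      hYc.eventually hNX] with v hv hs ha hvN hv0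
    have hcont : Continuous fun r : ℝ => X (Y v (Set.projIcc 0 1 zero_le_one r)) := by
      simp only [← hvN]
      exact (N (Y v)).continuous.comp continuous_projIcc
    have h1 : HasDerivAt (fun s : ℝ => v.1 + v.2 • ∫ r in (0 : ℝ)..s,
        X (Y v (Set.projIcc 0 1 zero_le_one r))) (v.2 • X (Y v 1)) 1 := by
      have := (hcont.integral_hasStrictDerivAt 0 1).hasDerivAt
      simp only [Set.projIcc_right] at this
      exact (this.const_smul v.2).const_add v.1
    have h2 : HasDerivAt (fun s : ℝ => ψ (v.1, (s : ℂ) * v.2))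
        (v.2 • fderiv ℂ ψ v (0, 1)) 1 := by
      have hl := hline v ha
      have hm : HasDerivAt (fun s : ℝ => (s : ℂ) * v.2) v.2 1 := by
        simpa using (Complex.ofRealCLM.hasDerivAt (x := 1)).mul_const v.2
      have := HasDerivAt.scomp (h := fun s : ℝ => (s : ℂ) * v.2) (1 : ℝ)
        (g₁ := fun z => ψ (v.1, z)) (by simpa using hl) hm
      exact this
    have h3 : Set.EqOn (fun s : ℝ => ψ (v.1, (s : ℂ) * v.2)) (fun s : ℝ => v.1 + v.2 •
        ∫ r in (0 : ℝ)..s, X (Y v (Set.projIcc 0 1 zero_le_one r))) (Set.Icc 0 1) := by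
      intro s hs'
      have := hs ⟨s, hs'⟩
      rw [hv ⟨s, hs'⟩] at this
      exact this.symm
    have h4 := (uniqueDiffOn_Icc (zero_lt_one' ℝ) 1 (Set.right_mem_Icc.2 zero_le_one)).eq_deriv _
      h2.hasDerivWithinAt (h1.hasDerivWithinAt.congr h3 (h3 (Set.right_mem_Icc.2 zero_le_one)))
    exact smul_right_injective E hv0 h4
  refine ⟨ψ, hψ, ?_, ?_⟩
  · have : Filter.Tendsto (fun w : E => (w, (0 : ℂ))) (𝓝 x) (𝓝 (x, 0)) :=
      (Continuous.prodMk_left (0 : ℂ)).tendsto x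
    filter_upwards [this.eventually hYeq] with w hw
    simpa using hw 1
  · have hXψ : AnalyticAt ℂ (fun v => X (ψ v)) (x, 0) := AnalyticAt.comp_of_eq hX hψ hψx
    filter_upwards [hne.eventually_nhds, hψ.eventually_analyticAt,
      hXψ.eventually_analyticAt] with v hv ha hXa
    have hd := hline v ha
    suffices fderiv ℂ ψ v (0, 1) = X (ψ v) by rwa [this] at hd
    by_cases h0 : v.2 = 0
    · -- the exceptional time `0` is reached by continuity
      have hl : Filter.Tendsto (fun z : ℂ => (v.1, z)) (𝓝[≠] v.2) (𝓝 v) :=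
        ((Continuous.prodMk_right v.1).tendsto v.2).mono_left nhdsWithin_le_nhds
      have c1 : ContinuousAt (fun v => fderiv ℂ ψ v (0, 1)) v :=
        ha.fderiv.continuousAt.clm_apply continuousAt_const
      refine tendsto_nhds_unique_of_eventuallyEq (c1.tendsto.comp hl)
        (hXa.continuousAt.tendsto.comp hl) ?_
      filter_upwards [hl.eventually hv, self_mem_nhdsWithin] with z hz hz'
      refine hz ?_
      rw [h0] at hz'
      exact hz'
    · exact hv.self_of_nhds h0

end Flow

end Melnikov

namespace Melnikov

/-! ### Division and local inversion of analytic germs -/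

section Division

variable {E : Type*} [NormedAddCommGroup E] [NormedSpace ℂ E]

/-- An analytic germ which vanishes for `ε = 0` is a multiple of `ε`; the quotient is the average
of the derivative in `ε` over the segment from `(x, 0)` to `(x, ε)`. -/
lemma exists_eq_mul_of_eq_zero {f : E × ℂ → ℂ} {x : E} (hf : AnalyticAt ℂ f (x, 0))
    (h0 : ∀ᶠ y in 𝓝 x, f (y, 0) = 0) :
    ∃ g : E × ℂ → ℂ, AnalyticAt ℂ g (x, 0) ∧ ∀ᶠ v in 𝓝 ((x, 0) : E × ℂ), f v = v.2 * g v := by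
  have hd : AnalyticAt ℂ (fun v => fderiv ℂ f v (0, 1)) (x, 0) :=
    ((ContinuousLinearMap.apply ℂ ℂ ((0, 1) : E × ℂ)).analyticAt _).comp hf.fderiv
  obtain ⟨N, hN, hNd⟩ := exists_analyticAt_postcomp (K := I) hd
  let P : E × ℂ → C(I, E × ℂ) := fun v =>
    ContinuousMap.const I (v.1, 0) + v.2 • ⟨fun s : I => ((0 : E), ((s : ℝ) : ℂ)), by fun_prop⟩
  have hP : ∀ v s, P v s = (v.1, (s : ℂ) * v.2) := fun v s => by
    simp [P, mul_comm]
  have hPa : AnalyticAt ℂ P (x, 0) := by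
    have h1 : AnalyticAt ℂ (fun v : E × ℂ => ContinuousMap.const I (v.1, (0 : ℂ))) (x, 0) :=
      ((ContinuousLinearMap.const ℂ I ∘L .inl ℂ E ℂ ∘L .fst ℂ E ℂ :
        E × ℂ →L[ℂ] C(I, E × ℂ)).analyticAt _)
    exact h1.add (analyticAt_snd.smul analyticAt_const)
  have hP0 : P (x, 0) = ContinuousMap.const I (x, 0) := by
    ext s <;> simp [hP]
  have hga : AnalyticAt ℂ (fun v => primitiveCLM ℂ (N (P v)) 1) (x, 0) :=
    ((ContinuousMap.evalCLM ℂ (1 : I) ∘L primitiveCLM ℂ : C(I, ℂ) →L[ℂ] ℂ).analyticAt _).comp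
      (AnalyticAt.comp_of_eq hN hPa hP0)
  refine ⟨_, hga, ?_⟩
  obtain ⟨ρ, hρ, hball⟩ := Metric.eventually_nhds_iff_ball.1 hf.eventually_analyticAt
  have hPc : ∀ᶠ v in 𝓝 ((x, 0) : E × ℂ), ∀ s, N (P v) s = fderiv ℂ f (P v s) (0, 1) :=
    (hP0 ▸ hPa.continuousAt.tendsto).eventually hNd
  filter_upwards [Metric.ball_mem_nhds _ hρ, hPc,
    (continuous_fst.tendsto ((x, 0) : E × ℂ)).eventually h0] with v hv hNv hv0
  have hmem : ∀ s ∈ Set.Icc (0 : ℝ) 1, (v.1, (s : ℂ) * v.2) ∈ Metric.ball ((x, 0) : E × ℂ) ρ := by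
    intro s hs
    rw [Metric.mem_ball, Prod.dist_eq, max_lt_iff] at hv ⊢
    refine ⟨hv.1, lt_of_le_of_lt ?_ hv.2⟩
    simp only [dist_zero_right, norm_mul, Complex.norm_real, Real.norm_eq_abs]
    rw [abs_of_nonneg hs.1]
    exact mul_le_of_le_one_left (norm_nonneg _) hs.2
  have hder : ∀ s ∈ Set.uIcc (0 : ℝ) 1, HasDerivAt (fun s : ℝ => f (v.1, (s : ℂ) * v.2))
      (v.2 * N (P v) (Set.projIcc 0 1 zero_le_one s)) s := by
    intro s hs
    rw [Set.uIcc_of_le zero_le_one] at hs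
    have h1 : HasDerivAt (fun s : ℝ => (v.1, (s : ℂ) * v.2)) ((0 : E), v.2) s := by
      refine (hasDerivAt_const _ _).prodMk ?_
      simpa using (Complex.ofRealCLM.hasDerivAt (x := s)).mul_const v.2
    have h2 := ((hball _ (hmem s hs)).differentiableAt.hasFDerivAt.restrictScalars ℝ).comp_hasDerivAt
      s h1
    rw [hNv, Set.projIcc_of_mem zero_le_one hs, hP]
    have h3 : ((0 : E), v.2) = v.2 • ((0 : E), (1 : ℂ)) := by simp
    have h4 : (fderiv ℂ f (v.1, (s : ℂ) * v.2)) ((0 : E), v.2) =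
        v.2 * (fderiv ℂ f (v.1, (s : ℂ) * v.2)) (0, 1) := by
      rw [h3, map_smul, smul_eq_mul]
    rw [← h4]
    exact h2
  have hint := intervalIntegral.integral_eq_sub_of_hasDerivAt hder
    ((continuous_const.mul ((N (P v)).continuous.comp continuous_projIcc)).intervalIntegrable _ _)
  rw [intervalIntegral.integral_const_mul] at hint
  simp only [Complex.ofReal_one, one_mul, Complex.ofReal_zero, zero_mul, hv0, sub_zero] at hint
  exact hint.symm

end Division

/-- The inverse function theorem for analytic maps, without the bookkeeping of the domains. -/
lemma exists_analyticAt_inverse {E F : Type*} [NormedAddCommGroup E] [NormedSpace ℂ E]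
    [CompleteSpace E] [NormedAddCommGroup F] [NormedSpace ℂ F] [CompleteSpace F] {f : E → F}
    {e : E ≃L[ℂ] F} {a : E}
    (hf : AnalyticAt ℂ f a) (he : HasFDerivAt f (e : E →L[ℂ] F) a) :
    ∃ g : F → E, AnalyticAt ℂ g (f a) ∧ g (f a) = a ∧ (∀ᶠ x in 𝓝 a, g (f x) = x) ∧
      ∀ᶠ y in 𝓝 (f a), f (g y) = y := by
  have hc : ContDiffAt ℂ ω f a := hf.contDiffAt
  have hω : (ω : WithTop ℕ∞) ≠ 0 := by simp
  have hs := hc.hasStrictFDerivAt' he hω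
  exact ⟨hs.localInverse f e a, (hc.to_localInverse he hω).analyticAt,
    hs.localInverse_apply_image, hs.eventually_left_inverse, hs.eventually_right_inverse⟩

/-! ### Analyticity of convergent deformations -/

section Cauchy

variable {F : Type*} [NormedAddCommGroup F] [NormedSpace ℂ F]

/-- The bounded bilinear map `(κ, h) ↦ ∮ κ • h` for continuous maps on a circle. -/
def circlePairing (z₀ : ℂ) (R : ℝ) (hR : 0 ≤ R) (F : Type*) [NormedAddCommGroup F]
    [NormedSpace ℂ F] :
    C(Metric.sphere z₀ R, ℂ) →L[ℂ] C(Metric.sphere z₀ R, F) →L[ℂ] F :=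
  LinearMap.mkContinuous₂
    (LinearMap.mk₂ ℂ (fun (κ : C(Metric.sphere z₀ R, ℂ)) (h : C(Metric.sphere z₀ R, F)) =>
      ∫ θ in (0 : ℝ)..2 * Real.pi, deriv (circleMap z₀ R) θ •
        (κ ⟨circleMap z₀ R θ, circleMap_mem_sphere z₀ hR θ⟩ •
          h ⟨circleMap z₀ R θ, circleMap_mem_sphere z₀ hR θ⟩))
      (by
        intro κ κ' h
        rw [← intervalIntegral.integral_add]
        · simp [add_smul]
        all_goals
          refine Continuous.intervalIntegrable ?_ _ _
          simp only [deriv_circleMap]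
          fun_prop)
      (by
        intro c κ h
        rw [← intervalIntegral.integral_smul]
        refine intervalIntegral.integral_congr fun θ _ => ?_
        simp only [ContinuousMap.smul_apply, smul_eq_mul, mul_smul]
        rw [smul_comm])
      (by
        intro κ h h'
        rw [← intervalIntegral.integral_add]
        · simp
        all_goals
          refine Continuous.intervalIntegrable ?_ _ _
          simp only [deriv_circleMap]
          fun_prop)
      (by
        intro c κ h
        rw [← intervalIntegral.integral_smul]
        refine intervalIntegral.integral_congr fun θ _ => ?_
        simp only [ContinuousMap.smul_apply]
        rw [smul_comm c, smul_comm c]))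
    (R * |2 * Real.pi - 0|) (by
      intro κ h
      have := intervalIntegral.norm_integral_le_of_norm_le_const (a := 0) (b := 2 * Real.pi)
        (C := R * ‖κ‖ * ‖h‖) (f := fun θ => deriv (circleMap z₀ R) θ •
          (κ ⟨circleMap z₀ R θ, circleMap_mem_sphere z₀ hR θ⟩ •
            h ⟨circleMap z₀ R θ, circleMap_mem_sphere z₀ hR θ⟩)) (by
        intro θ _
        rw [norm_smul, norm_smul, deriv_circleMap, mul_assoc]
        simp only [norm_mul, norm_circleMap_zero, Complex.norm_I, mul_one, abs_of_nonneg hR]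
        gcongr
        · exact κ.norm_coe_le_norm _
        · exact h.norm_coe_le_norm _)
      refine this.trans (le_of_eq ?_)
      ring)

/-- Cauchy's integral formula as a criterion of joint analyticity: a function of `(z, e)` which is
holomorphic in `z`, and whose restriction to the boundary circle is an analytic function of `e`
with values in the continuous maps on this circle, is analytic. -/
lemma analyticAt_of_analyticAt_sphere [CompleteSpace F] {E : Type*} [NormedAddCommGroup E]
    [NormedSpace ℂ E] {f : ℂ × E → F} {z₀ : ℂ} {e₀ : E} {R : ℝ} (hR : 0 < R)
    {Ψ : E → C(Metric.sphere z₀ R, F)} (hΨ : AnalyticAt ℂ Ψ e₀)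
    (hf : ∀ᶠ e in 𝓝 e₀, DiffContOnCl ℂ (fun z => f (z, e)) (Metric.ball z₀ R) ∧
      ∀ w : Metric.sphere z₀ R, Ψ e w = f (w, e)) :
    AnalyticAt ℂ f (z₀, e₀) := by
  let j : ℂ → C(Metric.sphere z₀ R, ℂ) := fun z =>
    ⟨fun w => (w : ℂ), by fun_prop⟩ - ContinuousLinearMap.const ℂ _ z
  have hj : ∀ z w, j z w = w - z := fun z w => rfl
  have hju : ∀ z ∈ Metric.ball z₀ R, ∀ w : Metric.sphere z₀ R, (w : ℂ) - z ≠ 0 := by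
    intro z hz w h
    rw [sub_eq_zero] at h
    have hw := w.2
    rw [h, Metric.mem_sphere] at hw
    exact absurd hw (ne_of_lt hz)
  have hunit : ∀ z ∈ Metric.ball z₀ R, IsUnit (j z) := fun z hz =>
    (ContinuousMap.isUnit_iff_forall_ne_zero _).2 fun w => hju z hz w
  have hκ : AnalyticAt ℂ (fun z => Ring.inverse (j z)) z₀ := by
    obtain ⟨u, hu⟩ := hunit z₀ (Metric.mem_ball_self hR)
    have h1 : AnalyticAt ℂ j z₀ :=
      analyticAt_const.sub
        ((ContinuousLinearMap.const ℂ _ : ℂ →L[ℂ] C(Metric.sphere z₀ R, ℂ)).analyticAt _)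
    have := analyticAt_inverse (𝕜 := ℂ) u
    rw [hu] at this
    exact this.comp h1
  have hκv : ∀ z ∈ Metric.ball z₀ R, ∀ w, Ring.inverse (j z) w = ((w : ℂ) - z)⁻¹ := by
    intro z hz w
    have h1 := DFunLike.congr_fun (Ring.mul_inverse_cancel _ (hunit z hz)) w
    rw [ContinuousMap.mul_apply, hj] at h1
    exact (inv_eq_of_mul_eq_one_right h1).symm
  have hB : AnalyticAt ℂ (fun v : ℂ × E => (2 * Real.pi * Complex.I : ℂ)⁻¹ •
      circlePairing z₀ R hR.le F (Ring.inverse (j v.1)) (Ψ v.2)) (z₀, e₀) := by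
    have h1 : AnalyticAt ℂ (fun v : ℂ × E => (Ring.inverse (j v.1), Ψ v.2)) (z₀, e₀) :=
      (AnalyticAt.comp_of_eq hκ analyticAt_fst rfl).prod
        (AnalyticAt.comp_of_eq hΨ analyticAt_snd rfl)
    exact analyticAt_const.smul (((circlePairing z₀ R hR.le F).analyticAt_bilinear _).comp h1)
  refine hB.congr ?_
  filter_upwards [(continuous_snd.tendsto (z₀, e₀)).eventually hf,
    (continuous_fst.tendsto (z₀, e₀)).eventually (Metric.ball_mem_nhds z₀ hR)] with v hv hvz
  have h1 := hv.1.two_pi_i_inv_smul_circleIntegral_sub_inv_smul hvz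
  refine Eq.trans ?_ h1
  congr 1
  refine intervalIntegral.integral_congr fun θ _ => ?_
  simp only [hκv v.1 hvz, hv.2]

variable {r B : ℝ}

lemma norm_pow_smul_le {c : F} {i : ℕ} (hc : ‖c‖ * r ^ (i + 1) ≤ B) {ε : ℂ}
    (hε : ‖ε‖ ≤ r / 2) : ‖ε ^ (i + 1) • c‖ ≤ B * (1 / 2) ^ (i + 1) := by
  rw [norm_smul, norm_pow]
  calc ‖ε‖ ^ (i + 1) * ‖c‖ ≤ (r / 2) ^ (i + 1) * ‖c‖ := by gcongr
    _ = ‖c‖ * r ^ (i + 1) * (1 / 2) ^ (i + 1) := by rw [div_eq_mul_one_div, mul_pow]; ring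
    _ ≤ _ := by gcongr

lemma summable_geometric_bound (B : ℝ) : Summable fun i : ℕ => B * (1 / 2 : ℝ) ^ (i + 1) :=
  ((summable_geometric_two.comp_injective (add_left_injective 1)).mul_left B)

lemma summable_pow_smul [CompleteSpace F] {c : ℕ → F}
    (hc : ∀ i, ‖c i‖ * r ^ (i + 1) ≤ B) {ε : ℂ} (hε : ‖ε‖ ≤ r / 2) :
    Summable fun i => ε ^ (i + 1) • c i :=
  .of_norm_bounded (summable_geometric_bound B) fun i => norm_pow_smul_le (hc i) hε

lemma analyticAt_tsum_pow_smul [CompleteSpace F] {c : ℕ → F} (hr : 0 < r)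
    (hc : ∀ i, ‖c i‖ * r ^ (i + 1) ≤ B) :
    AnalyticAt ℂ (fun ε : ℂ => ∑' i, ε ^ (i + 1) • c i) 0 := by
  have : DifferentiableOn ℂ (fun ε : ℂ => ∑' i, ε ^ (i + 1) • c i) (Metric.ball 0 (r / 2)) := by
    refine Complex.differentiableOn_tsum_of_summable_norm (summable_geometric_bound B) ?_
      Metric.isOpen_ball ?_
    · intro i
      fun_prop
    · intro i ε hε
      exact norm_pow_smul_le (hc i) (mem_ball_zero_iff.1 hε).le
  exact this.analyticAt (Metric.ball_mem_nhds _ (by positivity))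

lemma diffContOnCl_tsum_pow_smul [CompleteSpace F] {u : ℕ → ℂ → F} {z₀ : ℂ} {R : ℝ}
    (hR : 0 < R) (hu : ∀ i, Differentiable ℂ (u i))
    (hc : ∀ i, ∀ z ∈ Metric.closedBall z₀ R, ‖u i z‖ * r ^ (i + 1) ≤ B) {ε : ℂ}
    (hε : ‖ε‖ ≤ r / 2) :
    DiffContOnCl ℂ (fun z => ∑' i, ε ^ (i + 1) • u i z) (Metric.ball z₀ R) := by
  constructor
  · refine Complex.differentiableOn_tsum_of_summable_norm (summable_geometric_bound B) ?_
      Metric.isOpen_ball ?_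
    · intro i
      exact ((hu i).const_smul _).differentiableOn
    · intro i z hz
      exact norm_pow_smul_le (hc i z (Metric.ball_subset_closedBall hz)) hε
  · rw [closure_ball _ hR.ne']
    refine continuousOn_tsum (fun i => ((hu i).const_smul _).continuous.continuousOn)
      (summable_geometric_bound B) ?_
    intro i z hz
    exact norm_pow_smul_le (hc i z hz) hε

end Cauchy

/-- The coefficient of the deformation part `∑_{i ≥ 1} ε^i η_i` on the `k`-th coordinate. -/
def deformationCoeff (η : ℕ → Fin 2 → MvPolynomial (Fin 2) ℂ) (k : Fin 2) (v : Plane × ℂ) : ℂ :=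
  ∑' i : ℕ, v.2 ^ (i + 1) * MvPolynomial.eval v.1 (η (i + 1) k)

/-- Cauchy's formula is applied in each of the two coordinates of the plane, to functions with
values in the Banach spaces of continuous functions on circles. -/
lemma analyticAt_deformationCoeff {η : ℕ → Fin 2 → MvPolynomial (Fin 2) ℂ}
    (hη : IsConvergentDeformation η) (k : Fin 2) (x : Plane) :
    AnalyticAt ℂ (deformationCoeff η k) (x, 0) := by
  obtain ⟨r, hr, B, hB⟩ := hη (Metric.closedBall x 1) (isCompact_closedBall x 1)
  have hB' : ∀ z₁ ∈ Metric.closedBall (x 0) 1, ∀ z₂ ∈ Metric.closedBall (x 1) 1, ∀ i : ℕ,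
      ‖MvPolynomial.eval ![z₁, z₂] (η (i + 1) k)‖ * r ^ (i + 1) ≤ B := by
    intro z₁ h₁ z₂ h₂ i
    refine hB _ ?_ (i + 1) (by omega) k
    rw [Metric.mem_closedBall, dist_pi_le_iff zero_le_one, Fin.forall_fin_two]
    exact ⟨h₁, h₂⟩
  have hB0 : 0 ≤ B := (by positivity : 0 ≤ ‖MvPolynomial.eval ![x 0, x 1] (η (0 + 1) k)‖ *
    r ^ (0 + 1)).trans (hB' _ (Metric.mem_closedBall_self zero_le_one) _
      (Metric.mem_closedBall_self zero_le_one) 0)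
  let S := Metric.sphere (x 1) 1
  let ι : C(S, ℂ) := ⟨fun w => (w : ℂ), by fun_prop⟩
  let u : ℕ → ℂ → C(S, ℂ) := fun i z =>
    MvPolynomial.aeval ![algebraMap ℂ C(S, ℂ) z, ι] (η (i + 1) k)
  have hu : ∀ i z w, u i z w = MvPolynomial.eval ![z, (w : ℂ)] (η (i + 1) k) := by
    intro i z w
    have h1 := MvPolynomial.comp_aeval_apply (φ := ContinuousMap.evalAlgHom ℂ ℂ w)
      (f := ![algebraMap ℂ C(S, ℂ) z, ι]) (η (i + 1) k)
    have h2 : (fun j => ContinuousMap.evalAlgHom ℂ ℂ w (![algebraMap ℂ C(S, ℂ) z, ι] j)) =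
        ![z, (w : ℂ)] := by
      funext j; fin_cases j <;> rfl
    rw [h2] at h1
    exact h1
  have hun : ∀ i, ∀ z ∈ Metric.closedBall (x 0) 1, ‖u i z‖ * r ^ (i + 1) ≤ B := by
    intro i z hz
    rw [← le_div_iff₀ (by positivity)]
    refine (ContinuousMap.norm_le _ (by positivity)).2 fun w => ?_
    rw [hu, le_div_iff₀ (by positivity)]
    exact hB' z hz w (Metric.sphere_subset_closedBall w.2) i
  have hud : ∀ i, Differentiable ℂ (u i) := by
    intro i z
    refine (AnalyticAt.aeval_mvPolynomial (fun j => ?_) _).differentiableAt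
    fin_cases j
    · exact (ContinuousLinearMap.const ℂ _ : ℂ →L[ℂ] C(S, ℂ)).analyticAt _
    · exact analyticAt_const
  have hε : ∀ᶠ ε : ℂ in 𝓝 0, ‖ε‖ ≤ r / 2 := by
    filter_upwards [Metric.closedBall_mem_nhds (0 : ℂ) (half_pos hr)] with ε h
    simpa using h
  have h1 : AnalyticAt ℂ (fun v : ℂ × ℂ => ∑' i, v.2 ^ (i + 1) • u i v.1) (x 0, 0) := by
    let c : ℕ → C(Metric.sphere (x 0) 1, C(S, ℂ)) := fun i =>
      ⟨fun w => u i w, (hud i).continuous.comp continuous_subtype_val⟩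
    have hc : ∀ i, ‖c i‖ * r ^ (i + 1) ≤ B := by
      intro i
      rw [← le_div_iff₀ (by positivity)]
      refine (ContinuousMap.norm_le _ (by positivity)).2 fun w => ?_
      rw [le_div_iff₀ (by positivity)]
      exact hun i w (Metric.sphere_subset_closedBall w.2)
    refine analyticAt_of_analyticAt_sphere zero_lt_one (analyticAt_tsum_pow_smul hr hc) ?_
    filter_upwards [hε] with ε hε
    refine ⟨diffContOnCl_tsum_pow_smul zero_lt_one hud hun hε, fun w => ?_⟩
    exact ((summable_pow_smul hc hε).hasSum.map (ContinuousMap.evalCLM ℂ w)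
      (ContinuousMap.evalCLM ℂ w).continuous).tsum_eq.symm
  have h2 : AnalyticAt ℂ (fun v : ℂ × (ℂ × ℂ) =>
      ∑' i, v.2.2 ^ (i + 1) • MvPolynomial.eval ![v.2.1, v.1] (η (i + 1) k)) (x 1, (x 0, 0)) := by
    refine analyticAt_of_analyticAt_sphere zero_lt_one h1 ?_
    have h3 : ∀ᶠ v : ℂ × ℂ in 𝓝 (x 0, 0), v.1 ∈ Metric.closedBall (x 0) 1 :=
      (continuous_fst.tendsto ((x 0, 0) : ℂ × ℂ)).eventually
        (Metric.closedBall_mem_nhds _ zero_lt_one)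
    filter_upwards [h3, (continuous_snd.tendsto ((x 0, 0) : ℂ × ℂ)).eventually hε] with v hv hvε
    refine ⟨diffContOnCl_tsum_pow_smul zero_lt_one ?_
      (fun i z hz => hB' v.1 hv z hz i) hvε, fun w => ?_⟩
    · intro i z
      refine (AnalyticAt.aeval_mvPolynomial (f := fun z => ![v.1, z]) (fun j => ?_)
        _).differentiableAt
      fin_cases j
      · exact analyticAt_const
      · exact analyticAt_id
    · have := ((summable_pow_smul (fun i => hun i v.1 hv) hvε).hasSum.map
        (ContinuousMap.evalCLM ℂ w) (ContinuousMap.evalCLM ℂ w).continuous).tsum_eq.symm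
      refine this.trans (tsum_congr fun i => ?_)
      simp [hu]
  have h4 : AnalyticAt ℂ (fun v : Plane × ℂ => (v.1 1, (v.1 0, v.2))) (x, 0) := by
    have h : ∀ j : Fin 2, AnalyticAt ℂ (fun v : Plane × ℂ => v.1 j) (x, 0) := fun j =>
      ((ContinuousLinearMap.proj j : Plane →L[ℂ] ℂ) ∘L .fst ℂ Plane ℂ).analyticAt _
    exact (h 1).prod ((h 0).prod analyticAt_snd)
  refine (AnalyticAt.comp_of_eq h2 h4 rfl).congr (Filter.Eventually.of_forall fun v => ?_)
  refine tsum_congr fun i => ?_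
  have : ![v.1 0, v.1 1] = v.1 := by funext j; fin_cases j <;> rfl
  simp [this]

end Melnikov

namespace Melnikov

/-! ### The foliation near a regular point -/

variable {F : MvPolynomial (Fin 2) ℂ} {η : ℕ → Fin 2 → MvPolynomial (Fin 2) ℂ} {t₀ : ℂ}

/-- The coefficients of the form `dF + ∑ ε^i η_i`, as functions of `(x, ε)`. -/
def formCoeff (F : MvPolynomial (Fin 2) ℂ) (η : ℕ → Fin 2 → MvPolynomial (Fin 2) ℂ) (k : Fin 2)
    (v : Plane × ℂ) : ℂ :=
  MvPolynomial.eval v.1 (MvPolynomial.pderiv k F) + deformationCoeff η k v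

/-- The vector field spanning the kernel of the form `dF + ∑ ε^i η_i`. -/
def leafField (F : MvPolynomial (Fin 2) ℂ) (η : ℕ → Fin 2 → MvPolynomial (Fin 2) ℂ)
    (v : Plane × ℂ) : Plane :=
  ![-formCoeff F η 1 v, formCoeff F η 0 v]

lemma formCoeff_zero (k : Fin 2) (y : Plane) :
    formCoeff F η k (y, 0) = MvPolynomial.eval y (MvPolynomial.pderiv k F) := by
  simp [formCoeff, deformationCoeff]

lemma deformedForm_eq (ε : ℂ) (x v : Plane) :
    deformedForm F η ε x v = formCoeff F η 0 (x, ε) * v 0 + formCoeff F η 1 (x, ε) * v 1 := by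
  simp [deformedForm, formCoeff, deformationCoeff, Fin.sum_univ_two]

lemma deformedForm_smul_leafField (ε c : ℂ) (x : Plane) :
    deformedForm F η ε x (c • leafField F η (x, ε)) = 0 := by
  simp [deformedForm_eq, leafField]
  ring

lemma exists_eq_smul_leafField {ε : ℂ} {x v : Plane} (h : deformedForm F η ε x v = 0)
    (hx : leafField F η (x, ε) ≠ 0) : ∃ c : ℂ, v = c • leafField F η (x, ε) := by
  rw [deformedForm_eq] at h
  by_cases h0 : formCoeff F η 0 (x, ε) = 0
  · have h1 : formCoeff F η 1 (x, ε) ≠ 0 := by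
      intro h1
      exact hx (by funext j; fin_cases j <;> simp [leafField, h0, h1])
    rw [h0, zero_mul, zero_add] at h
    have h2 := (mul_eq_zero.1 h).resolve_left h1
    refine ⟨-v 0 / formCoeff F η 1 (x, ε), ?_⟩
    funext j
    fin_cases j
    · simp [leafField]; field_simp
    · simp [leafField, h0, h2]
  · refine ⟨v 1 / formCoeff F η 0 (x, ε), ?_⟩
    funext j
    fin_cases j
    · simp [leafField]; field_simp; linear_combination h
    · simp [leafField]; field_simp

lemma analyticAt_formCoeff (hη : IsConvergentDeformation η) (k : Fin 2) (x : Plane) :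
    AnalyticAt ℂ (formCoeff F η k) (x, 0) := by
  refine AnalyticAt.add ?_ (analyticAt_deformationCoeff hη k x)
  have h := AnalyticOnNhd.eval_mvPolynomial (𝕜 := ℂ) (MvPolynomial.pderiv k F) x (Set.mem_univ _)
  exact AnalyticAt.comp_of_eq (g := fun y : Plane => MvPolynomial.eval y (MvPolynomial.pderiv k F))
    (f := fun v : Plane × ℂ => v.1) h analyticAt_fst rfl

lemma analyticAt_leafField (hη : IsConvergentDeformation η) (x : Plane) :
    AnalyticAt ℂ (leafField F η) (x, 0) := by
  refine analyticAt_pi_iff.2 fun j => ?_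
  fin_cases j
  · exact (analyticAt_formCoeff hη 1 x).neg
  · exact analyticAt_formCoeff hη 0 x

lemma analyticAt_eval (F : MvPolynomial (Fin 2) ℂ) (x : Plane) :
    AnalyticAt ℂ (fun y : Plane => MvPolynomial.eval y F) x :=
  AnalyticOnNhd.eval_mvPolynomial F x (Set.mem_univ _)

lemma continuous_eval (F : MvPolynomial (Fin 2) ℂ) :
    Continuous fun y : Plane => MvPolynomial.eval y F :=
  MvPolynomial.continuous_eval F

lemma fderiv_eval (F : MvPolynomial (Fin 2) ℂ) (x v : Plane) :
    fderiv ℂ (fun y : Plane => MvPolynomial.eval y F) x v =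
      MvPolynomial.eval x (MvPolynomial.pderiv 0 F) * v 0 +
        MvPolynomial.eval x (MvPolynomial.pderiv 1 F) * v 1 := by
  have hd : ∀ G : MvPolynomial (Fin 2) ℂ,
      DifferentiableAt ℂ (fun y : Plane => MvPolynomial.eval y G) x := fun G =>
    (analyticAt_eval G x).differentiableAt
  induction F using MvPolynomial.induction_on with
  | C a => simp
  | add p q hp hq =>
    simp only [map_add]
    rw [fderiv_fun_add (hd p) (hd q), add_apply, hp, hq]
    ring
  | mul_X p j hp =>
    have h1 : fderiv ℂ (fun y : Plane => MvPolynomial.eval y (MvPolynomial.X j)) x v = v j := by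
      simp only [MvPolynomial.eval_X]
      rw [(hasFDerivAt_apply (𝕜 := ℂ) j x).fderiv]
      rfl
    simp only [map_mul]
    rw [fderiv_fun_mul (hd p) (hd _)]
    simp only [add_apply, smul_apply, h1, hp]
    fin_cases j <;> simp [MvPolynomial.pderiv_X] <;> ring

lemma fderiv_eval_leafField (y : Plane) :
    fderiv ℂ (fun y : Plane => MvPolynomial.eval y F) y (leafField F η (y, 0)) = 0 := by
  rw [fderiv_eval]
  simp [leafField, formCoeff_zero]
  ring

/-- A map with a local section differentiable along the real directions has nonzero derivative. -/
lemma ne_zero_of_differentiableAt_section {E : Type*} [NormedAddCommGroup E] [NormedSpace ℝ E]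
    {f : E → ℂ} {T : E → ℂ → E} {x : E} {t : ℂ} {f' : E →L[ℝ] ℂ}
    (hT : DifferentiableAt ℝ (fun z : E × ℂ => T z.1 z.2) (x, t)) (hx : T x t = x)
    (hs : ∀ᶠ s in 𝓝 t, f (T x s) = s) (hf : HasFDerivAt f f' x) : f' ≠ 0 := by
  rintro rfl
  have h1 : HasFDerivAt (fun s : ℂ => (x, s)) (.inr ℝ E ℂ) t := hasFDerivAt_prodMk_right _ _
  have h2 := hT.hasFDerivAt.comp t h1
  have h3 := (hx.symm ▸ hf : HasFDerivAt f 0 (T x t)).comp t h2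
  have h5 := h3.unique ((hasFDerivAt_id (𝕜 := ℝ) t).congr_of_eventuallyEq hs)
  have := DFunLike.congr_fun h5 1
  simp at this

/-- The points of a typical fiber are regular: the transport to the nearby fibers is a section of
`F`. -/
lemma IsTypicalValue.fderiv_ne_zero (ht : IsTypicalValue F t₀) (x : Fiber F t₀) :
    fderiv ℂ (fun y : Plane => MvPolynomial.eval y F) x ≠ 0 := by
  obtain ⟨D, T, hD, htD, hT, hT'⟩ := ht
  have hxD : MvPolynomial.eval (x : Plane) F ∈ D := by rw [x.2]; exact htD
  obtain ⟨h1, h2⟩ := hT' x hxD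
  rw [x.2] at h1
  have hopen : IsOpen {z : Plane × ℂ | MvPolynomial.eval z.1 F ∈ D ∧ z.2 ∈ D} :=
    (hD.preimage ((continuous_eval F).comp continuous_fst)).inter (hD.preimage continuous_snd)
  have hc := hT.contDiffAt (hopen.mem_nhds (x := ((x : Plane), t₀)) ⟨hxD, htD⟩)
  have hTd := hc.differentiableAt (by simp)
  intro h0
  have hF := (analyticAt_eval F (x : Plane)).differentiableAt.hasFDerivAt.restrictScalars ℝ
  refine ne_zero_of_differentiableAt_section hTd h1 ?_ hF (by rw [h0]; rfl)
  filter_upwards [hD.mem_nhds htD] with s hs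
  exact (h2 s hs).1

lemma leafField_ne_zero {x : Plane}
    (hx : fderiv ℂ (fun y : Plane => MvPolynomial.eval y F) x ≠ 0) : leafField F η (x, 0) ≠ 0 := by
  intro h
  refine hx ?_
  ext v
  have h0 := congrFun h 0
  have h1 := congrFun h 1
  simp only [leafField, formCoeff_zero] at h0 h1
  simp only [Matrix.cons_val_zero, Matrix.cons_val_one, Pi.zero_apply, neg_eq_zero] at h0 h1
  rw [fderiv_eval, h0, h1]
  simp

/-- `Φ` is (a representative of the germ at `(x, 0)` of) a first integral of the deformed
foliation, analytic in `(y, ε)` and equal to `F` for `ε = 0`. -/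
structure IsFirstIntegralAt (F : MvPolynomial (Fin 2) ℂ) (η : ℕ → Fin 2 → MvPolynomial (Fin 2) ℂ)
    (x : Plane) (Φ : Plane × ℂ → ℂ) : Prop where
  analyticAt : AnalyticAt ℂ Φ (x, 0)
  eventually_fderiv : ∀ᶠ v in 𝓝 ((x, 0) : Plane × ℂ), fderiv ℂ Φ v (leafField F η v, 0) = 0
  eventually_eq : ∀ᶠ y in 𝓝 x, Φ (y, 0) = MvPolynomial.eval y F

lemma tendsto_prodMk_zero {E : Type*} [TopologicalSpace E] (x : E) :
    Filter.Tendsto (fun y : E => (y, (0 : ℂ))) (𝓝 x) (𝓝 (x, 0)) :=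
  (Continuous.prodMk_left (0 : ℂ)).tendsto x

lemma IsFirstIntegralAt.eventually {x : Plane} {Φ : Plane × ℂ → ℂ}
    (h : IsFirstIntegralAt F η x Φ) : ∀ᶠ y in 𝓝 x, IsFirstIntegralAt F η y Φ := by
  filter_upwards [(tendsto_prodMk_zero x).eventually h.analyticAt.eventually_analyticAt,
    (tendsto_prodMk_zero x).eventually h.eventually_fderiv.eventually_nhds,
    h.eventually_eq.eventually_nhds] with y h1 h2 h3
  exact ⟨h1, h2, h3⟩

lemma IsFirstIntegralAt.congr {x : Plane} {Φ Ψ : Plane × ℂ → ℂ} (h : IsFirstIntegralAt F η x Φ)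
    (he : Φ =ᶠ[𝓝 (x, 0)] Ψ) : IsFirstIntegralAt F η x Ψ := by
  refine ⟨h.analyticAt.congr he, ?_, ?_⟩
  · filter_upwards [h.eventually_fderiv, he.eventually_nhds] with v hv hv'
    rwa [← Filter.EventuallyEq.fderiv_eq hv']
  · filter_upwards [h.eventually_eq, (tendsto_prodMk_zero x).eventually he] with y h1 h2
    rw [← h2, h1]

lemma IsFirstIntegralAt.apply_zero {x : Fiber F t₀} {Φ : Plane × ℂ → ℂ}
    (h : IsFirstIntegralAt F η x Φ) : Φ (x, 0) = t₀ := by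
  rw [h.eventually_eq.self_of_nhds, x.2]

/-- A family of functions of `z` with zero derivative near `z = 0` does not depend on `z`. -/
lemma eventually_eq_of_hasDerivAt_zero {E G : Type*} [NormedAddCommGroup E]
    [NormedAddCommGroup G] [NormedSpace ℂ G] {f : E × ℂ → G} {e₀ : E}
    (h : ∀ᶠ v in 𝓝 ((e₀, 0) : E × ℂ), HasDerivAt (fun z => f (v.1, z)) 0 v.2) :
    ∀ᶠ v in 𝓝 ((e₀, 0) : E × ℂ), f v = f (v.1, 0) := by
  obtain ⟨ρ, hρ, hball⟩ := Metric.eventually_nhds_iff_ball.1 h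
  filter_upwards [Metric.ball_mem_nhds _ hρ] with v hv
  rw [Metric.mem_ball, Prod.dist_eq, max_lt_iff] at hv
  have hd : ∀ z ∈ Metric.ball (0 : ℂ) ρ, HasDerivAt (fun z => f (v.1, z)) 0 z := by
    intro z hz
    refine hball (v.1, z) ?_
    rw [Metric.mem_ball, Prod.dist_eq, max_lt_iff]
    exact ⟨hv.1, hz⟩
  exact Metric.isOpen_ball.is_const_of_deriv_eq_zero (convex_ball (0 : ℂ) ρ).isPreconnected
    (fun z hz => (hd z hz).differentiableAt.differentiableWithinAt)
    (fun z hz => (hd z hz).deriv) hv.2 (Metric.mem_ball_self hρ)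

lemma IsTransversal.fderiv_eval_deriv {x : Fiber F t₀} {p : ℂ → Plane} (hp : IsTransversal F x p) :
    fderiv ℂ (fun y : Plane => MvPolynomial.eval y F) x (deriv p t₀) = 1 := by
  have h1 : HasFDerivAt (fun y : Plane => MvPolynomial.eval y F)
      (fderiv ℂ (fun y : Plane => MvPolynomial.eval y F) x) (p t₀) := by
    rw [hp.2.1]
    exact (analyticAt_eval F _).differentiableAt.hasFDerivAt
  have h2 := h1.comp_hasDerivAt t₀ hp.1.differentiableAt.hasDerivAt
  exact h2.unique ((hasDerivAt_id t₀).congr_of_eventuallyEq hp.2.2)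

/-- Through every regular point passes an analytic transversal. -/
lemma exists_isTransversal {x : Fiber F t₀}
    (hx : fderiv ℂ (fun y : Plane => MvPolynomial.eval y F) x ≠ 0) :
    ∃ p, IsTransversal F x p := by
  obtain ⟨v, hv⟩ : ∃ v, fderiv ℂ (fun y : Plane => MvPolynomial.eval y F) x v ≠ 0 := by
    by_contra! h
    exact hx (by ext v; simp [h])
  let f : ℂ → ℂ := fun z => MvPolynomial.eval ((x : Plane) + z • v) F
  have hl : AnalyticAt ℂ (fun z : ℂ => (x : Plane) + z • v) 0 :=
    analyticAt_const.add (analyticAt_id.smul analyticAt_const)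
  have hl0 : (x : Plane) + (0 : ℂ) • v = x := by simp
  have hfa : AnalyticAt ℂ f 0 := AnalyticAt.comp_of_eq
    (g := fun y : Plane => MvPolynomial.eval y F) (analyticAt_eval F x) hl hl0
  have hf0 : f 0 = t₀ := by simp only [f, hl0, x.2]
  have h1 : HasFDerivAt (fun y : Plane => MvPolynomial.eval y F)
      (fderiv ℂ (fun y : Plane => MvPolynomial.eval y F) x) ((x : Plane) + (0 : ℂ) • v) := by
    rw [hl0]
    exact (analyticAt_eval F _).differentiableAt.hasFDerivAt
  have hfd : HasDerivAt f (fderiv ℂ (fun y : Plane => MvPolynomial.eval y F) x v) 0 := by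
    refine HasFDerivAt.comp_hasDerivAt (f := fun z : ℂ => (x : Plane) + z • v) (0 : ℂ) h1 ?_
    simpa using ((hasDerivAt_id (0 : ℂ)).smul_const v).const_add (x : Plane)
  have he : HasFDerivAt f
      ((ContinuousLinearEquiv.unitsEquivAut ℂ (Units.mk0 _ hv) : ℂ ≃L[ℂ] ℂ) : ℂ →L[ℂ] ℂ) 0 := by
    refine hfd.hasFDerivAt.congr_fderiv (ContinuousLinearMap.ext_ring ?_)
    simp
  obtain ⟨g, hg, hg0, -, hfg⟩ := exists_analyticAt_inverse hfa he
  rw [hf0] at hg hg0 hfg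
  refine ⟨fun t => (x : Plane) + g t • v, ?_, ?_, hfg⟩
  · exact analyticAt_const.add (hg.smul analyticAt_const)
  · simp [hg0]

/-- A flow box of the deformed foliation around a point `x` of the fiber over `t₀`. The plaques are
`z ↦ χ ((t, ε), z)`, the plaque of `(t, ε)` starts at the point `p t` of the transversal `p`, and
`y ↦ (Φ (y, ε), ζ (y, ε))` are the inverse coordinates; `Φ` is a first integral. -/
lemma exists_flowBox (hη : IsConvergentDeformation η) {x : Fiber F t₀}
    (hx : fderiv ℂ (fun y : Plane => MvPolynomial.eval y F) x ≠ 0) {p : ℂ → Plane}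
    (hp : IsTransversal F x p) :
    ∃ (χ : (ℂ × ℂ) × ℂ → Plane) (Φ ζ : Plane × ℂ → ℂ),
      AnalyticAt ℂ χ ((t₀, 0), 0) ∧ χ ((t₀, 0), 0) = x ∧ IsFirstIntegralAt F η x Φ ∧
      AnalyticAt ℂ ζ (x, 0) ∧ ζ (x, 0) = 0 ∧
      (∀ᶠ q in 𝓝 ((t₀, 0) : ℂ × ℂ), Φ (p q.1, q.2) = q.1) ∧
      (∀ᶠ w in 𝓝 (((t₀, 0), 0) : (ℂ × ℂ) × ℂ),
        HasDerivAt (fun z => χ (w.1, z)) (leafField F η (χ w, w.1.2)) w.2 ∧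
        Φ (χ w, w.1.2) = w.1.1 ∧ ζ (χ w, w.1.2) = w.2) ∧
      ∀ᶠ v in 𝓝 (((x : Plane), 0) : Plane × ℂ), χ ((Φ v, v.2), ζ v) = v.1 := by
  have hXa : AnalyticAt ℂ (fun v => (leafField F η v, (0 : ℂ))) ((x : Plane), 0) :=
    (analyticAt_leafField hη x).prod analyticAt_const
  -- `ψ` is the flow of the field `(leafField, 0)`; it does not change the parameter `ε`
  obtain ⟨ψ, hψ, hψ0, hψd⟩ := exists_analyticAt_flow hXa
  have hψ2 : ∀ᶠ v in 𝓝 ((((x : Plane), 0), 0) : (Plane × ℂ) × ℂ), (ψ v).2 = v.1.2 := by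
    have h1 := eventually_eq_of_hasDerivAt_zero (f := fun v => (ψ v).2)
      (e₀ := (((x : Plane), 0) : Plane × ℂ))
      (hψd.mono fun v hv => HasFDerivAt.comp_hasDerivAt (l := fun u : Plane × ℂ => u.2) v.2
        hasFDerivAt_snd hv)
    filter_upwards [h1, (continuous_fst.tendsto
      ((((x : Plane), 0), 0) : (Plane × ℂ) × ℂ)).eventually hψ0] with v h1 h2
    rw [h1, h2]
  -- the box `Θ` is the flow started at the points of the transversal
  let P : (ℂ × ℂ) × ℂ → (Plane × ℂ) × ℂ := fun w => ((p w.1.1, w.1.2), w.2)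
  have hP : AnalyticAt ℂ P ((t₀, 0), 0) := by
    have h1 : AnalyticAt ℂ (fun w : (ℂ × ℂ) × ℂ => p w.1.1) ((t₀, 0), 0) :=
      AnalyticAt.comp_of_eq hp.1 (analyticAt_fst.comp analyticAt_fst) rfl
    exact (h1.prod (analyticAt_snd.comp analyticAt_fst)).prod analyticAt_snd
  have hP0 : P ((t₀, 0), 0) = (((x : Plane), 0), 0) := by simp [P, hp.2.1]
  have hPt : Filter.Tendsto P (𝓝 ((t₀, 0), 0)) (𝓝 (((x : Plane), 0), 0)) :=
    hP0 ▸ hP.continuousAt.tendsto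
  let Θ : (ℂ × ℂ) × ℂ → Plane × ℂ := fun w => ψ (P w)
  have hΘ : AnalyticAt ℂ Θ ((t₀, 0), 0) := AnalyticAt.comp_of_eq hψ hP hP0
  have hΘ2 : ∀ᶠ w in 𝓝 (((t₀, 0), 0) : (ℂ × ℂ) × ℂ), (Θ w).2 = w.1.2 := hPt.eventually hψ2
  have hin : Filter.Tendsto (fun q : ℂ × ℂ => (q, (0 : ℂ))) (𝓝 (t₀, 0)) (𝓝 ((t₀, 0), 0)) :=
    (Continuous.prodMk_left (0 : ℂ)).tendsto (t₀, 0)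
  have hpq : Filter.Tendsto (fun q : ℂ × ℂ => (p q.1, q.2)) (𝓝 (t₀, 0)) (𝓝 ((x : Plane), 0)) :=
    ((continuous_fst.tendsto _).comp (hPt.comp hin))
  have hΘ0 : ∀ᶠ q in 𝓝 ((t₀, 0) : ℂ × ℂ), Θ (q, 0) = (p q.1, q.2) := hpq.eventually hψ0
  have hΘb : Θ ((t₀, 0), 0) = ((x : Plane), 0) := by
    have := hΘ0.self_of_nhds
    simpa [hp.2.1] using this
  have hΘd : ∀ᶠ w in 𝓝 (((t₀, 0), 0) : (ℂ × ℂ) × ℂ),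
      HasDerivAt (fun z => Θ (w.1, z)) (leafField F η (Θ w), 0) w.2 := hPt.eventually hψd
  set L := fderiv ℂ Θ ((t₀, 0), 0) with hL
  have hLd : HasFDerivAt Θ L ((t₀, 0), 0) := hΘ.differentiableAt.hasFDerivAt
  -- the derivative at the base point
  have hL1 : ∀ q : ℂ × ℂ, L (q, 0) = (q.1 • deriv p t₀, q.2) := by
    have h1 := hLd.comp ((t₀, 0) : ℂ × ℂ) (hasFDerivAt_prodMk_left (𝕜 := ℂ) ((t₀, 0) : ℂ × ℂ) (0 : ℂ))
    have h2 : HasFDerivAt (fun q : ℂ × ℂ => (p q.1, q.2))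
        (((ContinuousLinearMap.toSpanSingleton ℂ (deriv p t₀)).comp
          (ContinuousLinearMap.fst ℂ ℂ ℂ)).prod (ContinuousLinearMap.snd ℂ ℂ ℂ)) (t₀, 0) := by
      refine HasFDerivAt.prodMk ?_ hasFDerivAt_snd
      exact HasFDerivAt.comp (f := fun q : ℂ × ℂ => q.1) ((t₀, 0) : ℂ × ℂ)
        hp.1.differentiableAt.hasDerivAt.hasFDerivAt hasFDerivAt_fst
    have h3 := h1.unique (h2.congr_of_eventuallyEq hΘ0)
    intro q
    exact DFunLike.congr_fun h3 q
  have hL2 : L ((0, 0), 1) = (leafField F η ((x : Plane), 0), 0) := by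
    have h1 := hLd.comp_hasDerivAt (0 : ℂ) (f := fun z : ℂ => (((t₀, 0), z) : (ℂ × ℂ) × ℂ))
      ((hasDerivAt_const _ _).prodMk (hasDerivAt_id _))
    have h2 := h1.unique hΘd.self_of_nhds
    rw [hΘb] at h2
    exact h2
  have hLw : ∀ w, L w = (w.1.1 • deriv p t₀ + w.2 • leafField F η ((x : Plane), 0), w.1.2) := by
    intro w
    have h1 : w = (w.1, 0) + w.2 • ((0, 0), 1) := by ext <;> simp
    rw [h1, map_add, map_smul, hL1, hL2]
    simp
  have hinj : Function.Injective L := by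
    refine (injective_iff_map_eq_zero L).2 fun w hw => ?_
    rw [hLw, Prod.mk_eq_zero] at hw
    obtain ⟨h1, h2⟩ := hw
    have h3 := congrArg (fderiv ℂ (fun y : Plane => MvPolynomial.eval y F) x) h1
    rw [map_add, map_smul, map_smul, hp.fderiv_eval_deriv, fderiv_eval_leafField, map_zero] at h3
    have h4 : w.1.1 = 0 := by simpa using h3
    rw [h4, zero_smul, zero_add] at h1
    have h5 := (smul_eq_zero.1 h1).resolve_right (leafField_ne_zero hx)
    exact Prod.ext (Prod.ext h4 h2) h5
  let e : ((ℂ × ℂ) × ℂ) ≃L[ℂ] (Plane × ℂ) :=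
    (LinearEquiv.ofInjectiveOfFinrankEq (L : ((ℂ × ℂ) × ℂ) →ₗ[ℂ] (Plane × ℂ)) hinj
      (by simp)).toContinuousLinearEquiv
  have he : (e : ((ℂ × ℂ) × ℂ) →L[ℂ] (Plane × ℂ)) = L := by ext <;> rfl
  obtain ⟨g, hg, hgb, hgΘ, hΘg⟩ := exists_analyticAt_inverse hΘ (he ▸ hLd)
  rw [hΘb] at hg hgb hΘg
  have hgt : Filter.Tendsto g (𝓝 ((x : Plane), 0)) (𝓝 ((t₀, 0), 0)) := hgb ▸ hg.continuousAt.tendsto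
  have hg2 : ∀ᶠ v in 𝓝 (((x : Plane), 0) : Plane × ℂ), (g v).1.2 = v.2 := by
    filter_upwards [hΘg, hgt.eventually hΘ2] with v h1 h2
    rw [← h2, h1]
  have hχ : ∀ᶠ w in 𝓝 (((t₀, 0), 0) : (ℂ × ℂ) × ℂ), Θ w = ((Θ w).1, w.1.2) := by
    filter_upwards [hΘ2] with w hw
    rw [← hw]
  let Φ : Plane × ℂ → ℂ := fun v => (g v).1.1
  have hΦ : AnalyticAt ℂ Φ ((x : Plane), 0) :=
    ((ContinuousLinearMap.fst ℂ ℂ ℂ ∘L .fst ℂ (ℂ × ℂ) ℂ).analyticAt _).comp hg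
  have hΦΘ : ∀ᶠ w in 𝓝 (((t₀, 0), 0) : (ℂ × ℂ) × ℂ), Φ (Θ w) = w.1.1 := by
    filter_upwards [hgΘ] with w hw
    simp only [Φ, hw]
  refine ⟨fun w => (Θ w).1, Φ, fun v => (g v).2, analyticAt_fst.comp hΘ,
    congrArg Prod.fst hΘb, ⟨hΦ, ?_, ?_⟩, analyticAt_snd.comp hg, congrArg Prod.snd hgb,
    ?_, ?_, ?_⟩
  · have h1 : ∀ᶠ w in 𝓝 (((t₀, 0), 0) : (ℂ × ℂ) × ℂ),
        fderiv ℂ Φ (Θ w) (leafField F η (Θ w), 0) = 0 := by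
      filter_upwards [hΘd, (hΘb ▸ hΘ.continuousAt.tendsto).eventually hΦ.eventually_analyticAt,
        hΦΘ.eventually_nhds] with w h1 h2 h3
      have h4 := HasFDerivAt.comp_hasDerivAt (l := Φ) w.2 h2.differentiableAt.hasFDerivAt h1
      have hz : Filter.Tendsto (fun z : ℂ => (w.1, z)) (𝓝 w.2) (𝓝 w) :=
        (Continuous.prodMk_right w.1).tendsto w.2
      exact h4.unique ((hasDerivAt_const w.2 w.1.1).congr_of_eventuallyEq (hz.eventually h3))
    filter_upwards [hΘg, hgt.eventually h1] with v h2 h3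
    rwa [h2] at h3
  · -- for `ε = 0` the polynomial `F` is constant on the plaques
    have h1 : ∀ᶠ v in 𝓝 ((t₀, 0) : ℂ × ℂ), HasDerivAt
        (fun z => MvPolynomial.eval (Θ ((v.1, 0), z)).1 F) 0 v.2 := by
      have hl : Filter.Tendsto (fun v : ℂ × ℂ => (((v.1, 0), v.2) : (ℂ × ℂ) × ℂ)) (𝓝 (t₀, 0))
          (𝓝 ((t₀, 0), 0)) := Continuous.tendsto (by fun_prop) ((t₀, 0) : ℂ × ℂ)
      filter_upwards [hl.eventually hΘd, hl.eventually hχ] with v h1 h2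
      have h3 := HasFDerivAt.comp_hasDerivAt (f := fun z => (Θ ((v.1, 0), z)).1) v.2
        (analyticAt_eval F _).differentiableAt.hasFDerivAt (hasFDerivAt_fst.comp_hasDerivAt v.2 h1)
      rw [h2] at h3
      have h4 := fderiv_eval_leafField (F := F) (η := η) (Θ ((v.1, 0), v.2)).1
      exact (h3.congr_deriv h4 :)
    have h2 := eventually_eq_of_hasDerivAt_zero
      (f := fun v : ℂ × ℂ => MvPolynomial.eval (Θ ((v.1, 0), v.2)).1 F) h1
    have hl : Filter.Tendsto (fun v : ℂ => (v, (0 : ℂ))) (𝓝 t₀) (𝓝 (t₀, 0)) :=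
      (Continuous.prodMk_left (0 : ℂ)).tendsto t₀
    have h3 : ∀ᶠ v in 𝓝 ((t₀, 0) : ℂ × ℂ), MvPolynomial.eval (Θ ((v.1, 0), v.2)).1 F = v.1 := by
      filter_upwards [h2, (continuous_fst.tendsto ((t₀, 0) : ℂ × ℂ)).eventually hp.2.2,
        (continuous_fst.tendsto ((t₀, 0) : ℂ × ℂ)).eventually (hl.eventually hΘ0)] with v h2 h3 h4
      rw [h2, h4, h3]
    have h4 : Filter.Tendsto (fun v => ((g v).1.1, (g v).2)) (𝓝 ((x : Plane), 0)) (𝓝 (t₀, 0)) :=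
      ((Continuous.tendsto (by fun_prop) (((t₀, 0), 0) : (ℂ × ℂ) × ℂ) : Filter.Tendsto
        (fun w : (ℂ × ℂ) × ℂ => (w.1.1, w.2)) _ (𝓝 (t₀, 0)))).comp hgt
    filter_upwards [(tendsto_prodMk_zero (x : Plane)).eventually (h4.eventually h3),
      (tendsto_prodMk_zero (x : Plane)).eventually hΘg,
      (tendsto_prodMk_zero (x : Plane)).eventually hg2] with y h5 h6 h7
    have h8 : (((g (y, 0)).1.1, 0), (g (y, 0)).2) = g (y, 0) :=
      Prod.ext (Prod.ext rfl h7.symm) rfl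
    rw [h8, h6] at h5
    exact h5.symm
  · filter_upwards [hΘ0, hin.eventually hΦΘ] with q h1 h2
    rw [← h1, h2]
  · filter_upwards [hΘd, hχ, hgΘ] with w h1 h2 h3
    rw [← h2]
    refine ⟨HasFDerivAt.comp_hasDerivAt (l := fun u : Plane × ℂ => u.1) w.2 hasFDerivAt_fst h1,
      ?_, ?_⟩
    · simp only [Φ, h3]
    · simp only [h3]
  · filter_upwards [hΘg, hg2] with v h1 h2
    have h3 : (((Φ v, v.2), (g v).2) : (ℂ × ℂ) × ℂ) = g v :=
      Prod.ext (Prod.ext rfl h2.symm) rfl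
    rw [h3, h1]

end Melnikov

namespace Melnikov

/-! ### Germs of holonomy maps -/

variable {F : MvPolynomial (Fin 2) ℂ} {η : ℕ → Fin 2 → MvPolynomial (Fin 2) ℂ} {t₀ : ℂ}

/-- `g (t, ε)` is analytic at `(t₀, 0)` and the identity for `ε = 0`. The germs of these functions
form the group of holonomy maps, under composition in the variable `t`. -/
structure IsHolonomyGerm (t₀ : ℂ) (g : ℂ × ℂ → ℂ) : Prop where
  analyticAt : AnalyticAt ℂ g (t₀, 0)
  eventually_eq : ∀ᶠ t in 𝓝 t₀, g (t, 0) = t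

/-- The composition `g (f (v, ε), ε)` of families of maps depending on the parameter `ε`. -/
def compGerm {E : Type*} (g : ℂ × ℂ → ℂ) (f : E × ℂ → ℂ) : E × ℂ → ℂ := fun v => g (f v, v.2)

section compGerm

variable {E : Type*}

lemma tendsto_prodMk_snd [TopologicalSpace E] {f : E × ℂ → ℂ} {x : E}
    (hf : ContinuousAt f (x, 0)) {t : ℂ} (h0 : f (x, 0) = t) :
    Filter.Tendsto (fun v : E × ℂ => (f v, v.2)) (𝓝 (x, 0)) (𝓝 (t, 0)) :=
  (h0 ▸ hf.tendsto).prodMk_nhds (continuous_snd.tendsto (x, (0 : ℂ)))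

lemma compGerm_congr_left [TopologicalSpace E] {g g' : ℂ × ℂ → ℂ} {f : E × ℂ → ℂ} {x : E} {t : ℂ}
    (h : g =ᶠ[𝓝 (t, 0)] g') (hf : ContinuousAt f (x, 0)) (h0 : f (x, 0) = t) :
    compGerm g f =ᶠ[𝓝 (x, 0)] compGerm g' f :=
  (tendsto_prodMk_snd hf h0).eventually h

lemma compGerm_congr_right [TopologicalSpace E] {g : ℂ × ℂ → ℂ} {f f' : E × ℂ → ℂ} {x : E}
    (h : f =ᶠ[𝓝 (x, 0)] f') : compGerm g f =ᶠ[𝓝 (x, 0)] compGerm g f' := by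
  filter_upwards [h] with v hv
  simp only [compGerm, hv]

lemma analyticAt_compGerm [NormedAddCommGroup E] [NormedSpace ℂ E] {g : ℂ × ℂ → ℂ}
    {f : E × ℂ → ℂ} {x : E} {t : ℂ} (hg : AnalyticAt ℂ g (t, 0)) (hf : AnalyticAt ℂ f (x, 0))
    (h0 : f (x, 0) = t) : AnalyticAt ℂ (compGerm g f) (x, 0) :=
  AnalyticAt.comp_of_eq (f := fun v : E × ℂ => (f v, v.2)) hg (hf.prod analyticAt_snd)
    (by simp [h0])

end compGerm

/-- A first integral restricted to a transversal is a holonomy germ. -/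
lemma IsTransversal.isHolonomyGerm {x : Fiber F t₀} {p : ℂ → Plane} (hp : IsTransversal F x p)
    {Φ : Plane × ℂ → ℂ} (hΦ : IsFirstIntegralAt F η x Φ) :
    IsHolonomyGerm t₀ fun z => Φ (p z.1, z.2) := by
  refine ⟨AnalyticAt.comp_of_eq (f := fun z : ℂ × ℂ => (p z.1, z.2)) hΦ.analyticAt
    ((AnalyticAt.comp_of_eq hp.1 analyticAt_fst rfl).prod analyticAt_snd) (by simp [hp.2.1]), ?_⟩
  have hpc : Filter.Tendsto p (𝓝 t₀) (𝓝 (x : Plane)) := by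
    have := hp.1.continuousAt.tendsto
    rwa [hp.2.1] at this
  filter_upwards [hpc.eventually hΦ.eventually_eq, hp.2.2] with t h1 h2
  rw [h1, h2]

namespace IsHolonomyGerm

lemma apply_zero {g : ℂ × ℂ → ℂ} (h : IsHolonomyGerm t₀ g) : g (t₀, 0) = t₀ :=
  h.eventually_eq.self_of_nhds

lemma fst (t₀ : ℂ) : IsHolonomyGerm t₀ Prod.fst :=
  ⟨analyticAt_fst, Filter.Eventually.of_forall fun _ => rfl⟩

lemma congr {g g' : ℂ × ℂ → ℂ} (h : IsHolonomyGerm t₀ g) (he : g =ᶠ[𝓝 (t₀, 0)] g') :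
    IsHolonomyGerm t₀ g' :=
  ⟨h.analyticAt.congr he, by
    filter_upwards [h.eventually_eq, (tendsto_prodMk_zero t₀).eventually he] with t h1 h2
    rw [← h2, h1]⟩

lemma comp {a b : ℂ × ℂ → ℂ} (ha : IsHolonomyGerm t₀ a) (hb : IsHolonomyGerm t₀ b) :
    IsHolonomyGerm t₀ (compGerm a b) :=
  ⟨analyticAt_compGerm ha.analyticAt hb.analyticAt hb.apply_zero, by
    filter_upwards [ha.eventually_eq, hb.eventually_eq] with t h1 h2
    simp only [compGerm, h2, h1]⟩

/-- The inverse function theorem applies to `(t, ε) ↦ (g (t, ε), ε)`, since the derivative of `g`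
in `t` is `1`. -/
lemma exists_inverse {g : ℂ × ℂ → ℂ} (hg : IsHolonomyGerm t₀ g) :
    ∃ h, IsHolonomyGerm t₀ h ∧ compGerm g h =ᶠ[𝓝 (t₀, 0)] Prod.fst ∧
      compGerm h g =ᶠ[𝓝 (t₀, 0)] Prod.fst := by
  let G : ℂ × ℂ → ℂ × ℂ := fun q => (g q, q.2)
  have hG : AnalyticAt ℂ G (t₀, 0) := hg.analyticAt.prod analyticAt_snd
  have hG0 : G (t₀, 0) = (t₀, 0) := by simp [G, hg.apply_zero]
  set L := fderiv ℂ g (t₀, 0)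
  have hL1 : L (1, 0) = 1 := by
    have h1 := hg.analyticAt.differentiableAt.hasFDerivAt.comp_hasDerivAt t₀
      (f := fun t : ℂ => (t, (0 : ℂ))) ((hasDerivAt_id t₀).prodMk (hasDerivAt_const _ _))
    exact h1.unique ((hasDerivAt_id t₀).congr_of_eventuallyEq hg.eventually_eq)
  have hL : ∀ q : ℂ × ℂ, L q = q.1 + q.2 * L (0, 1) := by
    intro q
    have : q = q.1 • ((1 : ℂ), (0 : ℂ)) + q.2 • ((0 : ℂ), (1 : ℂ)) := by ext <;> simp
    conv_lhs => rw [this, map_add, map_smul, map_smul, hL1]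
    simp
  have hGd : HasFDerivAt G (L.prod (.snd ℂ ℂ ℂ)) (t₀, 0) :=
    hg.analyticAt.differentiableAt.hasFDerivAt.prodMk hasFDerivAt_snd
  have hinj : Function.Injective (L.prod (.snd ℂ ℂ ℂ)) := by
    refine (injective_iff_map_eq_zero _).2 fun q hq => ?_
    obtain ⟨h1, h2⟩ := Prod.mk_eq_zero.1 hq
    have h2' : q.2 = 0 := h2
    replace h1 : L q = 0 := h1
    rw [hL, h2', zero_mul, add_zero] at h1
    exact Prod.ext h1 h2'
  let e : (ℂ × ℂ) ≃L[ℂ] (ℂ × ℂ) :=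
    (LinearEquiv.ofInjectiveOfFinrankEq ((L.prod (.snd ℂ ℂ ℂ) : ℂ × ℂ →L[ℂ] ℂ × ℂ) :
      (ℂ × ℂ) →ₗ[ℂ] (ℂ × ℂ)) hinj rfl).toContinuousLinearEquiv
  have he : (e : (ℂ × ℂ) →L[ℂ] (ℂ × ℂ)) = L.prod (.snd ℂ ℂ ℂ) := by ext <;> rfl
  obtain ⟨H, hH, hH0, hHG, hGH⟩ := exists_analyticAt_inverse hG (he ▸ hGd)
  rw [hG0] at hH hH0 hGH
  have hGt : Filter.Tendsto G (𝓝 (t₀, 0)) (𝓝 (t₀, 0)) := by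
    have := hG.continuousAt.tendsto
    rwa [hG0] at this
  have hH2 : ∀ᶠ q in 𝓝 ((t₀, 0) : ℂ × ℂ), (H q).2 = q.2 := by
    filter_upwards [hGH] with q hq
    have h1 : (G (H q)).2 = q.2 := by rw [hq]
    exact h1
  refine ⟨fun q => (H q).1, ⟨analyticAt_fst.comp hH, ?_⟩, ?_, ?_⟩
  · have h1 := (tendsto_prodMk_zero t₀).eventually hHG
    filter_upwards [h1, hg.eventually_eq] with t h2 h3
    simp only [G, h3] at h2
    rw [h2]
  · filter_upwards [hGH, hH2] with q h1 h2
    have h3 : ((H q).1, q.2) = H q := Prod.ext rfl h2.symm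
    simp only [compGerm, h3]
    exact congrArg Prod.fst h1
  · filter_upwards [hHG] with q h1
    exact congrArg Prod.fst h1

/-- Holonomy germs are determined by their composition with a first integral. -/
lemma eventuallyEq_of_compGerm {x : Fiber F t₀}
    (hx : fderiv ℂ (fun y : Plane => MvPolynomial.eval y F) x ≠ 0) {Φ : Plane × ℂ → ℂ}
    (hΦ : IsFirstIntegralAt F η x Φ) {g g' : ℂ × ℂ → ℂ}
    (h : compGerm g Φ =ᶠ[𝓝 ((x : Plane), 0)] compGerm g' Φ) : g =ᶠ[𝓝 (t₀, 0)] g' := by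
  obtain ⟨p, hp⟩ := exists_isTransversal hx
  let b : ℂ × ℂ → ℂ := fun q => Φ (p q.1, q.2)
  have hpa : AnalyticAt ℂ (fun q : ℂ × ℂ => (p q.1, q.2)) (t₀, 0) :=
    (AnalyticAt.comp_of_eq hp.1 analyticAt_fst rfl).prod analyticAt_snd
  have hp0 : (p t₀, (0 : ℂ)) = ((x : Plane), 0) := by rw [hp.2.1]
  have hpt : Filter.Tendsto (fun q : ℂ × ℂ => (p q.1, q.2)) (𝓝 (t₀, 0)) (𝓝 ((x : Plane), 0)) :=
    hp0 ▸ hpa.continuousAt.tendsto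
  have hb : IsHolonomyGerm t₀ b := hp.isHolonomyGerm hΦ
  obtain ⟨c, hc, hbc, -⟩ := hb.exists_inverse
  have h1 : compGerm g b =ᶠ[𝓝 (t₀, 0)] compGerm g' b := hpt.eventually h
  have h2 := (tendsto_prodMk_snd hc.analyticAt.continuousAt hc.apply_zero).eventually h1
  filter_upwards [h2, hbc] with q h3 h4
  simp only [compGerm] at h3 h4
  simpa only [h4] using h3

end IsHolonomyGerm

lemma IsFirstIntegralAt.compGerm {x : Fiber F t₀} {Φ : Plane × ℂ → ℂ}
    (hΦ : IsFirstIntegralAt F η x Φ) {g : ℂ × ℂ → ℂ} (hg : IsHolonomyGerm t₀ g) :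
    IsFirstIntegralAt F η x (compGerm g Φ) := by
  refine ⟨analyticAt_compGerm hg.analyticAt hΦ.analyticAt hΦ.apply_zero, ?_, ?_⟩
  · have hl := tendsto_prodMk_snd hΦ.analyticAt.continuousAt hΦ.apply_zero
    filter_upwards [hΦ.eventually_fderiv, hΦ.analyticAt.eventually_analyticAt,
      hl.eventually hg.analyticAt.eventually_analyticAt] with v h1 h2 h3
    have h4 := HasFDerivAt.comp (f := fun v : Plane × ℂ => (Φ v, v.2)) v
      h3.differentiableAt.hasFDerivAt (h2.differentiableAt.hasFDerivAt.prodMk hasFDerivAt_snd)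
    have h5 : fderiv ℂ (Melnikov.compGerm g Φ) v = _ := h4.fderiv
    rw [h5]
    simp only [ContinuousLinearMap.comp_apply, ContinuousLinearMap.prod_apply, h1]
    exact map_zero (fderiv ℂ g (Φ v, v.2))
  · have hl : Filter.Tendsto (fun y : Plane => MvPolynomial.eval y F) (𝓝 x) (𝓝 t₀) := by
      have := (continuous_eval F).tendsto (x : Plane)
      rwa [x.2] at this
    filter_upwards [hΦ.eventually_eq, hl.eventually hg.eventually_eq] with y h1 h2
    simp only [Melnikov.compGerm, h1, h2]

/-- Two first integrals at a point differ by a holonomy germ: both are functions of the transverse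
coordinate of a flow box. -/
lemma IsFirstIntegralAt.exists_eq_compGerm (hη : IsConvergentDeformation η) {x : Fiber F t₀}
    (hx : fderiv ℂ (fun y : Plane => MvPolynomial.eval y F) x ≠ 0) {Φ Ψ : Plane × ℂ → ℂ}
    (hΦ : IsFirstIntegralAt F η x Φ) (hΨ : IsFirstIntegralAt F η x Ψ) :
    ∃ g, IsHolonomyGerm t₀ g ∧ Ψ =ᶠ[𝓝 ((x : Plane), 0)] Melnikov.compGerm g Φ := by
  obtain ⟨p, hp⟩ := exists_isTransversal hx
  obtain ⟨χ, Φ₀, ζ, hχ, hχ0, hΦ₀, hζ, hζ0, hΦp, hbox, hinv⟩ := exists_flowBox hη hx hp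
  have key : ∀ Ψ, IsFirstIntegralAt F η x Ψ → ∃ g, IsHolonomyGerm t₀ g ∧
      Ψ =ᶠ[𝓝 ((x : Plane), 0)] Melnikov.compGerm g Φ₀ := by
    intro Ψ hΨ
    let f : (ℂ × ℂ) × ℂ → ℂ := fun w => Ψ (χ w, w.1.2)
    have hχ2 : AnalyticAt ℂ (fun w : (ℂ × ℂ) × ℂ => (χ w, w.1.2)) ((t₀, 0), 0) :=
      hχ.prod (analyticAt_snd.comp analyticAt_fst)
    have hχt : Filter.Tendsto (fun w : (ℂ × ℂ) × ℂ => (χ w, w.1.2)) (𝓝 ((t₀, 0), 0))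
        (𝓝 ((x : Plane), 0)) := by
      have := hχ2.continuousAt.tendsto
      simpa only [hχ0] using this
    have hf : ∀ᶠ w in 𝓝 (((t₀, 0), 0) : (ℂ × ℂ) × ℂ), HasDerivAt (fun z => f (w.1, z)) 0 w.2 := by
      filter_upwards [hbox, hχt.eventually hΨ.eventually_fderiv,
        hχt.eventually hΨ.analyticAt.eventually_analyticAt] with w h1 h2 h3
      have h4 := HasFDerivAt.comp_hasDerivAt (l := Ψ) (f := fun z => (χ (w.1, z), w.1.2)) w.2
        h3.differentiableAt.hasFDerivAt (h1.1.prodMk (hasDerivAt_const _ _))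
      exact h4.congr_deriv h2
    have hconst := eventually_eq_of_hasDerivAt_zero hf
    refine ⟨fun q => f (q, 0), ⟨?_, ?_⟩, ?_⟩
    · have h1 : AnalyticAt ℂ f ((t₀, 0), 0) := AnalyticAt.comp_of_eq hΨ.analyticAt hχ2 (by rw [hχ0])
      exact AnalyticAt.comp_of_eq (f := fun q : ℂ × ℂ => (q, (0 : ℂ))) h1
        (analyticAt_id.prod analyticAt_const) rfl
    · have hl : Filter.Tendsto (fun t : ℂ => (((t, 0), 0) : (ℂ × ℂ) × ℂ)) (𝓝 t₀)
          (𝓝 ((t₀, 0), 0)) := Continuous.tendsto (by fun_prop) t₀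
      have hl2 : Filter.Tendsto (fun t : ℂ => χ ((t, 0), 0)) (𝓝 t₀) (𝓝 (x : Plane)) :=
        (hχ0 ▸ hχ.continuousAt.tendsto).comp hl
      filter_upwards [hl2.eventually hΨ.eventually_eq, hl2.eventually hΦ₀.eventually_eq,
        hl.eventually hbox] with t h1 h2 h3
      simp only [f]
      rw [h1, ← h2]
      exact h3.2.1
    · have hl : Filter.Tendsto (fun v : Plane × ℂ => (((Φ₀ v, v.2), ζ v) : (ℂ × ℂ) × ℂ))
          (𝓝 ((x : Plane), 0)) (𝓝 ((t₀, 0), 0)) :=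
        (tendsto_prodMk_snd hΦ₀.analyticAt.continuousAt hΦ₀.apply_zero).prodMk_nhds
          (by simpa only [hζ0] using hζ.continuousAt.tendsto)
      filter_upwards [hinv, hl.eventually hconst] with v h1 h2
      simp only [f, h1] at h2
      exact h2
  obtain ⟨a, ha, haΦ⟩ := key Φ hΦ
  obtain ⟨b, hb, hbΨ⟩ := key Ψ hΨ
  obtain ⟨c, hc, -, hca⟩ := ha.exists_inverse
  refine ⟨Melnikov.compGerm b c, hb.comp hc, ?_⟩
  have h1 : Melnikov.compGerm c Φ =ᶠ[𝓝 ((x : Plane), 0)] Φ₀ :=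
    (compGerm_congr_right haΦ).trans
      (compGerm_congr_left hca hΦ₀.analyticAt.continuousAt hΦ₀.apply_zero)
  exact hbΨ.trans (compGerm_congr_right h1.symm)

end Melnikov

namespace Melnikov

/-! ### Continuation of first integrals along paths -/

variable {F : MvPolynomial (Fin 2) ℂ} {η : ℕ → Fin 2 → MvPolynomial (Fin 2) ℂ} {t₀ : ℂ}

/-- The points of the unit interval have arbitrarily small order-connected neighbourhoods. -/
lemma exists_ordConnected_mem_nhds {s : I} {U : Set I} (hU : U ∈ 𝓝 s) :
    ∃ J ∈ 𝓝 s, J ⊆ U ∧ J.OrdConnected := by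
  obtain ⟨r, hr, h⟩ := Metric.mem_nhds_iff.1 hU
  refine ⟨Metric.ball s r, Metric.ball_mem_nhds s hr, h, ?_⟩
  have h1 : (Subtype.val ⁻¹' Metric.ball (s : ℝ) r : Set I).OrdConnected := by
    rw [Real.ball_eq_Ioo]
    exact Set.ordConnected_Ioo.preimage_mono (Subtype.mono_coe _)
  exact h1

/-- A property which is locally constant on the unit interval holds at `1` if it holds at `0`. -/
lemma unitInterval_induction {P : I → Prop} (h : ∀ s, ∀ᶠ s' in 𝓝 s, (P s' ↔ P s)) (s s' : I)
    (h0 : P s) : P s' :=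
  (PreconnectedSpace.induction₂' (fun a b => P a → P b)
    (fun x => (h x).mono fun _ hy => ⟨hy.2, hy.1⟩)
    ⟨fun _ _ _ hab hbc ha => hbc (hab ha)⟩ s s') h0

/-- The identity theorem: whether two germs agree does not change at the nearby points. -/
lemma eventually_eventuallyEq_iff {E G : Type*} [NormedAddCommGroup E] [NormedSpace ℂ E]
    [NormedAddCommGroup G] [NormedSpace ℂ G] [CompleteSpace G] {f g : E → G} {x : E}
    (hf : AnalyticAt ℂ f x) (hg : AnalyticAt ℂ g x) : ∀ᶠ y in 𝓝 x, (f =ᶠ[𝓝 y] g ↔ f =ᶠ[𝓝 x] g) := by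
  obtain ⟨r, hr, hball⟩ := Metric.eventually_nhds_iff_ball.1
    (hf.eventually_analyticAt.and hg.eventually_analyticAt)
  have key : ∀ y ∈ Metric.ball x r, ∀ z ∈ Metric.ball x r, f =ᶠ[𝓝 y] g → f =ᶠ[𝓝 z] g := by
    intro y hy z hz h
    have := AnalyticOnNhd.eqOn_of_preconnected_of_eventuallyEq (fun w hw => (hball w hw).1)
      (fun w hw => (hball w hw).2)
      (Metric.isConnected_ball hr).isPreconnected hy h
    exact Filter.eventually_of_mem (Metric.isOpen_ball.mem_nhds hz) this
  filter_upwards [Metric.ball_mem_nhds x hr] with y hy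
  exact ⟨key y hy x (Metric.mem_ball_self hr), key x (Metric.mem_ball_self hr) y hy⟩

/-- `Φ s`, `s ∈ S`, is an analytic continuation of first integrals along the map `k`: `Φ s` is a
first integral at `k s`, and for `s'` close to `s` the germs of `Φ s'` and `Φ s` at `k s'` are
equal. -/
def IsCoherent {T : Type*} [TopologicalSpace T] (F : MvPolynomial (Fin 2) ℂ)
    (η : ℕ → Fin 2 → MvPolynomial (Fin 2) ℂ) (k : T → Plane) (S : Set T)
    (Φ : T → Plane × ℂ → ℂ) : Prop :=
  ∀ s ∈ S, IsFirstIntegralAt F η (k s) (Φ s) ∧ ∀ᶠ s' in 𝓝[S] s, Φ s' =ᶠ[𝓝 (k s', 0)] Φ s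

namespace IsCoherent

variable {T T' : Type*} [TopologicalSpace T] [TopologicalSpace T'] {k : T → Plane} {S : Set T}
  {Φ Ψ : T → Plane × ℂ → ℂ}

lemma mono (h : IsCoherent F η k S Φ) {S' : Set T} (hS : S' ⊆ S) : IsCoherent F η k S' Φ :=
  fun s hs => ⟨(h s (hS hs)).1, (h s (hS hs)).2.filter_mono (nhdsWithin_mono _ hS)⟩

lemma comp (h : IsCoherent F η k Set.univ Φ) {f : T' → T} (hf : Continuous f) :
    IsCoherent F η (k ∘ f) Set.univ (Φ ∘ f) := by
  intro s _
  have h1 := h (f s) (Set.mem_univ _)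
  rw [nhdsWithin_univ] at h1 ⊢
  exact ⟨h1.1, (hf.tendsto s).eventually h1.2⟩

lemma unique (h : IsCoherent F η k S Φ) (h' : IsCoherent F η k S Ψ) (hk : Continuous k)
    (hS : IsPreconnected S) {s s' : T} (hs : s ∈ S) (hs' : s' ∈ S)
    (he : Φ s =ᶠ[𝓝 (k s, 0)] Ψ s) : Φ s' =ᶠ[𝓝 (k s', 0)] Ψ s' := by
  refine hS.induction₂' (fun a b => Φ a =ᶠ[𝓝 (k a, 0)] Ψ a → Φ b =ᶠ[𝓝 (k b, 0)] Ψ b) ?_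
    (fun x y z _ _ _ h1 h2 h3 => h2 (h1 h3)) hs hs' he
  intro a ha
  have h1 := h a ha
  have h2 := h' a ha
  have hl : Filter.Tendsto (fun s => (k s, (0 : ℂ))) (𝓝[S] a) (𝓝 (k a, 0)) :=
    ((hk.prodMk continuous_const).tendsto a).mono_left nhdsWithin_le_nhds
  filter_upwards [h1.2, h2.2, hl.eventually
    (eventually_eventuallyEq_iff h1.1.analyticAt h2.1.analyticAt)] with b h3 h4 h5
  exact ⟨fun h => h3.trans ((h5.2 h).trans h4.symm), fun h => h5.1 (h3.symm.trans (h.trans h4))⟩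

/-- A first integral continues itself as long as it is one. -/
lemma const {Φ : Plane × ℂ → ℂ} (h : ∀ s ∈ S, IsFirstIntegralAt F η (k s) Φ) :
    IsCoherent F η k S fun _ => Φ :=
  fun s hs => ⟨h s hs, Filter.Eventually.of_forall fun _ => Filter.EventuallyEq.rfl⟩

lemma compGerm {k : T → Fiber F t₀} (h : IsCoherent F η (fun s => (k s : Plane)) S Φ)
    {g : ℂ × ℂ → ℂ} (hg : IsHolonomyGerm t₀ g) :
    IsCoherent F η (fun s => (k s : Plane)) S fun s => Melnikov.compGerm g (Φ s) :=
  fun s hs => ⟨(h s hs).1.compGerm hg, (h s hs).2.mono fun _ hs' => compGerm_congr_right hs'⟩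

end IsCoherent

/-- First integrals can be continued along all paths of a fiber consisting of regular points. -/
lemma exists_isCoherent (hη : IsConvergentDeformation η)
    (hreg : ∀ x : Fiber F t₀, fderiv ℂ (fun y : Plane => MvPolynomial.eval y F) x ≠ 0)
    {c : I → Fiber F t₀} (hc : Continuous c) {Φ₀ : Plane × ℂ → ℂ}
    (hΦ₀ : IsFirstIntegralAt F η (c 0) Φ₀) :
    ∃ Φ, IsCoherent F η (fun s => (c s : Plane)) Set.univ Φ ∧ Φ 0 = Φ₀ := by
  let P : I → Prop := fun s => ∃ Φ, IsCoherent F η (fun s => (c s : Plane)) (Set.Icc 0 s) Φ ∧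
    Φ 0 = Φ₀
  have hmono : ∀ {a b : I}, a ≤ b → P b → P a := fun hab ⟨Φ, hΦ, h0⟩ =>
    ⟨Φ, hΦ.mono (Set.Icc_subset_Icc le_rfl hab), h0⟩
  have hP : P 1 := by
    refine unitInterval_induction (fun s => ?_) 0 1 ⟨fun _ => Φ₀, ?_, rfl⟩
    · obtain ⟨p, hp⟩ := exists_isTransversal (hreg (c s))
      obtain ⟨-, Ψ, -, -, -, hΨ, -⟩ := exists_flowBox hη (hreg (c s)) hp
      have hcs : Continuous fun s => (c s : Plane) := continuous_subtype_val.comp hc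
      obtain ⟨J, hJ, hJU, hJo⟩ := exists_ordConnected_mem_nhds ((hcs.tendsto s).eventually
        hΨ.eventually)
      -- inside the flow box every first integral is a function of `Ψ`, hence extends
      have key : ∀ a ∈ J, ∀ b ∈ J, a ≤ b → P a → P b := by
        rintro a ha b hb hab ⟨Φ, hΦ, h0⟩
        obtain ⟨g, hg, hgΨ⟩ := IsFirstIntegralAt.exists_eq_compGerm hη (hreg (c a)) (hJU ha)
          (hΦ a ⟨bot_le, le_rfl⟩).1
        refine ⟨fun s => if s ≤ a then Φ s else compGerm g Ψ, fun s hs => ⟨?_, ?_⟩, ?_⟩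
        · by_cases hsa : s ≤ a
          · simp only [if_pos hsa]
            exact (hΦ s ⟨hs.1, hsa⟩).1
          · simp only [if_neg hsa]
            exact IsFirstIntegralAt.compGerm (hJU (hJo.out ha hb ⟨(not_le.1 hsa).le, hs.2⟩)) hg
        · rcases lt_trichotomy s a with hsa | hsa | hsa
          · have h1 := (hΦ s ⟨hs.1, hsa.le⟩).2
            have h2 : 𝓝[Set.Icc 0 b] s ≤ 𝓝[Set.Icc 0 a] s := by
              refine nhdsWithin_le_iff.2 ?_
              filter_upwards [mem_nhdsWithin_of_mem_nhds (Iio_mem_nhds hsa), self_mem_nhdsWithin]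
                with x h3 h4
              exact ⟨h4.1, le_of_lt h3⟩
            filter_upwards [h1.filter_mono h2, mem_nhdsWithin_of_mem_nhds (Iio_mem_nhds hsa)]
              with x h3 h4
            rwa [if_pos (le_of_lt h4), if_pos hsa.le]
          · subst hsa
            have h1 := (hΦ s ⟨hs.1, le_rfl⟩).2
            rw [eventually_nhdsWithin_iff] at h1 ⊢
            have h2 := ((hcs.prodMk continuous_const).tendsto s).eventually hgΨ.eventually_nhds
            filter_upwards [h1, h2] with x h3 h4 h5
            rw [if_pos le_rfl]
            by_cases hx : x ≤ s
            · rw [if_pos hx]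
              exact h3 ⟨h5.1, hx⟩
            · rw [if_neg hx]
              exact Filter.EventuallyEq.symm h4
          · filter_upwards [mem_nhdsWithin_of_mem_nhds (Ioi_mem_nhds hsa)] with x hx
            rw [if_neg (not_le.2 hx), if_neg (not_le.2 hsa)]
        · exact (if_pos (bot_le : (0 : I) ≤ a)).trans h0
      filter_upwards [hJ] with s' hs'
      have hs : s ∈ J := mem_of_mem_nhds hJ
      rcases le_total s s' with h | h
      · exact ⟨hmono h, key s hs s' hs' h⟩
      · exact ⟨key s' hs' s hs h, hmono h⟩
    · refine IsCoherent.const fun s hs => ?_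
      rw [le_antisymm hs.2 hs.1]
      exact hΦ₀
  obtain ⟨Φ, hΦ, h0⟩ := hP
  refine ⟨Φ, hΦ.mono fun s _ => ⟨bot_le, le_top⟩, h0⟩

/-- Continuations along the paths of a family `K (u, ·)`, with equal germs at the starting points
for `u` close to `u₀`, have equal germs at the end points for `u` close to `u₀`. -/
lemma eventually_eventuallyEq_of_isCoherent {K : I × I → Plane} (hK : Continuous K)
    {Φ : I → I → Plane × ℂ → ℂ} (hΦ : ∀ u, IsCoherent F η (fun s => K (u, s)) Set.univ (Φ u))
    {u₀ : I} (h0 : ∀ᶠ u in 𝓝 u₀, Φ u 0 =ᶠ[𝓝 (K (u, 0), 0)] Φ u₀ 0) :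
    ∀ᶠ u in 𝓝 u₀, Φ u 1 =ᶠ[𝓝 (K (u, 1), 0)] Φ u₀ 1 := by
  refine unitInterval_induction
    (P := fun s => ∀ᶠ u in 𝓝 u₀, Φ u s =ᶠ[𝓝 (K (u, s), 0)] Φ u₀ s) (fun s => ?_) 0 1 h0
  obtain ⟨h1, h2⟩ := hΦ u₀ s (Set.mem_univ s)
  rw [nhdsWithin_univ] at h2
  have h3 := (hK.tendsto (u₀, s)).eventually h1.eventually
  rw [nhds_prod_eq] at h3
  obtain ⟨pa, hpa, pb, hpb, h3⟩ := Filter.eventually_prod_iff.1 h3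
  obtain ⟨J, hJ, hJU, hJo⟩ := exists_ordConnected_mem_nhds (hpb.and h2)
  have key : ∀ a ∈ J, ∀ b ∈ J, (∀ᶠ u in 𝓝 u₀, Φ u a =ᶠ[𝓝 (K (u, a), 0)] Φ u₀ a) →
      ∀ᶠ u in 𝓝 u₀, Φ u b =ᶠ[𝓝 (K (u, b), 0)] Φ u₀ b := by
    intro a ha b hb h
    have hl : ∀ r ∈ J, ∀ᶠ u in 𝓝 u₀, Φ u₀ r =ᶠ[𝓝 (K (u, r), 0)] Φ u₀ s := fun r hr =>
      (((hK.comp (Continuous.prodMk_left r)).prodMk continuous_const).tendsto u₀).eventually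
        ((hJU hr).2).eventually_nhds
    filter_upwards [h, hl a ha, hl b hb, hpa] with u h4 h5 h6 h7
    have hco : IsCoherent F η (fun s => K (u, s)) J fun _ => Φ u₀ s :=
      IsCoherent.const fun r hr => h3 h7 (hJU hr).1
    exact (((hΦ u).mono (Set.subset_univ J)).unique hco (hK.comp (Continuous.prodMk_right u))
      hJo.isPreconnected ha hb (h4.trans h5)).trans h6.symm
  filter_upwards [hJ] with s' hs'
  exact ⟨key s' hs' s (mem_of_mem_nhds hJ), key s (mem_of_mem_nhds hJ) s' hs'⟩

/-- `Φ'` is the analytic continuation of the first integral `Φ` along the path `c`. -/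
def Continues (F : MvPolynomial (Fin 2) ℂ) (η : ℕ → Fin 2 → MvPolynomial (Fin 2) ℂ) (c : I → Plane)
    (Φ Φ' : Plane × ℂ → ℂ) : Prop :=
  ∃ Ψ, IsCoherent F η c Set.univ Ψ ∧ Ψ 0 =ᶠ[𝓝 (c 0, 0)] Φ ∧ Ψ 1 =ᶠ[𝓝 (c 1, 0)] Φ'

namespace Continues

variable {Φ Φ' Φ'' Φ₁ Φ₁' : Plane × ℂ → ℂ}

lemma congr {c : I → Plane} (h : Continues F η c Φ Φ') (h0 : Φ =ᶠ[𝓝 (c 0, 0)] Φ₁)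
    (h1 : Φ' =ᶠ[𝓝 (c 1, 0)] Φ₁') : Continues F η c Φ₁ Φ₁' := by
  obtain ⟨Ψ, hΨ, hΨ0, hΨ1⟩ := h
  exact ⟨Ψ, hΨ, hΨ0.trans h0, hΨ1.trans h1⟩

lemma isFirstIntegralAt_left {c : I → Plane} (h : Continues F η c Φ Φ') :
    IsFirstIntegralAt F η (c 0) Φ := by
  obtain ⟨Ψ, hΨ, hΨ0, -⟩ := h
  exact (hΨ 0 (Set.mem_univ _)).1.congr hΨ0

lemma isFirstIntegralAt_right {c : I → Plane} (h : Continues F η c Φ Φ') :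
    IsFirstIntegralAt F η (c 1) Φ' := by
  obtain ⟨Ψ, hΨ, -, hΨ1⟩ := h
  exact (hΨ 1 (Set.mem_univ _)).1.congr hΨ1

lemma unique {c : I → Plane} (hc : Continuous c) (h : Continues F η c Φ Φ')
    (h' : Continues F η c Φ₁ Φ₁') (h0 : Φ =ᶠ[𝓝 (c 0, 0)] Φ₁) : Φ' =ᶠ[𝓝 (c 1, 0)] Φ₁' := by
  obtain ⟨Ψ, hΨ, hΨ0, hΨ1⟩ := h
  obtain ⟨Ψ', hΨ', hΨ0', hΨ1'⟩ := h'
  exact hΨ1.symm.trans ((hΨ.unique hΨ' hc isPreconnected_univ (Set.mem_univ 0) (Set.mem_univ 1)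
    (hΨ0.trans (h0.trans hΨ0'.symm))).trans hΨ1')

lemma compGerm {c : I → Fiber F t₀} (h : Continues F η (fun s => (c s : Plane)) Φ Φ')
    {g : ℂ × ℂ → ℂ} (hg : IsHolonomyGerm t₀ g) :
    Continues F η (fun s => (c s : Plane)) (Melnikov.compGerm g Φ) (Melnikov.compGerm g Φ') := by
  obtain ⟨Ψ, hΨ, hΨ0, hΨ1⟩ := h
  exact ⟨_, hΨ.compGerm hg, compGerm_congr_right hΨ0, compGerm_congr_right hΨ1⟩

lemma symm {x x' : Fiber F t₀} {c : Path x x'} (h : Continues F η (fun s => (c s : Plane)) Φ Φ') :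
    Continues F η (fun s => (c.symm s : Plane)) Φ' Φ := by
  obtain ⟨Ψ, hΨ, hΨ0, hΨ1⟩ := h
  refine ⟨_, hΨ.comp unitInterval.continuous_symm, ?_, ?_⟩
  · simpa using hΨ1
  · simpa using hΨ0

end Continues

section Regular

variable {x x' x'' : Fiber F t₀} {Φ Φ' Φ'' : Plane × ℂ → ℂ}

lemma exists_continues (hη : IsConvergentDeformation η)
    (hreg : ∀ x : Fiber F t₀, fderiv ℂ (fun y : Plane => MvPolynomial.eval y F) x ≠ 0)
    (c : Path x x') (hΦ : IsFirstIntegralAt F η x Φ) :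
    ∃ Φ', Continues F η (fun s => (c s : Plane)) Φ Φ' := by
  obtain ⟨Ψ, hΨ, h0⟩ := exists_isCoherent hη hreg c.continuous (Φ₀ := Φ) (by rwa [c.source])
  exact ⟨Ψ 1, Ψ, hΨ, by rw [h0], Filter.EventuallyEq.rfl⟩

/-- The monodromy theorem for the continuation of first integrals. -/
lemma Continues.of_homotopic (hη : IsConvergentDeformation η)
    (hreg : ∀ x : Fiber F t₀, fderiv ℂ (fun y : Plane => MvPolynomial.eval y F) x ≠ 0)
    {c c' : Path x x'} (h : Continues F η (fun s => (c s : Plane)) Φ Φ')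
    (hcc' : c.Homotopic c') : Continues F η (fun s => (c' s : Plane)) Φ Φ' := by
  obtain ⟨H⟩ := hcc'
  have hΦ : IsFirstIntegralAt F η x Φ := by simpa using h.isFirstIntegralAt_left
  choose Ψ hΨ hΨ0 using fun u : I => exists_isCoherent hη hreg (H.eval u).continuous
    (Φ₀ := Φ) (by rwa [(H.eval u).source])
  have hK : Continuous fun v : I × I => (H v : Plane) :=
    continuous_subtype_val.comp H.continuous
  have key : Ψ 1 1 =ᶠ[𝓝 ((x' : Plane), 0)] Ψ 0 1 := by
    refine unitInterval_induction (P := fun u => Ψ u 1 =ᶠ[𝓝 ((x' : Plane), 0)] Ψ 0 1)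
      (fun u => ?_) 0 1 Filter.EventuallyEq.rfl
    have h1 := eventually_eventuallyEq_of_isCoherent hK hΨ (u₀ := u)
      (Filter.Eventually.of_forall fun u' => by rw [hΨ0, hΨ0])
    filter_upwards [h1] with u' h2
    rw [H.target] at h2
    exact ⟨fun h => h2.symm.trans h, fun h => h2.trans h⟩
  have e0 : ∀ s, (H.eval 0) s = c s := fun s => by rw [H.eval_zero]
  have e1 : ∀ s, (H.eval 1) s = c' s := fun s => by rw [H.eval_one]
  have h0 : Continues F η (fun s => (c s : Plane)) Φ (Ψ 0 1) := by
    refine ⟨Ψ 0, ?_, by rw [hΨ0], Filter.EventuallyEq.rfl⟩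
    have := hΨ 0
    simpa only [e0] using this
  have h1 := h.unique (continuous_subtype_val.comp c.continuous) h0 Filter.EventuallyEq.rfl
  refine ⟨Ψ 1, ?_, by rw [hΨ0], ?_⟩
  · have := hΨ 1
    simpa only [e1] using this
  · simp only [Function.comp_apply, c.target] at h1
    simp only [c'.target]
    exact key.trans h1.symm

lemma Continues.trans (hη : IsConvergentDeformation η)
    (hreg : ∀ x : Fiber F t₀, fderiv ℂ (fun y : Plane => MvPolynomial.eval y F) x ≠ 0)
    {c : Path x x'} {c' : Path x' x''} (h : Continues F η (fun s => (c s : Plane)) Φ Φ')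
    (h' : Continues F η (fun s => (c' s : Plane)) Φ' Φ'') :
    Continues F η (fun s => (c.trans c' s : Plane)) Φ Φ'' := by
  have hΦ : IsFirstIntegralAt F η x Φ := by simpa using h.isFirstIntegralAt_left
  obtain ⟨Ψ, hΨ, h0⟩ := exists_isCoherent hη hreg (c.trans c').continuous (Φ₀ := Φ)
    (by rwa [(c.trans c').source])
  -- the restrictions of `Ψ` to the two halves continue `Φ` along `c` and `Φ'` along `c'`
  let f : I → I := fun s => ⟨s / 2, by constructor <;> linarith [s.2.1, s.2.2]⟩
  let f' : I → I := fun s => ⟨(s + 1) / 2, by constructor <;> linarith [s.2.1, s.2.2]⟩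
  have hf : Continuous f := by fun_prop
  have hf' : Continuous f' := by fun_prop
  have ef : ∀ s, (c.trans c') (f s) = c s := by
    intro s
    rw [Path.trans_apply, dif_pos (by simp only [f]; linarith [s.2.2])]
    congr 1
    ext
    simp only [f]
    ring
  have ef' : ∀ s, (c.trans c') (f' s) = c' s := by
    intro s
    rw [Path.trans_apply]
    split_ifs with hs
    · have hs0 : s = 0 := by
        ext
        simp only [f'] at hs
        simp only [Set.Icc.coe_zero]
        linarith [s.2.1]
      subst hs0
      rw [c'.source]
      convert c.target using 2
      ext
      simp [f']
    · congr 1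
      ext
      simp only [f']
      ring
  have h1 : Continues F η (fun s => (c s : Plane)) Φ (Ψ (f 1)) := by
    refine ⟨Ψ ∘ f, ?_, ?_, Filter.EventuallyEq.rfl⟩
    · simpa only [Function.comp_def, ef] using hΨ.comp hf
    · have : f 0 = 0 := by ext; simp [f]
      simp only [Function.comp_apply, this, h0]
      exact Filter.EventuallyEq.rfl
  have h2 := h1.unique (continuous_subtype_val.comp c.continuous) h Filter.EventuallyEq.rfl
  have h3 : Continues F η (fun s => (c' s : Plane)) (Ψ (f 1)) (Ψ 1) := by
    refine ⟨Ψ ∘ f', ?_, ?_, ?_⟩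
    · simpa only [Function.comp_def, ef'] using hΨ.comp hf'
    · have : f' 0 = f 1 := by ext; simp [f, f']
      simp only [Function.comp_apply, this]
      exact Filter.EventuallyEq.rfl
    · have : f' 1 = 1 := by ext; simp [f']
      simp only [Function.comp_apply, this]
      exact Filter.EventuallyEq.rfl
  have h4 := h3.unique (continuous_subtype_val.comp c'.continuous) h' (by
    simp only [Function.comp_apply, c.target] at h2
    simp only [Function.comp_apply, c'.source]
    exact h2)
  refine ⟨Ψ, hΨ, by rw [h0], ?_⟩
  simp only [Function.comp_apply, c'.target] at h4
  simp only [(c.trans c').target]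
  exact h4

end Regular

end Melnikov

namespace Melnikov

/-! ### Holonomy in terms of first integrals -/

variable {F : MvPolynomial (Fin 2) ℂ} {η : ℕ → Fin 2 → MvPolynomial (Fin 2) ℂ} {t₀ : ℂ}

/-- The deformation converges and all points of the fiber over `t₀` are regular. -/
structure IsRegularFiber (F : MvPolynomial (Fin 2) ℂ) (η : ℕ → Fin 2 → MvPolynomial (Fin 2) ℂ)
    (t₀ : ℂ) : Prop where
  conv : IsConvergentDeformation η
  reg : ∀ x : Fiber F t₀, fderiv ℂ (fun y : Plane => MvPolynomial.eval y F) x ≠ 0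

/-- The first integral `Φ` at `x` becomes `g (Φ', ε)` when it is continued along the homotopy
class `κ` of paths from `x` to `x'`. If `Φ` and `Φ'` are the parameters of two transversals, then
`g` is the inverse of the holonomy map along `κ`. -/
def IsHolonomy (F : MvPolynomial (Fin 2) ℂ) (η : ℕ → Fin 2 → MvPolynomial (Fin 2) ℂ)
    {x x' : Fiber F t₀} (κ : Path.Homotopic.Quotient x x') (Φ Φ' : Plane × ℂ → ℂ)
    (g : ℂ × ℂ → ℂ) : Prop :=
  IsHolonomyGerm t₀ g ∧ ∃ c : Path x x', Path.Homotopic.Quotient.mk c = κ ∧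
    Continues F η (fun s => (c s : Plane)) Φ (compGerm g Φ')

namespace IsHolonomy

variable {x x' x'' : Fiber F t₀} {κ : Path.Homotopic.Quotient x x'}
  {κ' : Path.Homotopic.Quotient x' x''} {Φ Φ' Φ'' : Plane × ℂ → ℂ} {g g' : ℂ × ℂ → ℂ}

lemma exists_of_isFirstIntegralAt (hF : IsRegularFiber F η t₀)
    (κ : Path.Homotopic.Quotient x x') (hΦ : IsFirstIntegralAt F η x Φ)
    (hΦ' : IsFirstIntegralAt F η x' Φ') : ∃ g, IsHolonomy F η κ Φ Φ' g := by
  obtain ⟨c, rfl⟩ := Path.Homotopic.Quotient.mk_surjective κ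
  obtain ⟨Φ₁, h⟩ := exists_continues hF.conv hF.reg c hΦ
  have h1 : IsFirstIntegralAt F η x' Φ₁ := by simpa using h.isFirstIntegralAt_right
  obtain ⟨g, hg, hgΦ⟩ := hΦ'.exists_eq_compGerm hF.conv (hF.reg x') h1
  exact ⟨g, hg, c, rfl, h.congr Filter.EventuallyEq.rfl (by simpa using hgΦ)⟩

lemma isHolonomyGerm (h : IsHolonomy F η κ Φ Φ' g) : IsHolonomyGerm t₀ g := h.1

/-- By the monodromy theorem, any path of the class may be used. -/
lemma continues (hF : IsRegularFiber F η t₀) (h : IsHolonomy F η κ Φ Φ' g) {c : Path x x'}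
    (hc : Path.Homotopic.Quotient.mk c = κ) :
    Continues F η (fun s => (c s : Plane)) Φ (compGerm g Φ') := by
  obtain ⟨-, c', hc', h⟩ := h
  exact h.of_homotopic hF.conv hF.reg (Path.Homotopic.Quotient.exact (hc'.trans hc.symm))

lemma unique (hF : IsRegularFiber F η t₀) (hΦ' : IsFirstIntegralAt F η x' Φ')
    (h : IsHolonomy F η κ Φ Φ' g) (h' : IsHolonomy F η κ Φ Φ' g') : g =ᶠ[𝓝 (t₀, 0)] g' := by
  obtain ⟨-, c, hc, h1⟩ := h
  have h2 := h1.unique (continuous_subtype_val.comp c.continuous) (h'.continues hF hc)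
    Filter.EventuallyEq.rfl
  simp only [Function.comp_apply, c.target] at h2
  exact IsHolonomyGerm.eventuallyEq_of_compGerm (hF.reg x') hΦ' h2

/-- Continuation is compatible with the composition by germs, so the germs of two successive paths
are composed in the order of the paths. -/
lemma trans (hF : IsRegularFiber F η t₀) (h : IsHolonomy F η κ Φ Φ' g)
    (h' : IsHolonomy F η κ' Φ' Φ'' g') :
    IsHolonomy F η (κ.trans κ') Φ Φ'' (compGerm g g') := by
  obtain ⟨hg, c, rfl, h⟩ := h
  obtain ⟨hg', c', rfl, h'⟩ := h'
  exact ⟨hg.comp hg', c.trans c', rfl, h.trans hF.conv hF.reg (h'.compGerm hg)⟩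

lemma refl (hΦ : IsFirstIntegralAt F η x Φ)
    (hg : IsHolonomyGerm t₀ g) (he : Φ =ᶠ[𝓝 ((x : Plane), 0)] compGerm g Φ') :
    IsHolonomy F η (Path.Homotopic.Quotient.refl x) Φ Φ' g := by
  refine ⟨hg, Path.refl x, rfl, fun _ => Φ, IsCoherent.const fun s _ => hΦ,
    Filter.EventuallyEq.rfl, he⟩

lemma symm (h : IsHolonomy F η κ Φ Φ' g)
    (hΦ' : IsFirstIntegralAt F η x' Φ') (hg' : IsHolonomyGerm t₀ g')
    (he : compGerm g' g =ᶠ[𝓝 (t₀, 0)] Prod.fst) : IsHolonomy F η κ.symm Φ' Φ g' := by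
  obtain ⟨hg, c, rfl, h⟩ := h
  refine ⟨hg', c.symm, rfl, (h.symm.compGerm hg').congr ?_ Filter.EventuallyEq.rfl⟩
  simp only [c.symm.source]
  exact compGerm_congr_left he hΦ'.analyticAt.continuousAt hΦ'.apply_zero

end IsHolonomy

/-! ### Families of tangent paths -/

/-- A continuous family of paths tangent to the foliation, from the transversal `p` to the
transversal `q`, which realizes the holonomy map `h` along the homotopy class `κ`. -/
def IsHolonomyMap (F : MvPolynomial (Fin 2) ℂ) (η : ℕ → Fin 2 → MvPolynomial (Fin 2) ℂ)
    {x x' : Fiber F t₀} (p q : ℂ → Plane) (κ : Path.Homotopic.Quotient x x')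
    (h : ℂ × ℂ → ℂ) : Prop :=
  AnalyticAt ℂ h (t₀, 0) ∧ h (t₀, 0) = t₀ ∧
  ∃ U ∈ 𝓝 t₀, ∃ V ∈ 𝓝 (0 : ℂ), ∃ (H H' : ℝ → ℂ → ℂ → Plane) (c : Path x x'),
    ContinuousOn (fun z : ℝ × ℂ × ℂ => H z.1 z.2.1 z.2.2) (Set.Icc 0 1 ×ˢ U ×ˢ V) ∧
    ContinuousOn (fun z : ℝ × ℂ × ℂ => H' z.1 z.2.1 z.2.2) (Set.Icc 0 1 ×ˢ U ×ˢ V) ∧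
    (∀ t ∈ U, ∀ ε ∈ V,
      (∀ s ∈ Set.Icc (0 : ℝ) 1,
        HasDerivWithinAt (fun s => H s t ε) (H' s t ε) (Set.Icc 0 1) s ∧
        deformedForm F η ε (H s t ε) (H' s t ε) = 0) ∧
      H 0 t ε = p t ∧ H 1 t ε = q (h (t, ε))) ∧
    (∀ s : I, H s t₀ 0 = (c s : Plane)) ∧
    Path.Homotopic.Quotient.mk c = κ

lemma IsDisplacement.isHolonomyMap {x : Fiber F t₀} {p : ℂ → Plane}
    {δ : FundamentalGroup (Fiber F t₀) x} {Δ : ℂ → ℂ → ℂ} (h : IsDisplacement F η x p δ Δ) :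
    IsHolonomyMap F η (x := x) (x' := x) p p δ fun z => z.1 + Δ z.1 z.2 :=
  ⟨analyticAt_fst.add h.1, by simp [h.2.1], h.2.2⟩

lemma IsHolonomyMap.isDisplacement {x : Fiber F t₀} {p : ℂ → Plane}
    {δ : FundamentalGroup (Fiber F t₀) x} {h : ℂ × ℂ → ℂ}
    (hh : IsHolonomyMap F η (x := x) (x' := x) p p δ h) :
    IsDisplacement F η x p δ fun t ε => h (t, ε) - t := by
  refine ⟨hh.1.sub analyticAt_fst, by simp [hh.2.1], ?_⟩
  simpa only [add_sub_cancel] using hh.2.2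

lemma IsHolonomyMap.cast {x x' y y' : Fiber F t₀} {p q : ℂ → Plane}
    {κ : Path.Homotopic.Quotient x x'} {h : ℂ × ℂ → ℂ} (hh : IsHolonomyMap F η p q κ h)
    (hy : y = x) (hy' : y' = x') : IsHolonomyMap F η p q (κ.cast hy hy') h := by
  subst hy hy'
  rwa [Path.Homotopic.Quotient.cast_rfl_rfl]

lemma IsTransversal.tendsto {x : Fiber F t₀} {p : ℂ → Plane} (hp : IsTransversal F x p) :
    Filter.Tendsto (fun z : ℂ × ℂ => (p z.1, z.2)) (𝓝 (t₀, 0)) (𝓝 ((x : Plane), 0)) := by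
  have h1 : Filter.Tendsto p (𝓝 t₀) (𝓝 (x : Plane)) := by
    have := hp.1.continuousAt.tendsto
    rwa [hp.2.1] at this
  exact (h1.comp (continuous_fst.tendsto ((t₀, 0) : ℂ × ℂ))).prodMk_nhds
    (continuous_snd.tendsto ((t₀, 0) : ℂ × ℂ))

/-- First integrals are constant along tangent paths: the holonomy map of a family of tangent
paths is expressed through the continuation of first integrals. -/
lemma IsHolonomyMap.eventually_eq (hF : IsRegularFiber F η t₀) {x x' : Fiber F t₀}
    {p q : ℂ → Plane} (hp : IsTransversal F x p)
    {κ : Path.Homotopic.Quotient x x'} {h : ℂ × ℂ → ℂ}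
    (hh : IsHolonomyMap F η p q κ h) {Φ Φ' : Plane × ℂ → ℂ} {g : ℂ × ℂ → ℂ}
    (hg : IsHolonomy F η κ Φ Φ' g) (hq : IsTransversal F x' q) :
    ∀ᶠ z in 𝓝 ((t₀, 0) : ℂ × ℂ), compGerm g Φ' (q (h z), z.2) = Φ (p z.1, z.2) := by
  obtain ⟨hha, hh0, U, hU, V, hV, H, H', c, hH, -, htan, hc, hκ⟩ := hh
  obtain ⟨Ψ, hΨ, hΨ0, hΨ1⟩ := hg.continues hF hκ
  simp only [c.source] at hΨ0
  simp only [c.target] at hΨ1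
  have hUV : ∀ᶠ z in 𝓝 ((t₀, 0) : ℂ × ℂ), z.1 ∈ U ∧ z.2 ∈ V := prod_mem_nhds hU hV
  have hHc : ∀ s : I, Filter.Tendsto (fun w : I × ℂ × ℂ => (H w.1 w.2.1 w.2.2, w.2.2))
      (𝓝 (s, (t₀, 0))) (𝓝 ((c s : Plane), 0)) := by
    intro s
    have h1 := hH ((s : ℝ), (t₀, 0)) ⟨s.2, mem_of_mem_nhds hU, mem_of_mem_nhds hV⟩
    have h2 : Filter.Tendsto (fun w : I × ℂ × ℂ => ((w.1 : ℝ), w.2)) (𝓝 (s, (t₀, 0)))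
        (𝓝[Set.Icc 0 1 ×ˢ U ×ˢ V] ((s : ℝ), (t₀, 0))) := by
      refine tendsto_nhdsWithin_iff.2 ⟨Continuous.tendsto (by fun_prop) (s, (t₀, 0)), ?_⟩
      filter_upwards [(continuous_snd.tendsto (s, ((t₀, 0) : ℂ × ℂ))).eventually hUV] with w hw
      exact ⟨w.1.2, hw⟩
    have h3 := h1.tendsto.comp h2
    rw [hc] at h3
    exact h3.prodMk_nhds (Continuous.tendsto (by fun_prop) (s, ((t₀, 0) : ℂ × ℂ)))
  have hHs : ∀ s : I, Filter.Tendsto (fun z : ℂ × ℂ => (H s z.1 z.2, z.2))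
      (𝓝 (t₀, 0)) (𝓝 ((c s : Plane), 0)) := fun s =>
    (hHc s).comp ((Continuous.prodMk_right s).tendsto (t₀, 0))
  -- the value of the continued first integral at the moving point is constant along the path
  have h1 : ∀ᶠ z in 𝓝 ((t₀, 0) : ℂ × ℂ), Ψ 1 (H (1 : I) z.1 z.2, z.2) = Φ (p z.1, z.2) := by
    refine unitInterval_induction (P := fun s : I => ∀ᶠ z in 𝓝 ((t₀, 0) : ℂ × ℂ),
      Ψ s (H s z.1 z.2, z.2) = Φ (p z.1, z.2)) (fun s => ?_) 0 1 ?_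
    · obtain ⟨hs1, hs2⟩ := hΨ s (Set.mem_univ s)
      rw [nhdsWithin_univ] at hs2
      have h3 : ∀ᶠ v in 𝓝 ((c s : Plane), (0 : ℂ)), DifferentiableAt ℂ (Ψ s) v ∧
          fderiv ℂ (Ψ s) v (leafField F η v, 0) = 0 ∧ leafField F η v ≠ 0 := by
        filter_upwards [hs1.analyticAt.eventually_analyticAt, hs1.eventually_fderiv,
          (analyticAt_leafField hF.conv (c s : Plane)).continuousAt.eventually_ne
            (leafField_ne_zero (hF.reg (c s)))] with v h1 h2 h3
        exact ⟨h1.differentiableAt, h2, h3⟩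
      have h4 := (hHc s).eventually h3
      rw [nhds_prod_eq] at h4
      obtain ⟨pa, hpa, pb, hpb, h4⟩ := Filter.eventually_prod_iff.1 h4
      obtain ⟨J, hJ, hJU, hJo⟩ := exists_ordConnected_mem_nhds (hpa.and hs2)
      have hagree : ∀ a ∈ J, ∀ᶠ z in 𝓝 ((t₀, 0) : ℂ × ℂ),
          Ψ a (H a z.1 z.2, z.2) = Ψ s (H a z.1 z.2, z.2) := fun a ha =>
        (hHs a).eventually (hJU ha).2
      have hconst : ∀ a ∈ J, ∀ b ∈ J, a ≤ b → ∀ᶠ z in 𝓝 ((t₀, 0) : ℂ × ℂ),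
          Ψ s (H b z.1 z.2, z.2) = Ψ s (H a z.1 z.2, z.2) := by
        intro a ha b hb hab
        filter_upwards [hpb, hUV] with z hz hzUV
        have hd : ∀ r ∈ Set.Icc (a : ℝ) b, HasDerivWithinAt
            (fun r => Ψ s (H r z.1 z.2, z.2)) 0 (Set.Icc (a : ℝ) b) r := by
          intro r hr
          have hrI : r ∈ Set.Icc (0 : ℝ) 1 := ⟨a.2.1.trans hr.1, hr.2.trans b.2.2⟩
          obtain ⟨hd1, hd2, hd3⟩ := h4 (hJU (hJo.out ha hb (show (⟨r, hrI⟩ : I) ∈ Set.Icc a b from hr))).1 hz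
          obtain ⟨ht1, ht2⟩ := (htan z.1 hzUV.1 z.2 hzUV.2).1 r hrI
          obtain ⟨e, he⟩ := exists_eq_smul_leafField ht2 hd3
          have h5 : HasDerivWithinAt (fun r => (H r z.1 z.2, z.2)) (H' r z.1 z.2, 0)
              (Set.Icc 0 1) r := ht1.prodMk (hasDerivWithinAt_const _ _ _)
          have h6 := (hd1.hasFDerivAt.restrictScalars ℝ).comp_hasDerivWithinAt r h5
          have h7 : (fderiv ℂ (Ψ s) (H r z.1 z.2, z.2)) (H' r z.1 z.2, 0) = 0 := by
            have : ((H' r z.1 z.2, 0) : Plane × ℂ) =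
                e • (leafField F η (H r z.1 z.2, z.2), (0 : ℂ)) := by
              rw [he]; simp
            rw [this, map_smul, hd2, smul_zero]
          exact (h6.congr_deriv h7).mono (Set.Icc_subset_Icc a.2.1 b.2.2)
        refine constant_of_derivWithin_zero (fun r hr => (hd r hr).differentiableWithinAt)
          (fun r hr => (hd r (Set.Ico_subset_Icc_self hr)).derivWithin
            (uniqueDiffOn_Icc (hr.1.trans_lt hr.2) r (Set.Ico_subset_Icc_self hr))) b ⟨hab, le_rfl⟩
      have hconst' : ∀ a ∈ J, ∀ b ∈ J, ∀ᶠ z in 𝓝 ((t₀, 0) : ℂ × ℂ),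
          Ψ b (H b z.1 z.2, z.2) = Ψ a (H a z.1 z.2, z.2) := by
        intro a ha b hb
        rcases le_total a b with hab | hab
        · filter_upwards [hagree a ha, hagree b hb, hconst a ha b hb hab] with z h1 h2 h3
          rw [h1, h2, h3]
        · filter_upwards [hagree a ha, hagree b hb, hconst b hb a ha hab] with z h1 h2 h3
          rw [h1, h2, h3]
      have hs : s ∈ J := mem_of_mem_nhds hJ
      filter_upwards [hJ] with b hb
      constructor
      · intro h
        filter_upwards [h, hconst' b hb s hs] with z h5 h6
        rw [h6, h5]
      · intro h
        filter_upwards [h, hconst' s hs b hb] with z h5 h6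
        rw [h6, h5]
    · filter_upwards [hp.tendsto.eventually hΨ0, hUV] with z h1 h2
      have h3 := (htan z.1 h2.1 z.2 h2.2).2.1
      rw [← h1, ← h3]
      rfl
  have hht : Filter.Tendsto (fun z : ℂ × ℂ => (h z, z.2)) (𝓝 (t₀, 0)) (𝓝 (t₀, 0)) :=
    tendsto_prodMk_snd hha.continuousAt hh0
  filter_upwards [h1, (hq.tendsto.comp hht).eventually hΨ1, hUV] with z h1 h2 h3
  rw [← h1]
  have h4 := (htan z.1 h3.1 z.2 h3.2).2.2
  have h5 : H ((1 : I) : ℝ) z.1 z.2 = q (h z) := h4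
  rw [h5]
  exact h2.symm

end Melnikov

namespace Melnikov

/-! ### Existence of holonomy maps -/

variable {F : MvPolynomial (Fin 2) ℂ} {η : ℕ → Fin 2 → MvPolynomial (Fin 2) ℂ} {t₀ : ℂ}

lemma exists_prod_of_eventually {P : ℂ × ℂ → Prop} (h : ∀ᶠ z in 𝓝 ((t₀, 0) : ℂ × ℂ), P z) :
    ∃ U ∈ 𝓝 t₀, ∃ V ∈ 𝓝 (0 : ℂ), ∀ t ∈ U, ∀ ε ∈ V, P (t, ε) := by
  obtain ⟨U, hU, V, hV, h⟩ := mem_nhds_prod_iff.1 h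
  exact ⟨U, hU, V, hV, fun t ht ε hε => h ⟨ht, hε⟩⟩

lemma deriv_smoothTransition_of_nonpos {x : ℝ} (hx : x ≤ 0) : deriv Real.smoothTransition x = 0 :=
  IsLocalMin.deriv_eq_zero (Filter.Eventually.of_forall fun y => by
    rw [Real.smoothTransition.zero_of_nonpos hx]; exact Real.smoothTransition.nonneg y)

lemma deriv_smoothTransition_of_one_le {x : ℝ} (hx : 1 ≤ x) : deriv Real.smoothTransition x = 0 :=
  IsLocalMax.deriv_eq_zero (Filter.Eventually.of_forall fun y => by
    rw [Real.smoothTransition.one_of_one_le hx]; exact Real.smoothTransition.le_one y)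

lemma hasDerivAt_smoothTransition (x : ℝ) :
    HasDerivAt Real.smoothTransition (deriv Real.smoothTransition x) x :=
  ((Real.smoothTransition.contDiff (n := 1)).differentiable (by simp) x).hasDerivAt

lemma continuous_deriv_smoothTransition : Continuous (deriv Real.smoothTransition) :=
  (Real.smoothTransition.contDiff (n := 1)).continuous_deriv (by simp)

lemma deformedForm_real_smul {ε : ℂ} {x v : Plane} (h : deformedForm F η ε x v = 0) (c : ℝ) :
    deformedForm F η ε x (c • v) = 0 := by
  have : deformedForm F η ε x (c • v) = c * deformedForm F η ε x v := by
    simp only [deformedForm, Finset.mul_sum, Pi.smul_apply, Complex.real_smul]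
    exact Finset.sum_congr rfl fun k _ => by ring
  rw [this, h, mul_zero]

/-- The smooth transition as a map of the unit interval. -/
def smoothStep : C(I, I) :=
  ⟨fun s => ⟨Real.smoothTransition s, Real.smoothTransition.nonneg _,
    Real.smoothTransition.le_one _⟩, by
      have := Real.smoothTransition.continuous
      fun_prop⟩

/-- Holonomy maps are composed by concatenation of tangent paths. The two families of paths are
run through with a speed that vanishes at the ends, so that the concatenation is `C¹`. -/
lemma IsHolonomyMap.trans {x x' x'' : Fiber F t₀} {p q r : ℂ → Plane}
    {κ : Path.Homotopic.Quotient x x'} {κ' : Path.Homotopic.Quotient x' x''} {h₁ h₂ : ℂ × ℂ → ℂ}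
    (hh₁ : IsHolonomyMap F η p q κ h₁) (hh₂ : IsHolonomyMap F η q r κ' h₂) :
    IsHolonomyMap F η p r (κ.trans κ') (compGerm h₂ h₁) := by
  obtain ⟨ha₁, h0₁, U₁, hU₁, V₁, hV₁, H₁, H₁', c₁, hH₁, hH₁', ht₁, hc₁, rfl⟩ := hh₁
  obtain ⟨ha₂, h0₂, U₂, hU₂, V₂, hV₂, H₂, H₂', c₂, hH₂, hH₂', ht₂, hc₂, rfl⟩ := hh₂
  refine ⟨analyticAt_compGerm ha₂ ha₁ h0₁, by simp [compGerm, h0₁, h0₂], ?_⟩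
  have hev : ∀ᶠ z in 𝓝 ((t₀, 0) : ℂ × ℂ), (z.1 ∈ U₁ ∧ z.2 ∈ V₁) ∧ z.2 ∈ V₂ ∧ h₁ z ∈ U₂ ∧
      ContinuousAt h₁ z := by
    have e1 : ∀ᶠ z in 𝓝 ((t₀, 0) : ℂ × ℂ), z.1 ∈ U₁ ∧ z.2 ∈ V₁ := prod_mem_nhds hU₁ hV₁
    filter_upwards [e1, (continuous_snd.tendsto ((t₀, 0) : ℂ × ℂ)).eventually hV₂,
      ha₁.continuousAt.eventually (by rwa [h0₁]), ha₁.eventually_continuousAt] with z e1 e2 e3 e4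
    exact ⟨e1, e2, e3, e4⟩
  obtain ⟨U, hU, V, hV, hUV⟩ := exists_prod_of_eventually hev
  let φ₁ : ℝ → ℝ := fun s => Real.smoothTransition (2 * s)
  let φ₂ : ℝ → ℝ := fun s => Real.smoothTransition (2 * s - 1)
  let ψ₁ : ℝ → ℝ := fun s => deriv Real.smoothTransition (2 * s) * 2
  let ψ₂ : ℝ → ℝ := fun s => deriv Real.smoothTransition (2 * s - 1) * 2
  have hφ₁ : ∀ s, φ₁ s ∈ Set.Icc (0 : ℝ) 1 := fun s =>
    ⟨Real.smoothTransition.nonneg _, Real.smoothTransition.le_one _⟩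
  have hφ₂ : ∀ s, φ₂ s ∈ Set.Icc (0 : ℝ) 1 := fun s =>
    ⟨Real.smoothTransition.nonneg _, Real.smoothTransition.le_one _⟩
  have hφψ₁ : ∀ s, HasDerivAt φ₁ (ψ₁ s) s := fun s =>
    (hasDerivAt_smoothTransition (2 * s)).comp s
      (by simpa using (hasDerivAt_id s).const_mul (2 : ℝ))
  have hφψ₂ : ∀ s, HasDerivAt φ₂ (ψ₂ s) s := fun s =>
    HasDerivAt.comp (h := fun s : ℝ => 2 * s - 1) s (hasDerivAt_smoothTransition (2 * s - 1))
      (by simpa using ((hasDerivAt_id s).const_mul (2 : ℝ)).sub_const 1)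
  have hφ₁c : Continuous φ₁ := Real.smoothTransition.continuous.comp (by fun_prop)
  have hφ₂c : Continuous φ₂ := Real.smoothTransition.continuous.comp (by fun_prop)
  have hψ₁c : Continuous ψ₁ :=
    (continuous_deriv_smoothTransition.comp (by fun_prop : Continuous fun s : ℝ => 2 * s)).mul
      continuous_const
  have hψ₂c : Continuous ψ₂ :=
    (continuous_deriv_smoothTransition.comp
      (by fun_prop : Continuous fun s : ℝ => 2 * s - 1)).mul continuous_const
  have hh₁c : ContinuousOn (fun z : ℝ × ℂ × ℂ => h₁ z.2) (Set.Icc 0 1 ×ˢ U ×ˢ V) := fun z hz =>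
    (ContinuousAt.comp (f := fun z : ℝ × ℂ × ℂ => z.2) (hUV _ hz.2.1 _ hz.2.2).2.2.2
      continuous_snd.continuousAt).continuousWithinAt
  have hm₁ : Set.MapsTo (fun z : ℝ × ℂ × ℂ => (φ₁ z.1, z.2.1, z.2.2)) (Set.Icc 0 1 ×ˢ U ×ˢ V)
      (Set.Icc 0 1 ×ˢ U₁ ×ˢ V₁) := fun z hz =>
    ⟨hφ₁ _, (hUV _ hz.2.1 _ hz.2.2).1.1, (hUV _ hz.2.1 _ hz.2.2).1.2⟩
  have hm₂ : Set.MapsTo (fun z : ℝ × ℂ × ℂ => (φ₂ z.1, h₁ z.2, z.2.2)) (Set.Icc 0 1 ×ˢ U ×ˢ V)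
      (Set.Icc 0 1 ×ˢ U₂ ×ˢ V₂) := fun z hz =>
    ⟨hφ₂ _, (hUV _ hz.2.1 _ hz.2.2).2.2.1, (hUV _ hz.2.1 _ hz.2.2).2.1⟩
  have hm₃ : Set.MapsTo (fun z : ℝ × ℂ × ℂ => ((1 : ℝ), z.2.1, z.2.2)) (Set.Icc 0 1 ×ˢ U ×ˢ V)
      (Set.Icc 0 1 ×ˢ U₁ ×ˢ V₁) := fun z hz =>
    ⟨⟨zero_le_one, le_rfl⟩, (hUV _ hz.2.1 _ hz.2.2).1.1, (hUV _ hz.2.1 _ hz.2.2).1.2⟩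
  have hk₁ : ContinuousOn (fun z : ℝ × ℂ × ℂ => (φ₁ z.1, z.2.1, z.2.2))
      (Set.Icc 0 1 ×ˢ U ×ˢ V) := Continuous.continuousOn (by fun_prop)
  have hk₂ : ContinuousOn (fun z : ℝ × ℂ × ℂ => (φ₂ z.1, h₁ z.2, z.2.2))
      (Set.Icc 0 1 ×ˢ U ×ˢ V) :=
    (hφ₂c.comp continuous_fst).continuousOn.prodMk (hh₁c.prodMk (by fun_prop))
  have hk₃ : ContinuousOn (fun z : ℝ × ℂ × ℂ => ((1 : ℝ), z.2.1, z.2.2))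
      (Set.Icc 0 1 ×ˢ U ×ˢ V) := Continuous.continuousOn (by fun_prop)
  -- at each time one of the first two terms equals the last one
  refine ⟨U, hU, V, hV,
    fun s t ε => H₁ (φ₁ s) t ε + H₂ (φ₂ s) (h₁ (t, ε)) ε - H₁ 1 t ε,
    fun s t ε => ψ₁ s • H₁' (φ₁ s) t ε + ψ₂ s • H₂' (φ₂ s) (h₁ (t, ε)) ε,
    (c₁.reparam smoothStep smoothStep.continuous (by ext; simp [smoothStep])
      (by ext; simp [smoothStep])).trans
    (c₂.reparam smoothStep smoothStep.continuous (by ext; simp [smoothStep])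
      (by ext; simp [smoothStep])), ?_, ?_, ?_, ?_, ?_⟩
  · exact ((hH₁.comp hk₁ hm₁).add (hH₂.comp hk₂ hm₂)).sub (hH₁.comp hk₃ hm₃)
  · exact ((hψ₁c.comp continuous_fst).continuousOn.smul (hH₁'.comp hk₁ hm₁)).add
      ((hψ₂c.comp continuous_fst).continuousOn.smul (hH₂'.comp hk₂ hm₂))
  · intro t ht ε hε
    obtain ⟨⟨e1, e2⟩, e3, e4, -⟩ := hUV t ht ε hε
    obtain ⟨f1, f2, f3⟩ := ht₁ t e1 ε e2
    obtain ⟨g1, g2, g3⟩ := ht₂ _ e4 ε e3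
    refine ⟨fun s hs => ⟨?_, ?_⟩, ?_, ?_⟩
    · have d1 := HasDerivWithinAt.scomp s (f1 (φ₁ s) (hφ₁ s)).1 (hφψ₁ s).hasDerivWithinAt
        (fun y (_ : y ∈ Set.Icc (0 : ℝ) 1) => hφ₁ y)
      have d2 := HasDerivWithinAt.scomp s (g1 (φ₂ s) (hφ₂ s)).1 (hφψ₂ s).hasDerivWithinAt
        (fun y (_ : y ∈ Set.Icc (0 : ℝ) 1) => hφ₂ y)
      exact (d1.add d2).sub_const _
    · rcases le_total (2 * s) 1 with h | h
      · have h1 : φ₂ s = 0 := Real.smoothTransition.zero_of_nonpos (by linarith)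
        have h2 : ψ₂ s = 0 := by
          simp only [ψ₂, deriv_smoothTransition_of_nonpos (show 2 * s - 1 ≤ 0 by linarith), zero_mul]
        simp only [h1, h2, g2, f3, zero_smul, add_zero, add_sub_cancel_right]
        exact deformedForm_real_smul (f1 _ (hφ₁ s)).2 _
      · have h1 : φ₁ s = 1 := Real.smoothTransition.one_of_one_le h
        have h2 : ψ₁ s = 0 := by
          simp only [ψ₁, deriv_smoothTransition_of_one_le h, zero_mul]
        simp only [h1, h2, zero_smul, zero_add, add_sub_cancel_left]
        exact deformedForm_real_smul (g1 _ (hφ₂ s)).2 _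
    · have h1 : φ₁ 0 = 0 := by simp [φ₁]
      have h2 : φ₂ 0 = 0 := Real.smoothTransition.zero_of_nonpos (by norm_num)
      simp only [h1, h2, g2, f2, f3, add_sub_cancel_right]
    · have h1 : φ₁ 1 = 1 := Real.smoothTransition.one_of_one_le (by norm_num)
      have h2 : φ₂ 1 = 1 := Real.smoothTransition.one_of_one_le (by norm_num)
      simp only [h1, h2, g3, add_sub_cancel_left]
      rfl
  · intro s
    have hc₁' : ∀ a : ℝ, ∀ ha : a ∈ Set.Icc (0 : ℝ) 1, H₁ a t₀ 0 = (c₁ ⟨a, ha⟩ : Plane) :=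
      fun a ha => hc₁ ⟨a, ha⟩
    have hc₂' : ∀ a : ℝ, ∀ ha : a ∈ Set.Icc (0 : ℝ) 1, H₂ a t₀ 0 = (c₂ ⟨a, ha⟩ : Plane) :=
      fun a ha => hc₂ ⟨a, ha⟩
    have hx1 : H₁ 1 t₀ 0 = (x' : Plane) := by
      rw [hc₁' 1 ⟨zero_le_one, le_rfl⟩]; exact congrArg Subtype.val c₁.target
    have hx2 : H₂ 0 t₀ 0 = (x' : Plane) := by
      rw [hc₂' 0 ⟨le_rfl, zero_le_one⟩]; exact congrArg Subtype.val c₂.source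
    simp only [h0₁]
    rw [Path.trans_apply]
    split_ifs with h
    · have h1 : φ₂ s = 0 := Real.smoothTransition.zero_of_nonpos (by linarith)
      rw [h1, hx1, hx2, add_sub_cancel_right, hc₁' _ (hφ₁ s)]
      rfl
    · have h1 : φ₁ s = 1 := Real.smoothTransition.one_of_one_le (by linarith)
      rw [h1, hx1, add_sub_cancel_left, hc₂' _ (hφ₂ s)]
      rfl
  · rw [Path.Homotopic.Quotient.mk_trans]
    congr 1
    · exact Path.Homotopic.Quotient.eq.2 ⟨(Path.Homotopy.reparam c₁ _ _ _ _).symm⟩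
    · exact Path.Homotopic.Quotient.eq.2 ⟨(Path.Homotopy.reparam c₂ _ _ _ _).symm⟩

/-- Two paths which are lifted to a disc, with the same ends, are homotopic. -/
lemma homotopic_of_lift_ball {X : Type*} [TopologicalSpace X] {ρ : ℝ}
    {f : C(Metric.ball (0 : ℂ) ρ, X)} {x x' : X} {c c' : Path x x'}
    {d d' : C(I, Metric.ball (0 : ℂ) ρ)} (hd : ∀ s, c s = f (d s)) (hd' : ∀ s, c' s = f (d' s))
    (h0 : d 0 = d' 0) (h1 : d 1 = d' 1) : c.Homotopic c' := by
  obtain rfl : x = f (d 0) := by rw [← hd, c.source]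
  obtain rfl : x' = f (d 1) := by rw [← hd, c.target]
  have : Nonempty (Metric.ball (0 : ℂ) ρ) := ⟨d 0⟩
  have : ContractibleSpace (Metric.ball (0 : ℂ) ρ) :=
    (convex_ball (0 : ℂ) ρ).contractibleSpace (Set.nonempty_coe_sort.1 this)
  let e : Path (d 0) (d 1) := ⟨d, rfl, rfl⟩
  let e' : Path (d 0) (d 1) := ⟨d', h0.symm, h1.symm⟩
  have he : c = e.map f.continuous := by ext s; exact hd s
  have he' : c' = e'.map f.continuous := by ext s; exact hd' s
  rw [he, he']
  exact (SimplyConnectedSpace.paths_homotopic e e').map f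

/-- Holonomy maps exist inside a flow box. In the coordinates of the flow box, the tangent paths
are segments. -/
lemma eventually_exists_isHolonomyMap (hF : IsRegularFiber F η t₀) {x x' : Fiber F t₀}
    (c : Path x x') (s : I) : ∃ J ∈ 𝓝 s, ∀ a ∈ J, ∀ b ∈ J, ∀ q q' : ℂ → Plane,
      IsTransversal F (c a) q → IsTransversal F (c b) q' →
      ∃ h, IsHolonomyMap F η q q' (Path.Homotopic.Quotient.mk (c.subpath a b)) h := by
  obtain ⟨p, hp⟩ := exists_isTransversal (hF.reg (c s))
  obtain ⟨χ, Φ, ζ, hχ, hχ0, hΦ, hζ, hζ0, -, hbox, hinv⟩ := exists_flowBox hF.conv (hF.reg (c s)) hp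
  -- the points `w` of the coordinate domain around which the flow box is defined
  have hW : ∀ᶠ w in 𝓝 (((t₀, 0), 0) : (ℂ × ℂ) × ℂ), ContinuousAt χ w ∧
      HasDerivAt (fun z => χ (w.1, z)) (leafField F η (χ w, w.1.2)) w.2 ∧
      ContinuousAt (leafField F η) (χ w, w.1.2) ∧
      (w.1.2 = 0 → MvPolynomial.eval (χ w) F = w.1.1) := by
    have h1 : Filter.Tendsto (fun w : (ℂ × ℂ) × ℂ => (χ w, w.1.2)) (𝓝 ((t₀, 0), 0))
        (𝓝 ((c s : Plane), 0)) := by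
      have := hχ.continuousAt.tendsto
      rw [hχ0] at this
      exact this.prodMk_nhds (Continuous.tendsto (by fun_prop) (((t₀, 0), 0) : (ℂ × ℂ) × ℂ))
    have h2 := hχ.continuousAt.tendsto
    rw [hχ0] at h2
    filter_upwards [hχ.eventually_continuousAt, hbox,
      h1.eventually (analyticAt_leafField hF.conv (c s : Plane)).eventually_continuousAt,
      h2.eventually hΦ.eventually_eq] with w e1 e2 e3 e4
    refine ⟨e1, e2.1, e3, fun hw => ?_⟩
    rw [← e4, ← e2.2.1, hw]
  rw [nhds_prod_eq] at hW
  obtain ⟨pa, hpa, pb, hpb, hW⟩ := Filter.eventually_prod_iff.1 hW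
  obtain ⟨ρ, hρ, hρb⟩ := Metric.eventually_nhds_iff_ball.1 hpb
  -- the points near `c s`
  have hN : ∀ᶠ y in 𝓝 (c s : Plane), (IsFirstIntegralAt F η y Φ ∧ AnalyticAt ℂ ζ (y, 0) ∧
      ζ (y, 0) ∈ Metric.ball 0 ρ) ∧
      ∀ᶠ v in 𝓝 ((y, 0) : Plane × ℂ), χ ((Φ v, v.2), ζ v) = v.1 := by
    have h3 : ∀ᶠ v in 𝓝 ((c s : Plane), (0 : ℂ)), ζ v ∈ Metric.ball 0 ρ :=
      hζ.continuousAt.eventually (by rw [hζ0]; exact Metric.ball_mem_nhds _ hρ)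
    filter_upwards [hΦ.eventually, (tendsto_prodMk_zero _).eventually hζ.eventually_analyticAt,
      (tendsto_prodMk_zero _).eventually h3,
      (tendsto_prodMk_zero _).eventually hinv.eventually_nhds] with y e1 e2 e3 e4
    exact ⟨⟨e1, e2, e3⟩, e4⟩
  have hcs : Continuous fun a => (c a : Plane) := continuous_subtype_val.comp c.continuous
  obtain ⟨J, hJ, hJN, hJo⟩ := exists_ordConnected_mem_nhds (hcs.continuousAt.eventually hN)
  refine ⟨J, hJ, fun a ha b hb q q' hq hq' => ?_⟩
  obtain ⟨⟨hΦa, hζa, hζaρ⟩, hinva⟩ := hJN ha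
  obtain ⟨⟨hΦb, hζb, hζbρ⟩, hinvb⟩ := hJN hb
  -- the parameters of the two transversals
  have hka := hq.isHolonomyGerm hΦa
  have hkb := hq'.isHolonomyGerm hΦb
  obtain ⟨mb, hmb, hkbmb, -⟩ := hkb.exists_inverse
  set ka : ℂ × ℂ → ℂ := fun z => Φ (q z.1, z.2) with hka_def
  set kb : ℂ × ℂ → ℂ := fun z => Φ (q' z.1, z.2) with hkb_def
  have hh := hmb.comp hka
  set h := compGerm mb ka with h_def
  have hhk : ∀ᶠ z in 𝓝 ((t₀, 0) : ℂ × ℂ), kb (h z, z.2) = ka z :=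
    (tendsto_prodMk_snd hka.analyticAt.continuousAt hka.apply_zero).eventually hkbmb
  have hht : Filter.Tendsto (fun z : ℂ × ℂ => (h z, z.2)) (𝓝 (t₀, 0)) (𝓝 (t₀, 0)) :=
    tendsto_prodMk_snd hh.analyticAt.continuousAt hh.apply_zero
  let za : ℂ × ℂ → ℂ := fun z => ζ (q z.1, z.2)
  let zb : ℂ × ℂ → ℂ := fun z => ζ (q' (h z), z.2)
  have hza : AnalyticAt ℂ za (t₀, 0) := AnalyticAt.comp_of_eq
    (f := fun z : ℂ × ℂ => (q z.1, z.2)) hζa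
    ((AnalyticAt.comp_of_eq hq.1 analyticAt_fst rfl).prod analyticAt_snd) (by simp [hq.2.1])
  have hzb : AnalyticAt ℂ zb (t₀, 0) := AnalyticAt.comp_of_eq
    (f := fun z : ℂ × ℂ => (q' (h z), z.2)) hζb
    ((AnalyticAt.comp_of_eq hq'.1 hh.analyticAt hh.apply_zero).prod analyticAt_snd)
    (by simp [hh.apply_zero, hq'.2.1])
  have hza0 : za (t₀, 0) = ζ (c a, 0) := by simp [za, hq.2.1]
  have hzb0 : zb (t₀, 0) = ζ (c b, 0) := by simp [zb, hh.apply_zero, hq'.2.1]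
  have hev : ∀ᶠ z in 𝓝 ((t₀, 0) : ℂ × ℂ), (pa (ka z, z.2) ∧ za z ∈ Metric.ball 0 ρ ∧
      zb z ∈ Metric.ball 0 ρ) ∧ (ContinuousAt ka z ∧ ContinuousAt za z ∧ ContinuousAt zb z) ∧
      χ ((ka z, z.2), za z) = q z.1 ∧ χ ((ka z, z.2), zb z) = q' (h z) := by
    filter_upwards [(tendsto_prodMk_snd hka.analyticAt.continuousAt hka.apply_zero).eventually hpa,
      hza.continuousAt.eventually (by rw [hza0]; exact Metric.isOpen_ball.mem_nhds hζaρ),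
      hzb.continuousAt.eventually (by rw [hzb0]; exact Metric.isOpen_ball.mem_nhds hζbρ),
      hka.analyticAt.eventually_continuousAt, hza.eventually_continuousAt,
      hzb.eventually_continuousAt, hq.tendsto.eventually hinva,
      (hq'.tendsto.comp hht).eventually hinvb, hhk] with z e1 e2 e3 e4 e5 e6 e7 e8 e9
    refine ⟨⟨e1, e2, e3⟩, ⟨e4, e5, e6⟩, e7, ?_⟩
    rw [← e9]
    exact e8
  obtain ⟨U, hU, V, hV, hUV⟩ := exists_prod_of_eventually hev
  have hseg : ∀ z : ℂ × ℂ, za z ∈ Metric.ball 0 ρ → zb z ∈ Metric.ball 0 ρ →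
      ∀ r ∈ Set.Icc (0 : ℝ) 1, za z + (r : ℂ) * (zb z - za z) ∈ Metric.ball 0 ρ := by
    intro z h1 h2 r hr
    have := (convex_ball (0 : ℂ) ρ).add_smul_sub_mem h1 h2 hr
    rwa [Complex.real_smul] at this
  let w : ℝ × ℂ × ℂ → (ℂ × ℂ) × ℂ := fun z =>
    ((ka z.2, z.2.2), za z.2 + (z.1 : ℂ) * (zb z.2 - za z.2))
  have hwc : ∀ z ∈ Set.Icc (0 : ℝ) 1 ×ˢ U ×ˢ V, ContinuousAt w z := by
    intro z hz
    obtain ⟨-, ⟨e1, e2, e3⟩, -⟩ := hUV _ hz.2.1 _ hz.2.2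
    have f : ∀ {k : ℂ × ℂ → ℂ}, ContinuousAt k z.2 →
        ContinuousAt (fun z : ℝ × ℂ × ℂ => k z.2) z := fun hk =>
      ContinuousAt.comp (f := fun z : ℝ × ℂ × ℂ => z.2) hk continuous_snd.continuousAt
    have f1 := f e1
    have f2 := f e2
    have f3 := f e3
    have f4 : ContinuousAt (fun z : ℝ × ℂ × ℂ => (z.1 : ℂ)) z :=
      Continuous.continuousAt (by fun_prop)
    exact (f1.prodMk (Continuous.continuousAt (by fun_prop))).prodMk (f2.add (f4.mul (f3.sub f2)))
  have hWw : ∀ z ∈ Set.Icc (0 : ℝ) 1 ×ˢ U ×ˢ V, ContinuousAt χ (w z) ∧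
      HasDerivAt (fun y => χ ((w z).1, y)) (leafField F η (χ (w z), z.2.2)) (w z).2 ∧
      ContinuousAt (leafField F η) (χ (w z), z.2.2) ∧
      (z.2.2 = 0 → MvPolynomial.eval (χ (w z)) F = (w z).1.1) := fun z hz =>
    hW (hUV _ hz.2.1 _ hz.2.2).1.1 (hρb _ (hseg z.2 (hUV _ hz.2.1 _ hz.2.2).1.2.1
      (hUV _ hz.2.1 _ hz.2.2).1.2.2 z.1 hz.1))
  -- the central plaque
  have hplaque : ∀ z ∈ Metric.ball (0 : ℂ) ρ, MvPolynomial.eval (χ ((t₀, 0), z)) F = t₀ :=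
    fun z hz => (hW hpa.self_of_nhds (hρb z hz)).2.2.2 rfl
  let f : C(Metric.ball (0 : ℂ) ρ, Fiber F t₀) :=
    ⟨fun z => ⟨χ ((t₀, 0), z), hplaque z z.2⟩, Continuous.subtype_mk
      (continuous_iff_continuousAt.2 fun z =>
        ContinuousAt.comp (f := fun z : Metric.ball (0 : ℂ) ρ => (((t₀, 0) : ℂ × ℂ), (z : ℂ)))
          (hW hpa.self_of_nhds (hρb z z.2)).1 (Continuous.continuousAt (by fun_prop))) _⟩
  have hka0 : ka (t₀, 0) = t₀ := hka.apply_zero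
  obtain ⟨⟨-, hzaρ, hzbρ⟩, -, hχa, hχb⟩ := hUV t₀ (mem_of_mem_nhds hU) 0 (mem_of_mem_nhds hV)
  rw [hka0] at hχa hχb
  simp only [hh.apply_zero, hq.2.1, hq'.2.1] at hχa hχb
  let d : C(I, Metric.ball (0 : ℂ) ρ) :=
    ⟨fun r => ⟨za (t₀, 0) + ((r : ℝ) : ℂ) * (zb (t₀, 0) - za (t₀, 0)),
      hseg _ hzaρ hzbρ r r.2⟩, by fun_prop⟩
  have hsubJ : ∀ r : I, c.subpath a b r ∈ c '' J := by
    intro r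
    have h1 : c.subpath a b r ∈ Set.range (c.subpath a b) := ⟨r, rfl⟩
    rw [Path.range_subpath] at h1
    exact Set.image_mono (hJo.uIcc_subset ha hb) h1
  have hd'ρ : ∀ r, ζ ((c.subpath a b r : Plane), 0) ∈ Metric.ball (0 : ℂ) ρ := by
    intro r
    obtain ⟨r', hr', e⟩ := hsubJ r
    rw [← e]
    exact (hJN hr').1.2.2
  have hd'c : Continuous fun r => ζ ((c.subpath a b r : Plane), 0) := by
    refine continuous_iff_continuousAt.2 fun r => ?_
    obtain ⟨r', hr', e⟩ := hsubJ r
    have h1 := (hJN hr').1.2.1.continuousAt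
    simp only [e] at h1
    exact ContinuousAt.comp (f := fun r : I => ((c.subpath a b r : Plane), (0 : ℂ))) h1
      (Continuous.continuousAt (by fun_prop))
  let d' : C(I, Metric.ball (0 : ℂ) ρ) :=
    ⟨fun r => ⟨ζ ((c.subpath a b r : Plane), 0), hd'ρ r⟩, hd'c.subtype_mk _⟩
  let c₀ : Path (c a) (c b) :=
    ⟨f.comp d, by ext1; simpa [f, d] using hχa, by ext1; simpa [f, d] using hχb⟩
  refine ⟨h, hh.analyticAt, hh.apply_zero, U, hU, V, hV, fun r t ε => χ (w (r, t, ε)),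
    fun r t ε => (zb (t, ε) - za (t, ε)) • leafField F η (χ (w (r, t, ε)), ε), c₀,
    fun z hz => ((hWw z hz).1.comp (hwc z hz)).continuousWithinAt, fun z hz => ?_,
    fun t ht ε hε => ⟨fun r hr => ?_, ?_, ?_⟩, fun r => by simp only [w, hka0]; rfl, ?_⟩
  · obtain ⟨-, ⟨-, e2, e3⟩, -⟩ := hUV _ hz.2.1 _ hz.2.2
    have f' : ∀ {k : ℂ × ℂ → ℂ}, ContinuousAt k z.2 →
        ContinuousAt (fun z : ℝ × ℂ × ℂ => k z.2) z := fun hk =>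
      ContinuousAt.comp (f := fun z : ℝ × ℂ × ℂ => z.2) hk continuous_snd.continuousAt
    refine (((f' e3).sub (f' e2)).smul ?_).continuousWithinAt
    exact ContinuousAt.comp (f := fun z : ℝ × ℂ × ℂ => (χ (w z), z.2.2)) (hWw z hz).2.2.1
      (((hWw z hz).1.comp (hwc z hz)).prodMk (Continuous.continuousAt (by fun_prop)))
  · refine ⟨?_, deformedForm_smul_leafField _ _ _⟩
    have h1 := (hWw (r, t, ε) ⟨hr, ht, hε⟩).2.1
    have h2 : HasDerivAt (fun r : ℝ => za (t, ε) + (r : ℂ) * (zb (t, ε) - za (t, ε)))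
        (zb (t, ε) - za (t, ε)) r := by
      simpa using ((Complex.ofRealCLM.hasDerivAt (x := r)).mul_const
        (zb (t, ε) - za (t, ε))).const_add (za (t, ε))
    exact (HasDerivAt.scomp r h1 h2).hasDerivWithinAt
  · have := (hUV t ht ε hε).2.2.1
    simpa [w] using this
  · have := (hUV t ht ε hε).2.2.2
    simpa [w] using this
  · refine Path.Homotopic.Quotient.eq.2 (homotopic_of_lift_ball (f := f) (d := d) (d' := d')
      (fun r => rfl) (fun r => ?_) ?_ ?_)
    · obtain ⟨r', hr', e⟩ := hsubJ r
      have h1 := (hJN hr').2.self_of_nhds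
      rw [(hJN hr').1.1.apply_zero] at h1
      simp only [e] at h1
      ext1
      exact h1.symm
    · ext1
      simp [d, d', hza0]
    · ext1
      simp [d, d', hzb0]

/-- Holonomy maps exist along every path of a regular fiber. -/
lemma exists_isHolonomyMap (hF : IsRegularFiber F η t₀) {x x' : Fiber F t₀}
    (κ : Path.Homotopic.Quotient x x') {p q : ℂ → Plane} (hp : IsTransversal F x p)
    (hq : IsTransversal F x' q) : ∃ h, IsHolonomyMap F η p q κ h := by
  obtain ⟨c, rfl⟩ := Path.Homotopic.Quotient.mk_surjective κ
  have hp' : IsTransversal F (c 0) p := by rwa [c.source]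
  have hq' : IsTransversal F (c 1) q := by rwa [c.target]
  have key : ∀ r, IsTransversal F (c 1) r →
      ∃ h, IsHolonomyMap F η p r (Path.Homotopic.Quotient.mk (c.subpath 0 1)) h := by
    refine unitInterval_induction (P := fun s => ∀ r, IsTransversal F (c s) r →
      ∃ h, IsHolonomyMap F η p r (Path.Homotopic.Quotient.mk (c.subpath 0 s)) h) (fun s => ?_) 0 1 ?_
    · obtain ⟨J, hJ, h⟩ := eventually_exists_isHolonomyMap hF c s
      have step : ∀ a ∈ J, ∀ b ∈ J, (∀ r, IsTransversal F (c a) r →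
          ∃ h, IsHolonomyMap F η p r (Path.Homotopic.Quotient.mk (c.subpath 0 a)) h) →
          ∀ r, IsTransversal F (c b) r →
          ∃ h, IsHolonomyMap F η p r (Path.Homotopic.Quotient.mk (c.subpath 0 b)) h := by
        intro a ha b hb hPa r hr
        obtain ⟨r', hr'⟩ := exists_isTransversal (hF.reg (c a))
        obtain ⟨h₁, hh₁⟩ := hPa r' hr'
        obtain ⟨h₂, hh₂⟩ := h a ha b hb r' r hr' hr
        have h3 := hh₁.trans hh₂
        rw [← Path.Homotopic.Quotient.mk_trans, Path.Homotopic.Quotient.eq.2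
          ⟨Path.Homotopy.subpathTransSubpath c 0 a b⟩] at h3
        exact ⟨_, h3⟩
      filter_upwards [hJ] with b hb
      exact ⟨step b hb s (mem_of_mem_nhds hJ), step s (mem_of_mem_nhds hJ) b hb⟩
    · obtain ⟨J, hJ, h⟩ := eventually_exists_isHolonomyMap hF c 0
      exact fun r hr => h 0 (mem_of_mem_nhds hJ) 0 (mem_of_mem_nhds hJ) p r hp' hr
  obtain ⟨h, hh⟩ := key q hq'
  refine ⟨h, ?_⟩
  have h1 := hh.cast (y := x) (y' := x') (by simp) (by simp)
  rw [← Path.Homotopic.Quotient.mk_cast, Path.subpath_zero_one] at h1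
  exact h1

end Melnikov

namespace Melnikov

/-! ### Order of vanishing in the parameter -/

variable {F : MvPolynomial (Fin 2) ℂ} {η : ℕ → Fin 2 → MvPolynomial (Fin 2) ℂ} {t₀ : ℂ}

section Order

/-- Powers of the parameter `ε` can be cancelled in equations between continuous germs. -/
lemma eventuallyEq_of_pow_mul {E : Type*} [TopologicalSpace E] {f g : E × ℂ → ℂ} {x : E} (μ : ℕ)
    (hf : ∀ᶠ v in 𝓝 ((x, 0) : E × ℂ), ContinuousAt f v)
    (hg : ∀ᶠ v in 𝓝 ((x, 0) : E × ℂ), ContinuousAt g v)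
    (h : ∀ᶠ v in 𝓝 ((x, 0) : E × ℂ), v.2 ^ μ * f v = v.2 ^ μ * g v) : f =ᶠ[𝓝 (x, 0)] g := by
  filter_upwards [hf, hg, h.eventually_nhds] with v h1 h2 h3
  by_cases hv : v.2 = 0
  · have hl : Filter.Tendsto (fun z : ℂ => (v.1, z)) (𝓝[≠] 0) (𝓝 v) := by
      have := (Continuous.prodMk_right v.1).tendsto (0 : ℂ)
      rw [show (v.1, (0 : ℂ)) = v from Prod.ext rfl hv.symm] at this
      exact this.mono_left nhdsWithin_le_nhds
    refine tendsto_nhds_unique ((h1.tendsto.comp hl).congr' ?_) (h2.tendsto.comp hl)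
    filter_upwards [hl.eventually h3, self_mem_nhdsWithin] with z h4 hz
    exact mul_left_cancel₀ (pow_ne_zero μ hz) h4
  · exact mul_left_cancel₀ (pow_ne_zero μ hv) h3.self_of_nhds

variable {E : Type*} [NormedAddCommGroup E] [NormedSpace ℂ E]

/-- The germ of `D` at `(x, 0)` is divisible by `ε ^ μ`. -/
def IsDivisibleAt (μ : ℕ) (D : E × ℂ → ℂ) (x : E) : Prop :=
  ∃ R : E × ℂ → ℂ, AnalyticAt ℂ R (x, 0) ∧ D =ᶠ[𝓝 (x, 0)] fun v => v.2 ^ μ * R v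

lemma IsDivisibleAt.congr {μ : ℕ} {D D' : E × ℂ → ℂ} {x : E} (h : IsDivisibleAt μ D x)
    (hD : D =ᶠ[𝓝 (x, 0)] D') : IsDivisibleAt μ D' x := by
  obtain ⟨R, hR, he⟩ := h
  exact ⟨R, hR, hD.symm.trans he⟩

lemma isDivisibleAt_succ_iff {μ : ℕ} {D D' : E × ℂ → ℂ} {x : E} (hD' : AnalyticAt ℂ D' (x, 0))
    (h : ∀ᶠ v in 𝓝 ((x, 0) : E × ℂ), D v = v.2 * D' v) :
    IsDivisibleAt (μ + 1) D x ↔ IsDivisibleAt μ D' x := by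
  constructor
  · rintro ⟨R, hR, he⟩
    have hR' : AnalyticAt ℂ (fun v : E × ℂ => v.2 ^ μ * R v) (x, 0) :=
      (analyticAt_snd.pow μ).mul hR
    refine ⟨R, hR, eventuallyEq_of_pow_mul 1 hD'.eventually_continuousAt
      hR'.eventually_continuousAt ?_⟩
    filter_upwards [h, he] with v h1 h2
    rw [pow_one, ← h1, h2]
    ring
  · rintro ⟨R, hR, he⟩
    refine ⟨R, hR, ?_⟩
    filter_upwards [h, he] with v h1 h2
    rw [h1, h2]
    ring

/-- Divisibility of an analytic function by a power of `ε` does not change at the nearby points. -/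
lemma eventually_isDivisibleAt_iff (μ : ℕ) {D : E × ℂ → ℂ} {x : E} (hD : AnalyticAt ℂ D (x, 0)) :
    ∀ᶠ y in 𝓝 x, (IsDivisibleAt μ D y ↔ IsDivisibleAt μ D x) := by
  have htriv : ∀ {D : E × ℂ → ℂ} {y : E}, AnalyticAt ℂ D (y, 0) → IsDivisibleAt 0 D y :=
    fun h => ⟨_, h, by simp⟩
  induction μ generalizing D with
  | zero =>
    filter_upwards [(tendsto_prodMk_zero x).eventually hD.eventually_analyticAt] with y hy
    exact ⟨fun _ => htriv hD, fun _ => htriv hy⟩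
  | succ μ ih =>
    have ha : AnalyticAt ℂ (fun y : E => D (y, 0)) x :=
      AnalyticAt.comp_of_eq (f := fun y : E => (y, (0 : ℂ))) hD
        (analyticAt_id.prod analyticAt_const) rfl
    have hvan : ∀ {y : E}, IsDivisibleAt (μ + 1) D y →
        (fun y : E => D (y, 0)) =ᶠ[𝓝 y] fun _ => 0 := by
      rintro y ⟨R, -, he⟩
      filter_upwards [(tendsto_prodMk_zero y).eventually he] with z hz
      simpa using hz
    have hid := eventually_eventuallyEq_iff ha (analyticAt_const (v := (0 : ℂ)) (x := x))
    by_cases h0 : (fun y : E => D (y, 0)) =ᶠ[𝓝 x] fun _ => 0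
    · obtain ⟨D', hD', he⟩ := exists_eq_mul_of_eq_zero hD h0
      filter_upwards [ih hD', (tendsto_prodMk_zero x).eventually he.eventually_nhds,
        (tendsto_prodMk_zero x).eventually hD'.eventually_analyticAt] with y h1 h2 h3
      rw [isDivisibleAt_succ_iff h3 h2, isDivisibleAt_succ_iff hD' he, h1]
    · filter_upwards [hid] with y hy
      exact ⟨fun h => absurd (hy.1 (hvan h)) h0, fun h => absurd (hvan h) h0⟩

end Order

/-! ### Leading terms of holonomy germs -/

/-- `g (t, ε) = t + ε ^ μ (m t + O(ε))`. -/
def HasLeadingTerm (t₀ : ℂ) (μ : ℕ) (g : ℂ × ℂ → ℂ) (m : ℂ → ℂ) : Prop :=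
  IsHolonomyGerm t₀ g ∧ ∃ r : ℂ × ℂ → ℂ, AnalyticAt ℂ r (t₀, 0) ∧
    (∀ᶠ v in 𝓝 ((t₀, 0) : ℂ × ℂ), g v = v.1 + v.2 ^ μ * r v) ∧ ∀ᶠ t in 𝓝 t₀, r (t, 0) = m t

namespace HasLeadingTerm

variable {μ : ℕ} {g g' a a' : ℂ × ℂ → ℂ} {m m' : ℂ → ℂ}

lemma congr (h : HasLeadingTerm t₀ μ g m) (he : g =ᶠ[𝓝 (t₀, 0)] g') :
    HasLeadingTerm t₀ μ g' m := by
  obtain ⟨hg, r, hr, h1, h2⟩ := h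
  refine ⟨hg.congr he, r, hr, ?_, h2⟩
  filter_upwards [h1, he] with v h3 h4
  rw [← h4, h3]

lemma unique (h : HasLeadingTerm t₀ μ g m) (h' : HasLeadingTerm t₀ μ g m') : m =ᶠ[𝓝 t₀] m' := by
  obtain ⟨-, r, hr, h1, h2⟩ := h
  obtain ⟨-, r', hr', h1', h2'⟩ := h'
  have h3 : r =ᶠ[𝓝 (t₀, 0)] r' := by
    refine eventuallyEq_of_pow_mul μ hr.eventually_continuousAt hr'.eventually_continuousAt ?_
    filter_upwards [h1, h1'] with v h4 h5
    exact add_left_cancel (h4.symm.trans h5)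
  filter_upwards [h2, h2', (tendsto_prodMk_zero t₀).eventually h3] with t h4 h5 h6
  rw [← h4, ← h5, h6]

lemma comp (h : HasLeadingTerm t₀ μ g m) (h' : HasLeadingTerm t₀ μ g' m') :
    HasLeadingTerm t₀ μ (compGerm g g') (m + m') := by
  obtain ⟨hg, r, hr, h1, h2⟩ := h
  obtain ⟨hg', r', hr', h1', h2'⟩ := h'
  refine ⟨hg.comp hg', fun v => r' v + compGerm r g' v,
    hr'.add (analyticAt_compGerm hr hg'.analyticAt hg'.apply_zero), ?_, ?_⟩
  · filter_upwards [h1', (tendsto_prodMk_snd hg'.analyticAt.continuousAt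
      hg'.apply_zero).eventually h1] with v h3 h4
    simp only [compGerm] at h4 ⊢
    rw [h4, h3]
    ring
  · filter_upwards [h2, h2', hg'.eventually_eq] with t h3 h4 h5
    simp only [compGerm, h5, h3, h4, Pi.add_apply, add_comm]

lemma inverse (h : HasLeadingTerm t₀ μ g m) (hg' : IsHolonomyGerm t₀ g')
    (he : compGerm g g' =ᶠ[𝓝 (t₀, 0)] Prod.fst) : HasLeadingTerm t₀ μ g' (-m) := by
  obtain ⟨hg, r, hr, h1, h2⟩ := h
  refine ⟨hg', fun v => -compGerm r g' v,
    (analyticAt_compGerm hr hg'.analyticAt hg'.apply_zero).neg, ?_, ?_⟩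
  · filter_upwards [he, (tendsto_prodMk_snd hg'.analyticAt.continuousAt
      hg'.apply_zero).eventually h1] with v h3 h4
    simp only [compGerm] at h3 h4 ⊢
    rw [h4] at h3
    rw [← h3]
    ring
  · filter_upwards [h2, hg'.eventually_eq] with t h3 h4
    simp only [compGerm, h4, h3, Pi.neg_apply]

/-- The leading term is not changed by conjugation, since all germs are the identity for `ε = 0`. -/
lemma conj (h : HasLeadingTerm t₀ μ g m) (ha : IsHolonomyGerm t₀ a) (ha' : IsHolonomyGerm t₀ a')
    (he : compGerm a a' =ᶠ[𝓝 (t₀, 0)] Prod.fst) :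
    HasLeadingTerm t₀ μ (compGerm a (compGerm g a')) m := by
  obtain ⟨hg, r, hr, h1, h2⟩ := h
  -- `a (u + w, ε) - a (u, ε) = w A (u, ε, w)` with `A (u, 0, 0) = 1`
  let f : (ℂ × ℂ) × ℂ → ℂ := fun w => a (w.1.1 + w.2, w.1.2) - a w.1
  have hf : AnalyticAt ℂ f ((t₀, 0), 0) := by
    refine AnalyticAt.sub ?_ (AnalyticAt.comp_of_eq ha.analyticAt analyticAt_fst rfl)
    exact AnalyticAt.comp_of_eq (f := fun w : (ℂ × ℂ) × ℂ => (w.1.1 + w.2, w.1.2)) ha.analyticAt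
      (((analyticAt_fst.comp analyticAt_fst).add analyticAt_snd).prod
        (analyticAt_snd.comp analyticAt_fst)) (by simp)
  obtain ⟨A, hA, hfA⟩ := exists_eq_mul_of_eq_zero hf
    (Filter.Eventually.of_forall fun u => by simp [f])
  have hA1 : ∀ᶠ t in 𝓝 t₀, A ((t, 0), 0) = 1 := by
    let B : ℂ × ℂ → ℂ := fun v => A ((v.1, 0), v.2)
    have hB : AnalyticAt ℂ B (t₀, 0) :=
      AnalyticAt.comp_of_eq (f := fun v : ℂ × ℂ => ((v.1, (0 : ℂ)), v.2)) hA
        ((analyticAt_fst.prod analyticAt_const).prod analyticAt_snd) rfl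
    have hl : Filter.Tendsto (fun v : ℂ × ℂ => ((v.1, (0 : ℂ)), v.2)) (𝓝 (t₀, 0))
        (𝓝 ((t₀, 0), 0)) := Continuous.tendsto (by fun_prop) ((t₀, 0) : ℂ × ℂ)
    have hl1 : Filter.Tendsto (fun v : ℂ × ℂ => v.1 + v.2) (𝓝 (t₀, 0)) (𝓝 t₀) := by
      have : Continuous fun v : ℂ × ℂ => v.1 + v.2 := by fun_prop
      simpa using this.tendsto (t₀, 0)
    have hB1 : B =ᶠ[𝓝 (t₀, 0)] fun _ => 1 := by
      refine eventuallyEq_of_pow_mul 1 hB.eventually_continuousAt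
        (Filter.Eventually.of_forall fun _ => continuousAt_const) ?_
      filter_upwards [hl.eventually hfA, hl1.eventually ha.eventually_eq,
        (continuous_fst.tendsto ((t₀, 0) : ℂ × ℂ)).eventually ha.eventually_eq] with v h3 h4 h5
      simp only [f, h4, h5] at h3
      simp only [B, pow_one]
      rw [← h3]
      ring
    exact (tendsto_prodMk_zero t₀).eventually hB1
  let k : ℂ × ℂ → (ℂ × ℂ) × ℂ := fun v => ((a' v, v.2), compGerm g a' v - a' v)
  have hk : AnalyticAt ℂ k (t₀, 0) := (ha'.analyticAt.prod analyticAt_snd).prod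
    ((hg.comp ha').analyticAt.sub ha'.analyticAt)
  have hk0 : k (t₀, 0) = ((t₀, 0), 0) := by
    simp [k, ha'.apply_zero, (hg.comp ha').apply_zero]
  have hkt : Filter.Tendsto k (𝓝 (t₀, 0)) (𝓝 ((t₀, 0), 0)) := hk0 ▸ hk.continuousAt.tendsto
  refine ⟨ha.comp (hg.comp ha'), fun v => compGerm r a' v * A (k v),
    (analyticAt_compGerm hr ha'.analyticAt ha'.apply_zero).mul
      (AnalyticAt.comp_of_eq hA hk hk0), ?_, ?_⟩
  · filter_upwards [he, hkt.eventually hfA, (tendsto_prodMk_snd ha'.analyticAt.continuousAt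
      ha'.apply_zero).eventually h1] with v h3 h4 h5
    simp only [f, k, compGerm, add_sub_cancel] at h3 h4 h5 ⊢
    rw [h3, h5] at h4
    rw [h5]
    rw [sub_eq_iff_eq_add] at h4
    rw [h4]
    ring
  · filter_upwards [h2, ha'.eventually_eq, (hg.comp ha').eventually_eq, hA1] with t h3 h4 h5 h6
    have h7 : k (t, 0) = ((t, 0), 0) := by simp only [k, h5, h4, sub_self]
    simp only [h7, h6, mul_one, compGerm, h4, h3]

end HasLeadingTerm

/-! ### Melnikov functions -/

lemma eventually_melnikov_eq {μ : ℕ} {Δ : ℂ → ℂ → ℂ} {r : ℂ × ℂ → ℂ}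
    (hr : AnalyticAt ℂ r (t₀, 0)) (h : ∀ᶠ z in 𝓝 ((t₀, 0) : ℂ × ℂ), Δ z.1 z.2 = z.2 ^ μ * r z) :
    ∀ᶠ t in 𝓝 t₀, (∀ i < μ, melnikov Δ i t = 0) ∧ melnikov Δ μ t = r (t, 0) := by
  filter_upwards [(tendsto_prodMk_zero t₀).eventually h.eventually_nhds,
    (tendsto_prodMk_zero t₀).eventually hr.eventually_analyticAt] with t h1 h2
  have h3 : (fun ε => Δ t ε) =ᶠ[𝓝 0] fun ε => ε ^ μ * r (t, ε) :=
    ((Continuous.prodMk_right t).tendsto (0 : ℂ)).eventually h1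
  have h4 : AnalyticAt ℂ (fun ε => r (t, ε)) 0 :=
    AnalyticAt.comp_of_eq (f := fun ε : ℂ => (t, ε)) h2 (analyticAt_const.prod analyticAt_id) rfl
  have h5 : ∀ i, melnikov Δ i t = (∑ j ∈ Finset.range (i + 1), (i.choose j : ℂ) *
      (if j = μ then (μ.factorial : ℂ) else 0) * iteratedDeriv (i - j) (fun ε => r (t, ε)) 0) /
        (i.factorial : ℂ) := by
    intro i
    have h6 : ContDiffAt ℂ i (fun ε : ℂ => ε ^ μ) 0 := contDiffAt_id.pow μ
    rw [melnikov, (h3.iteratedDeriv i).self_of_nhds, iteratedDeriv_fun_mul h6 h4.contDiffAt]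
    simp only [iteratedDeriv_fun_pow_zero, Nat.cast_ite, Nat.cast_zero]
  constructor
  · intro i hi
    rw [h5, Finset.sum_eq_zero, zero_div]
    intro j hj
    have hj' : j ≠ μ := by have := Finset.mem_range.1 hj; omega
    simp [hj']
  · rw [h5, Finset.sum_eq_single μ]
    · have : (μ.factorial : ℂ) ≠ 0 := Nat.cast_ne_zero.2 μ.factorial_ne_zero
      simp only [Nat.choose_self, Nat.cast_one, one_mul, if_true, Nat.sub_self, iteratedDeriv_zero]
      exact mul_div_cancel_left₀ _ this
    · intro j _ hj
      simp [hj]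
    · simp

lemma exists_eq_pow_mul_of_melnikov {μ : ℕ} {Δ : ℂ → ℂ → ℂ}
    (hΔ : AnalyticAt ℂ (fun z : ℂ × ℂ => Δ z.1 z.2) (t₀, 0))
    (h : ∀ i < μ, ∀ᶠ t in 𝓝 t₀, melnikov Δ i t = 0) :
    ∃ r : ℂ × ℂ → ℂ, AnalyticAt ℂ r (t₀, 0) ∧
      ∀ᶠ z in 𝓝 ((t₀, 0) : ℂ × ℂ), Δ z.1 z.2 = z.2 ^ μ * r z := by
  induction μ with
  | zero => exact ⟨_, hΔ, by simp⟩
  | succ μ ih =>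
    obtain ⟨r, hr, he⟩ := ih fun i hi => h i (hi.trans (Nat.lt_succ_self μ))
    obtain ⟨r', hr', he'⟩ := exists_eq_mul_of_eq_zero hr (by
      filter_upwards [eventually_melnikov_eq hr he, h μ (Nat.lt_succ_self μ)] with t h1 h2
      rw [← h1.2, h2])
    refine ⟨r', hr', ?_⟩
    filter_upwards [he, he'] with z h1 h2
    rw [h1, h2]
    ring

lemma HasLeadingTerm.eventually_melnikov {μ : ℕ} {m : ℂ → ℂ} {Δ : ℂ → ℂ → ℂ}
    (h : HasLeadingTerm t₀ μ (fun z => z.1 + Δ z.1 z.2) m) :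
    ∀ᶠ t in 𝓝 t₀, (∀ i < μ, melnikov Δ i t = 0) ∧ melnikov Δ μ t = m t := by
  obtain ⟨-, r, hr, h1, h2⟩ := h
  filter_upwards [eventually_melnikov_eq (Δ := Δ) hr (h1.mono fun z hz => add_left_cancel hz), h2]
    with t h3 h4
  exact ⟨h3.1, h3.2.trans h4⟩

lemma HasLeadingTerm.of_melnikov {μ : ℕ} {Δ : ℂ → ℂ → ℂ}
    (hg : IsHolonomyGerm t₀ (fun z => z.1 + Δ z.1 z.2))
    (h : ∀ i < μ, ∀ᶠ t in 𝓝 t₀, melnikov Δ i t = 0) :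
    HasLeadingTerm t₀ μ (fun z => z.1 + Δ z.1 z.2) (melnikov Δ μ) := by
  have hΔ : AnalyticAt ℂ (fun z : ℂ × ℂ => Δ z.1 z.2) (t₀, 0) := by
    exact (hg.analyticAt.sub analyticAt_fst).congr (Filter.Eventually.of_forall fun z => by simp)
  obtain ⟨r, hr, he⟩ := exists_eq_pow_mul_of_melnikov hΔ h
  refine ⟨hg, r, hr, he.mono fun z hz => congrArg (z.1 + ·) hz, ?_⟩
  filter_upwards [eventually_melnikov_eq hr he] with t ht
  exact ht.2.symm

end Melnikov

namespace Melnikov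

/-! ### Leading terms of loops -/

variable {F : MvPolynomial (Fin 2) ℂ} {η : ℕ → Fin 2 → MvPolynomial (Fin 2) ℂ} {t₀ : ℂ}

/-- The holonomy germ of the loop class `κ`, in terms of some first integral at the base point, is
`t + ε ^ μ (m t + O(ε))`. -/
def HasLoopLeadingTerm (F : MvPolynomial (Fin 2) ℂ) (η : ℕ → Fin 2 → MvPolynomial (Fin 2) ℂ)
    {x : Fiber F t₀} (μ : ℕ) (κ : Path.Homotopic.Quotient x x) (m : ℂ → ℂ) : Prop :=
  ∃ Φ g, IsFirstIntegralAt F η x Φ ∧ IsHolonomy F η κ Φ Φ g ∧ HasLeadingTerm t₀ μ g m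

lemma IsRegularFiber.exists_isFirstIntegralAt (hF : IsRegularFiber F η t₀) (x : Fiber F t₀) :
    ∃ Φ, IsFirstIntegralAt F η x Φ := by
  obtain ⟨p, hp⟩ := exists_isTransversal (hF.reg x)
  obtain ⟨-, Φ, -, -, -, hΦ, -⟩ := exists_flowBox hF.conv (hF.reg x) hp
  exact ⟨Φ, hΦ⟩

lemma eventuallyEq_compGerm_of_inverse {a a' b c : ℂ × ℂ → ℂ} (hb : ContinuousAt b (t₀, 0))
    (hb0 : b (t₀, 0) = t₀) (ha : compGerm a' a =ᶠ[𝓝 (t₀, 0)] Prod.fst)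
    (h : compGerm a b =ᶠ[𝓝 (t₀, 0)] c) : b =ᶠ[𝓝 (t₀, 0)] compGerm a' c := by
  filter_upwards [(tendsto_prodMk_snd hb hb0).eventually ha, h] with v h1 h2
  simp only [compGerm] at h1 h2 ⊢
  rw [← h2, h1]

namespace HasLoopLeadingTerm

variable {x y : Fiber F t₀} {μ : ℕ} {κ κ' : Path.Homotopic.Quotient x x} {m m' : ℂ → ℂ}

lemma exists_isHolonomy_conj (hF : IsRegularFiber F η t₀) (h : HasLoopLeadingTerm F η μ κ m)
    (β : Path.Homotopic.Quotient x y) {Φ' : Plane × ℂ → ℂ} (hΦ' : IsFirstIntegralAt F η y Φ') :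
    ∃ g, IsHolonomy F η (β.symm.trans (κ.trans β)) Φ' Φ' g ∧ HasLeadingTerm t₀ μ g m := by
  obtain ⟨Φ, g, hΦ, hg, hm⟩ := h
  obtain ⟨b, hb⟩ := IsHolonomy.exists_of_isFirstIntegralAt hF β hΦ hΦ'
  obtain ⟨b', hb', h1, h2⟩ := hb.isHolonomyGerm.exists_inverse
  exact ⟨_, (hb.symm hΦ' hb' h2).trans hF (hg.trans hF hb), hm.conj hb' hb.isHolonomyGerm h2⟩

/-- Leading terms are not changed by a change of the base point. -/
lemma conj (hF : IsRegularFiber F η t₀) (h : HasLoopLeadingTerm F η μ κ m)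
    (β : Path.Homotopic.Quotient x y) :
    HasLoopLeadingTerm F η μ (β.symm.trans (κ.trans β)) m := by
  obtain ⟨Φ', hΦ'⟩ := hF.exists_isFirstIntegralAt y
  obtain ⟨g, hg, hm⟩ := h.exists_isHolonomy_conj hF β hΦ'
  exact ⟨Φ', g, hΦ', hg, hm⟩

lemma exists_isHolonomy (hF : IsRegularFiber F η t₀) (h : HasLoopLeadingTerm F η μ κ m)
    {Φ : Plane × ℂ → ℂ} (hΦ : IsFirstIntegralAt F η x Φ) :
    ∃ g, IsHolonomy F η κ Φ Φ g ∧ HasLeadingTerm t₀ μ g m := by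
  have h1 := h.exists_isHolonomy_conj hF (Path.Homotopic.Quotient.refl x) hΦ
  have h2 : (Path.Homotopic.Quotient.refl x).symm = Path.Homotopic.Quotient.refl x := by
    rw [← Path.Homotopic.Quotient.mk_refl, ← Path.Homotopic.Quotient.mk_symm, Path.refl_symm]
  rwa [h2, Path.Homotopic.Quotient.trans_refl, Path.Homotopic.Quotient.refl_trans] at h1

lemma unique (hF : IsRegularFiber F η t₀) (h : HasLoopLeadingTerm F η μ κ m)
    (h' : HasLoopLeadingTerm F η μ κ m') : m =ᶠ[𝓝 t₀] m' := by
  obtain ⟨Φ, g, hΦ, hg, hm⟩ := h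
  obtain ⟨g', hg', hm'⟩ := h'.exists_isHolonomy hF hΦ
  exact hm.unique (hm'.congr (hg'.unique hF hΦ hg))

lemma refl (hF : IsRegularFiber F η t₀) (μ : ℕ) (x : Fiber F t₀) :
    HasLoopLeadingTerm F η μ (Path.Homotopic.Quotient.refl x) 0 := by
  obtain ⟨Φ, hΦ⟩ := hF.exists_isFirstIntegralAt x
  exact ⟨Φ, Prod.fst, hΦ, IsHolonomy.refl hΦ (IsHolonomyGerm.fst t₀) Filter.EventuallyEq.rfl,
    IsHolonomyGerm.fst t₀, 0, analyticAt_const, by simp, by simp⟩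

lemma trans (hF : IsRegularFiber F η t₀) (h : HasLoopLeadingTerm F η μ κ m)
    (h' : HasLoopLeadingTerm F η μ κ' m') : HasLoopLeadingTerm F η μ (κ.trans κ') (m + m') := by
  obtain ⟨Φ, g, hΦ, hg, hm⟩ := h
  obtain ⟨g', hg', hm'⟩ := h'.exists_isHolonomy hF hΦ
  exact ⟨Φ, _, hΦ, hg.trans hF hg', hm.comp hm'⟩

lemma symm (h : HasLoopLeadingTerm F η μ κ m) : HasLoopLeadingTerm F η μ κ.symm (-m) := by
  obtain ⟨Φ, g, hΦ, hg, hm⟩ := h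
  obtain ⟨g', hg', h1, h2⟩ := hg.isHolonomyGerm.exists_inverse
  exact ⟨Φ, g', hΦ, hg.symm hΦ hg' h2, hm.inverse hg' h1⟩

end HasLoopLeadingTerm

section Displacement

variable {x : Fiber F t₀} {μ : ℕ} {m : ℂ → ℂ} {p : ℂ → Plane}

/-- In the coordinate of a first integral, the holonomy map of a family of tangent paths is the
inverse of the holonomy germ. -/
lemma IsHolonomyMap.exists_conj (hF : IsRegularFiber F η t₀) (hp : IsTransversal F x p)
    {κ : Path.Homotopic.Quotient x x} {h : ℂ × ℂ → ℂ} (hh : IsHolonomyMap F η p p κ h)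
    {Φ : Plane × ℂ → ℂ} {g : ℂ × ℂ → ℂ} (hΦ : IsFirstIntegralAt F η x Φ)
    (hg : IsHolonomy F η κ Φ Φ g) :
    ∃ k k' g', IsHolonomyGerm t₀ k ∧ IsHolonomyGerm t₀ k' ∧ IsHolonomyGerm t₀ g' ∧
      compGerm k k' =ᶠ[𝓝 (t₀, 0)] Prod.fst ∧ compGerm k' k =ᶠ[𝓝 (t₀, 0)] Prod.fst ∧
      compGerm g g' =ᶠ[𝓝 (t₀, 0)] Prod.fst ∧ compGerm g' g =ᶠ[𝓝 (t₀, 0)] Prod.fst ∧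
      h =ᶠ[𝓝 (t₀, 0)] compGerm k' (compGerm g' k) := by
  have hk := hp.isHolonomyGerm hΦ
  set k : ℂ × ℂ → ℂ := fun z => Φ (p z.1, z.2) with hk_def
  obtain ⟨k', hk', h1, h2⟩ := hk.exists_inverse
  obtain ⟨g', hg', h3, h4⟩ := hg.isHolonomyGerm.exists_inverse
  refine ⟨k, k', g', hk, hk', hg', h1, h2, h3, h4, ?_⟩
  have h5 : compGerm g (compGerm k h) =ᶠ[𝓝 (t₀, 0)] k := hh.eventually_eq hF hp hg hp
  have h6 : AnalyticAt ℂ (compGerm k h) (t₀, 0) := analyticAt_compGerm hk.analyticAt hh.1 hh.2.1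
  refine eventuallyEq_compGerm_of_inverse hh.1.continuousAt hh.2.1 h2
    (eventuallyEq_compGerm_of_inverse h6.continuousAt ?_ h4 h5)
  simp only [compGerm, hh.2.1, hk.apply_zero]

/-- The sign comes from the holonomy map being conjugate to the inverse of the holonomy germ. -/
lemma HasLoopLeadingTerm.hasLeadingTerm (hF : IsRegularFiber F η t₀) (hp : IsTransversal F x p)
    {κ : Path.Homotopic.Quotient x x} {h : ℂ × ℂ → ℂ} (hm : HasLoopLeadingTerm F η μ κ m)
    (hh : IsHolonomyMap F η p p κ h) : HasLeadingTerm t₀ μ h (-m) := by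
  obtain ⟨Φ, g, hΦ, hg, hm⟩ := hm
  obtain ⟨k, k', g', hk, hk', hg', h1, h2, h3, h4, h5⟩ := hh.exists_conj hF hp hΦ hg
  exact ((hm.inverse hg' h3).conj hk' hk h2).congr h5.symm

/-- The hypothesis `hm` may use that the holonomy map is the identity for `ε = 0`. -/
lemma HasLoopLeadingTerm.of_hasLeadingTerm (hF : IsRegularFiber F η t₀) (hp : IsTransversal F x p)
    {κ : Path.Homotopic.Quotient x x} {h : ℂ × ℂ → ℂ} (hh : IsHolonomyMap F η p p κ h)
    (hm : ∀ _ : IsHolonomyGerm t₀ h, HasLeadingTerm t₀ μ h m) :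
    HasLoopLeadingTerm F η μ κ (-m) := by
  obtain ⟨Φ, hΦ⟩ := hF.exists_isFirstIntegralAt x
  obtain ⟨g, hg⟩ := IsHolonomy.exists_of_isFirstIntegralAt hF κ hΦ hΦ
  obtain ⟨k, k', g', hk, hk', hg', h1, h2, h3, h4, h5⟩ := hh.exists_conj hF hp hΦ hg
  have hhg : IsHolonomyGerm t₀ h := (hk'.comp (hg'.comp hk)).congr h5.symm
  refine ⟨Φ, g, hΦ, hg, ((((hm hhg).conj hk hk' h1).congr ?_).inverse hg.isHolonomyGerm h4)⟩
  -- `k ∘ h ∘ k' = g'`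
  have hk't := tendsto_prodMk_snd hk'.analyticAt.continuousAt hk'.apply_zero
  have hgk := hg'.comp (hk.comp hk')
  filter_upwards [h1, hk't.eventually h5,
    (tendsto_prodMk_snd hgk.analyticAt.continuousAt hgk.apply_zero).eventually h1] with v e1 e2 e3
  simp only [compGerm] at e1 e2 e3 ⊢
  rw [e2, e3, e1]

lemma HasLoopLeadingTerm.of_isFirstNonzero (hF : IsRegularFiber F η t₀) (hp : IsTransversal F x p)
    {γ : FundamentalGroup (Fiber F t₀) x} {Δ : ℂ → ℂ → ℂ} (hΔ : IsDisplacement F η x p γ Δ)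
    (hμ : IsFirstNonzero t₀ Δ μ) :
    HasLoopLeadingTerm F η (x := x) μ γ (-melnikov Δ μ) :=
  .of_hasLeadingTerm hF hp hΔ.isHolonomyMap fun hg => .of_melnikov hg hμ.1

lemma HasLoopLeadingTerm.eventually_melnikov (hF : IsRegularFiber F η t₀)
    (hp : IsTransversal F x p) {γ : FundamentalGroup (Fiber F t₀) x}
    (hm : HasLoopLeadingTerm F η (x := x) μ γ m) {Δ : ℂ → ℂ → ℂ}
    (hΔ : IsDisplacement F η x p γ Δ) :
    ∀ᶠ t in 𝓝 t₀, (∀ i < μ, melnikov Δ i t = 0) ∧ melnikov Δ μ t = -m t :=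
  (hm.hasLeadingTerm hF hp hΔ.isHolonomyMap).eventually_melnikov

end Displacement

/-! ### Invariance of the order under monodromy -/

/-- The order of the holonomy of a loop is read off from a first integral and its continuation
along the loop. -/
lemma exists_hasLoopLeadingTerm_iff (hF : IsRegularFiber F η t₀) {x : Fiber F t₀} (c : Path x x)
    {μ : ℕ} {Φ Φ' : Plane × ℂ → ℂ} (h : Continues F η (fun s => (c s : Plane)) Φ Φ') :
    (∃ m, HasLoopLeadingTerm F η μ (Path.Homotopic.Quotient.mk c) m) ↔
      IsDivisibleAt μ (Φ' - Φ) (x : Plane) := by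
  have hΦ : IsFirstIntegralAt F η x Φ := by simpa using h.isFirstIntegralAt_left
  have hcc : Continuous fun s => (c s : Plane) := continuous_subtype_val.comp c.continuous
  constructor
  · rintro ⟨m, hm⟩
    obtain ⟨g, hg, hg', r, hr, h1, -⟩ := hm.exists_isHolonomy hF hΦ
    have h2 := h.unique hcc (hg.continues hF rfl) Filter.EventuallyEq.rfl
    simp only [c.target] at h2
    refine ⟨compGerm r Φ, analyticAt_compGerm hr hΦ.analyticAt hΦ.apply_zero, ?_⟩
    filter_upwards [h2, (tendsto_prodMk_snd hΦ.analyticAt.continuousAt hΦ.apply_zero).eventually h1]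
      with v h3 h4
    simp only [Pi.sub_apply, h3, compGerm] at h4 ⊢
    rw [h4]
    ring
  · rintro ⟨R, hR, h1⟩
    obtain ⟨g, hg⟩ := IsHolonomy.exists_of_isFirstIntegralAt hF (Path.Homotopic.Quotient.mk c) hΦ hΦ
    have h2 := h.unique hcc (hg.continues hF rfl) Filter.EventuallyEq.rfl
    simp only [c.target] at h2
    obtain ⟨p, hp⟩ := exists_isTransversal (hF.reg x)
    have hk := hp.isHolonomyGerm hΦ
    set k : ℂ × ℂ → ℂ := fun z => Φ (p z.1, z.2) with hk_def
    obtain ⟨k', hk', hkk', -⟩ := hk.exists_inverse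
    have hk't := tendsto_prodMk_snd hk'.analyticAt.continuousAt hk'.apply_zero
    let r : ℂ × ℂ → ℂ := fun z => R (p (k' z), z.2)
    have hr : AnalyticAt ℂ r (t₀, 0) := AnalyticAt.comp_of_eq
      (f := fun z : ℂ × ℂ => (p (k' z), z.2)) hR
      ((AnalyticAt.comp_of_eq hp.1 hk'.analyticAt hk'.apply_zero).prod analyticAt_snd)
      (by simp [hk'.apply_zero, hp.2.1])
    refine ⟨fun t => r (t, 0), Φ, g, hΦ, hg, hg.isHolonomyGerm, r, hr, ?_, by simp⟩
    filter_upwards [hkk', (hp.tendsto.comp hk't).eventually h1, (hp.tendsto.comp hk't).eventually h2]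
      with z e1 e2 e3
    simp only [compGerm, Pi.sub_apply, Function.comp_apply, hk_def] at e1 e2 e3
    rw [e3, e1] at e2
    rw [← sub_eq_iff_eq_add', e2]

/-- Loops obtained from each other by monodromy have holonomies of the same order. The property of
having the holonomy of order `μ` is open and closed along the family of loops, since divisibility
by `ε ^ μ` passes to the nearby points. -/
lemma IsMonodromy.exists_hasLoopLeadingTerm (hη : IsConvergentDeformation η) {x : Fiber F t₀}
    {α : Path (x : Plane) (x : Plane)} {γ γ' : FundamentalGroup (Fiber F t₀) x}
    (h : IsMonodromy F x α γ γ') (hα : ∀ u, IsTypicalValue F (MvPolynomial.eval (α u) F))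
    {μ : ℕ} (hγ : ∃ m, HasLoopLeadingTerm F η (x := x) μ γ m) :
    ∃ m, HasLoopLeadingTerm F η (x := x) μ γ' m := by
  obtain ⟨H, c, c', hH1, hH2, hH3, rfl, rfl⟩ := h
  have hreg : ∀ u, IsRegularFiber F η (MvPolynomial.eval (α u) F) := fun u =>
    ⟨hη, fun y => (hα u).fderiv_ne_zero y⟩
  have hF : IsRegularFiber F η t₀ := by
    have := hreg 0
    rwa [α.source, x.2] at this
  -- the loops of the family, in their fibers
  let b : ∀ u, Fiber F (MvPolynomial.eval (α u) F) := fun u => ⟨α u, rfl⟩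
  let l : ∀ u, Path (b u) (b u) := fun u =>
    ⟨⟨fun s => ⟨H (u, s), hH2 u s⟩, by fun_prop⟩, Subtype.ext (hH1 u).1, Subtype.ext (hH1 u).2⟩
  let P : I → Prop := fun u => ∃ Φ Φ', Continues F η (fun s => H (u, s)) Φ Φ' ∧
    IsDivisibleAt μ (Φ' - Φ) (α u)
  have hP : ∀ {u Φ Φ'}, Continues F η (fun s => H (u, s)) Φ Φ' →
      (P u ↔ IsDivisibleAt μ (Φ' - Φ) (α u)) := by
    intro u Φ Φ' h
    refine ⟨?_, fun h1 => ⟨Φ, Φ', h, h1⟩⟩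
    rintro ⟨Ψ, Ψ', h2, h3⟩
    exact (exists_hasLoopLeadingTerm_iff (hreg u) (l u) h).1
      ((exists_hasLoopLeadingTerm_iff (hreg u) (l u) h2).2 h3)
  have hends : ∀ {u : I} {e : Path x x}, (∀ s, H (u, s) = (e s : Plane)) → α u = x →
      ((∃ m, HasLoopLeadingTerm F η μ (Path.Homotopic.Quotient.mk e) m) ↔ P u) := by
    intro u e he hu
    have he' : (fun s => H (u, s)) = fun s => (e s : Plane) := funext he
    obtain ⟨Φ, hΦ⟩ := hF.exists_isFirstIntegralAt x
    obtain ⟨Φ', h⟩ := exists_continues hF.conv hF.reg e hΦ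
    rw [exists_hasLoopLeadingTerm_iff hF e h, hP (u := u) (by rwa [he']), hu]
  refine (hends (u := 1) (fun s => (hH3 s).2) α.target).2 ?_
  refine unitInterval_induction (fun u => ?_) 0 1 ((hends (fun s => (hH3 s).1) α.source).1 hγ)
  -- near `u`, one first integral `Φ₀` serves as initial value for all loops of the family
  obtain ⟨Φ₀, hΦ₀⟩ := (hreg u).exists_isFirstIntegralAt (b u)
  have hnear : ∀ᶠ u' in 𝓝 u, IsFirstIntegralAt F η (α u') Φ₀ :=
    (α.continuous.tendsto u).eventually hΦ₀.eventually
  have hex : ∀ u' : I, ∃ Ψ : I → Plane × ℂ → ℂ, IsCoherent F η (fun s => H (u', s)) Set.univ Ψ ∧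
      (IsFirstIntegralAt F η (α u') Φ₀ → Ψ 0 = Φ₀) := by
    intro u'
    by_cases hu' : IsFirstIntegralAt F η (α u') Φ₀
    · obtain ⟨Ψ, hΨ, h0⟩ := exists_isCoherent (hreg u').conv (hreg u').reg (l u').continuous
        (Φ₀ := Φ₀) (by rwa [(l u').source])
      exact ⟨Ψ, hΨ, fun _ => h0⟩
    · obtain ⟨Φ₁, hΦ₁⟩ := (hreg u').exists_isFirstIntegralAt (b u')
      obtain ⟨Ψ, hΨ, -⟩ := exists_isCoherent (hreg u').conv (hreg u').reg (l u').continuous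
        (Φ₀ := Φ₁) (by rwa [(l u').source])
      exact ⟨Ψ, hΨ, fun h => absurd h hu'⟩
  choose Ψ hΨ hΨ0 using hex
  have hcont : ∀ u', IsFirstIntegralAt F η (α u') Φ₀ →
      Continues F η (fun s => H (u', s)) Φ₀ (Ψ u' 1) := fun u' hu' =>
    ⟨Ψ u', hΨ u', by rw [hΨ0 u' hu'], Filter.EventuallyEq.rfl⟩
  have hend := eventually_eventuallyEq_of_isCoherent (K := fun v => H v) H.continuous hΨ (u₀ := u)
    (hnear.mono fun u' hu' => by rw [hΨ0 u' hu', hΨ0 u hΦ₀])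
  have hD : AnalyticAt ℂ (Ψ u 1 - Φ₀) (α u, 0) := by
    have h1 := (hcont u hΦ₀).isFirstIntegralAt_right.analyticAt
    simp only [(hH1 u).2] at h1
    exact h1.sub hΦ₀.analyticAt
  filter_upwards [hnear, hend,
    (α.continuous.tendsto u).eventually (eventually_isDivisibleAt_iff μ hD)] with u' h1 h2 h3
  rw [hP (hcont u' h1), hP (hcont u hΦ₀), ← h3]
  rw [(hH1 u').2] at h2
  have h4 : Ψ u' 1 - Φ₀ =ᶠ[𝓝 (α u', 0)] Ψ u 1 - Φ₀ := h2.sub Filter.EventuallyEq.rfl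
  exact ⟨fun h => h.congr h4, fun h => h.congr h4.symm⟩

end Melnikov

namespace Melnikov

/-! ### Functionals on the first homology of the orbit -/

section Group

variable {G : Type*} [Group G]

/-- An additive function on `𝒪` which is invariant under conjugation kills `K = [𝒪, G]`, hence it
defines a linear functional on `ℂ H₁(𝒪)`. -/
lemma exists_functional (O : Subgroup G) [hO : O.Normal] (f : O → ℂ)
    (hmul : ∀ a b, f (a * b) = f a + f b)
    (hconj : ∀ (a : O) (g : G), f ⟨g * a * g⁻¹, hO.conj_mem a a.2 g⟩ = f a) :
    ∃ ℳ : ComplexOrbitH1 O →ₗ[ℂ] ℂ, ∀ δ, ℳ (orbitClass O δ) = f δ := by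
  let φ : O →* Multiplicative ℂ := MonoidHom.mk' (fun a => Multiplicative.ofAdd (f a))
    fun a b => by rw [hmul, ofAdd_add]
  have hφ : ∀ a, f a = (φ a).toAdd := fun _ => rfl
  have hle : ⁅O, (⊤ : Subgroup G)⁆ ≤ φ.ker.map O.subtype := by
    refine Subgroup.commutator_le.2 fun a ha g _ => ?_
    refine ⟨⟨a, ha⟩ * ⟨g * a⁻¹ * g⁻¹, hO.conj_mem _ (O.inv_mem ha) g⟩, ?_, ?_⟩
    · have h1 := hconj (⟨a, ha⟩⁻¹ : O) g
      have h2 : f (⟨a, ha⟩⁻¹ : O) = -f ⟨a, ha⟩ := by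
        rw [hφ, map_inv, toAdd_inv, ← hφ]
      have h3 : f (⟨a, ha⟩ * ⟨g * a⁻¹ * g⁻¹, hO.conj_mem _ (O.inv_mem ha) g⟩ : O) = 0 := by
        rw [hmul, show f ⟨g * a⁻¹ * g⁻¹, hO.conj_mem _ (O.inv_mem ha) g⟩ = _ from h1, h2,
          add_neg_cancel]
      exact congrArg Multiplicative.ofAdd h3
    · simp [commutatorElement_def, mul_assoc]
  have hker : commutatorIn O ≤ φ.ker := by
    intro a ha
    obtain ⟨b, hb, hba⟩ := hle (Subgroup.mem_subgroupOf.1 ha)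
    rwa [← Subtype.ext hba]
  let ψ : OrbitH1 O →* Multiplicative ℂ := QuotientGroup.lift (commutatorIn O) φ hker
  refine ⟨LinearMap.liftBaseChange ℂ (MonoidHom.toAdditiveLeft ψ).toIntLinearMap, fun δ => ?_⟩
  rw [orbitClass, LinearMap.liftBaseChange_tmul, one_smul]
  rfl

/-- Beyond the torsion-free depth, the classes of the elements of the lower central sequence
vanish in `ℂ H₁(𝒪)`. -/
lemma orbitClass_eq_zero_of_torsionFreeDepth (O : Subgroup G) [O.Normal] {k : ℕ}
    (h : torsionFreeDepth O = k) (δ : O) (hδ : (δ : G) ∈ lowerCentral G (k + 1)) :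
    orbitClass O δ = 0 := by
  have hne : {k : ℕ∞ | ∃ j : ℕ, k = j ∧ 1 ≤ j ∧
      Subsingleton (ℂ ⊗[ℤ] Additive (orbitFiltration O (j + 1)))}.Nonempty := by
    by_contra hne
    rw [Set.not_nonempty_iff_eq_empty] at hne
    rw [torsionFreeDepth, hne, sInf_empty] at h
    exact ENat.natCast_ne_top k h.symm
  obtain ⟨j, hj, -, hsub⟩ := csInf_mem hne
  rw [show sInf _ = (k : ℕ∞) from h, Nat.cast_inj] at hj
  subst hj
  let ι : Additive (orbitFiltration O (k + 1)) →ₗ[ℤ] Additive (OrbitH1 O) :=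
    (MonoidHom.toAdditive (orbitFiltration O (k + 1)).subtype).toIntLinearMap
  let z : orbitFiltration O (k + 1) :=
    ⟨toOrbitH1 O δ, δ, Subgroup.mem_subgroupOf.2 hδ, rfl⟩
  have h1 : orbitClass O δ = ι.lTensor ℂ ((1 : ℂ) ⊗ₜ[ℤ] Additive.ofMul z) := rfl
  rw [h1, Subsingleton.elim ((1 : ℂ) ⊗ₜ[ℤ] Additive.ofMul z) 0, map_zero]

end Group

/-! ### The functional defined by the first nonzero Melnikov function -/

variable {F : MvPolynomial (Fin 2) ℂ} {η : ℕ → Fin 2 → MvPolynomial (Fin 2) ℂ} {t₀ : ℂ}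
  {x y : Fiber F t₀} {μ : ℕ} {γ δ : FundamentalGroup (Fiber F t₀) x} {m : ℂ → ℂ}

/-- The subgroup of the loops whose holonomy differs from the identity by a multiple of `ε ^ μ`. -/
def leadingTermSubgroup (hF : IsRegularFiber F η t₀) (x : Fiber F t₀) (μ : ℕ) :
    Subgroup (FundamentalGroup (Fiber F t₀) x) where
  carrier := {δ | ∃ m, HasLoopLeadingTerm F η (x := x) μ δ m}
  mul_mem' := fun ⟨_, h⟩ ⟨_, h'⟩ => ⟨_, h'.trans hF h⟩
  one_mem' := ⟨_, .refl hF μ x⟩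
  inv_mem' := fun ⟨_, h⟩ => ⟨_, h.symm⟩

lemma HasLoopLeadingTerm.changeBase (hF : IsRegularFiber F η t₀)
    (h : HasLoopLeadingTerm F η (x := x) μ δ m) (β : Path x y) :
    HasLoopLeadingTerm F η (x := y) μ (changeBase β δ) m :=
  h.conj hF (Path.Homotopic.Quotient.mk β)

lemma HasLoopLeadingTerm.conj_mul (hF : IsRegularFiber F η t₀)
    (h : HasLoopLeadingTerm F η (x := x) μ δ m) (g : FundamentalGroup (Fiber F t₀) x) :
    HasLoopLeadingTerm F η (x := x) μ (g * δ * g⁻¹) m :=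
  h.conj hF g

lemma leadingTermSubgroup_normal (hF : IsRegularFiber F η t₀) (x : Fiber F t₀) (μ : ℕ) :
    (leadingTermSubgroup hF x μ).Normal :=
  ⟨fun _ ⟨_, h⟩ g => ⟨_, h.conj_mul hF g⟩⟩

lemma exists_hasLoopLeadingTerm_of_mem_orbit (hF : IsRegularFiber F η t₀)
    (hγ : ∃ m, HasLoopLeadingTerm F η (x := x) μ γ m) (hδ : δ ∈ orbit F x γ) :
    ∃ m, HasLoopLeadingTerm F η (x := x) μ δ m := by
  have := leadingTermSubgroup_normal hF x μ
  have h1 : orbit F x γ ≤ leadingTermSubgroup hF x μ := by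
    refine Subgroup.normalClosure_le_normal ?_
    rintro γ' ⟨α, hα, h⟩
    exact h.exists_hasLoopLeadingTerm hF.conv hα hγ
  exact h1 hδ

/-- If the loop `γ` has a leading term of order `ε ^ μ`, then so have all loops of its orbit, and
the leading coefficients at `t₀` define a functional. -/
lemma exists_isMelnikovFunctional (hF : IsRegularFiber F η t₀)
    (hγ : ∃ m, HasLoopLeadingTerm F η (x := x) μ γ m) :
    ∃ ℳ : ComplexOrbitH1 (orbit F x γ) →ₗ[ℂ] ℂ, IsMelnikovFunctional F η x γ μ ℳ ∧
      ∀ (δ : orbit F x γ) (m : ℂ → ℂ), HasLoopLeadingTerm F η (x := x) μ δ.1 m →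
        ℳ (orbitClass _ δ) = -m t₀ := by
  choose m hm using fun δ : orbit F x γ => exists_hasLoopLeadingTerm_of_mem_orbit hF hγ δ.2
  have huniq : ∀ (δ : orbit F x γ) (m' : ℂ → ℂ), HasLoopLeadingTerm F η (x := x) μ δ.1 m' →
      m δ t₀ = m' t₀ := fun δ m' h => ((hm δ).unique hF h).self_of_nhds
  obtain ⟨ℳ, hℳ⟩ := exists_functional (orbit F x γ) (fun δ => -m δ t₀)
    (fun a b => by
      rw [huniq (a * b) _ ((hm b).trans hF (hm a)), Pi.add_apply]
      ring)
    (fun a g => by rw [huniq _ _ ((hm a).conj_mul hF g)])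
  refine ⟨ℳ, fun p hp δ => ⟨?_, fun Δ hΔ => ?_⟩, fun δ m' h => by rw [hℳ, huniq δ m' h]⟩
  · obtain ⟨h, hh⟩ := exists_isHolonomyMap hF (x := x) (x' := x) (δ : FundamentalGroup _ x) hp hp
    exact ⟨_, hh.isDisplacement⟩
  · rw [hℳ, ((hm δ).eventually_melnikov hF hp hΔ).self_of_nhds.2]

/-! ### Free loops -/

/-- The free loops in the typical fibers of `F`. -/
def typicalLoops (F : MvPolynomial (Fin 2) ℂ) : Set C(I, Plane) :=
  {l | l 0 = l 1 ∧ (∀ s, MvPolynomial.eval (l s) F = MvPolynomial.eval (l 0) F) ∧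
    IsTypicalValue F (MvPolynomial.eval (l 0) F)}

/-- A path in a fiber, seen as a path in the plane. -/
def planePath (c : Path x y) : C(I, Plane) :=
  ⟨fun s => (c s : Plane), continuous_subtype_val.comp c.continuous⟩

/-- Monodromy is free homotopy through loops in the typical fibers. -/
lemma exists_isMonodromy_iff {γ' : FundamentalGroup (Fiber F t₀) x} :
    (∃ α : Path (x : Plane) (x : Plane),
      (∀ u, IsTypicalValue F (MvPolynomial.eval (α u) F)) ∧ IsMonodromy F x α γ γ') ↔
    ∃ c c' : Path x x, JoinedIn (typicalLoops F) (planePath c) (planePath c') ∧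
      FundamentalGroup.fromPath (Path.Homotopic.Quotient.mk c) = γ ∧
      FundamentalGroup.fromPath (Path.Homotopic.Quotient.mk c') = γ' := by
  constructor
  · rintro ⟨α, hα, H, c, c', h1, h2, h3, h4, h5⟩
    refine ⟨c, c', ⟨⟨H.curry, ?_, ?_⟩, fun u => ⟨?_, fun s => ?_, ?_⟩⟩, h4, h5⟩
    · ext1 s
      exact (h3 s).1
    · ext1 s
      exact (h3 s).2
    · exact (h1 u).1.trans (h1 u).2.symm
    · exact (h2 u s).trans (h2 u 0).symm
    · change IsTypicalValue F (MvPolynomial.eval (H (u, 0)) F)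
      rw [(h1 u).1]
      exact hα u
  · rintro ⟨c, c', ⟨Γ, hΓ⟩, h4, h5⟩
    have hs : ∀ s, Γ 0 s = c s := fun s => by rw [Γ.source]; rfl
    have ht : ∀ s, Γ 1 s = c' s := fun s => by rw [Γ.target]; rfl
    let α : Path (x : Plane) (x : Plane) :=
      ⟨⟨fun u => Γ u 0, by fun_prop⟩, (hs 0).trans (congrArg Subtype.val c.source),
        (ht 0).trans (congrArg Subtype.val c'.source)⟩
    refine ⟨α, fun u => (hΓ u).2.2, ContinuousMap.uncurry ⟨Γ, Γ.continuous⟩, c, c',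
      fun u => ⟨rfl, (hΓ u).1.symm⟩, fun u s => (hΓ u).2.1 s, fun s => ⟨hs s, ht s⟩, h4, h5⟩

lemma joinedIn_typicalLoops (ht : IsTypicalValue F t₀) {K : I × I → Fiber F t₀}
    (hK : Continuous K) (h : ∀ u, K (u, 0) = K (u, 1)) {l l' : C(I, Plane)}
    (hl : ∀ s, (K (0, s) : Plane) = l s) (hl' : ∀ s, (K (1, s) : Plane) = l' s) :
    JoinedIn (typicalLoops F) l l' := by
  let H : C(I × I, Plane) := ⟨fun v => (K v : Plane), continuous_subtype_val.comp hK⟩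
  refine ⟨⟨H.curry, by ext1 s; exact hl s, by ext1 s; exact hl' s⟩, fun u => ⟨?_, fun s => ?_, ?_⟩⟩
  · exact congrArg Subtype.val (h u)
  · exact (K (u, s)).2.trans (K (u, 0)).2.symm
  · change IsTypicalValue F (MvPolynomial.eval (K (u, 0) : Plane) F)
    rw [(K (u, 0)).2]
    exact ht

lemma joinedIn_typicalLoops_of_homotopic (ht : IsTypicalValue F t₀) {c c' : Path x x}
    (h : c.Homotopic c') : JoinedIn (typicalLoops F) (planePath c) (planePath c') := by
  obtain ⟨H⟩ := h
  refine joinedIn_typicalLoops ht (K := fun v => H v) H.continuous (fun u => ?_) (fun s => ?_)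
    fun s => ?_
  · exact (H.source u).trans (H.target u).symm
  · exact congrArg Subtype.val (H.map_zero_left s)
  · exact congrArg Subtype.val (H.map_one_left s)

/-- The base point of a loop can be moved along a path: the loop slides along the initial pieces of
the path. -/
lemma joinedIn_typicalLoops_slide (ht : IsTypicalValue F t₀) (c : Path x x) (β : Path x y) :
    JoinedIn (typicalLoops F) (planePath c) (planePath (β.symm.trans (c.trans β))) := by
  let c₀ : Path (β 0) (β 0) := c.cast β.source β.source
  let b : ∀ u : I, Path (β 0) (β u) := fun u => β.subpath 0 u
  have hb : Continuous ↿b := β.subpath_continuous_family.comp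
    (continuous_const.prodMk continuous_id : Continuous fun v : I × I => ((0 : I), v))
  have hK : Continuous ↿fun u => (b u).symm.trans (c₀.trans (b u)) :=
    Path.trans_continuous_family _ (Path.symm_continuous_family _ hb) _
      (Path.trans_continuous_family (fun _ => c₀) (c₀.continuous.comp continuous_snd) _ hb)
  have h1 : JoinedIn (typicalLoops F) (planePath ((b 0).symm.trans (c₀.trans (b 0))))
      (planePath (β.symm.trans (c.trans β))) := by
    refine joinedIn_typicalLoops ht (K := fun v => (b v.1).symm.trans (c₀.trans (b v.1)) v.2) hK
      (fun u => by simp) (fun s => rfl) fun s => ?_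
    simp only [b]
    rw [Path.subpath_zero_one]
    rfl
  refine JoinedIn.trans ?_ h1
  have h2 : c₀.Homotopic ((b 0).symm.trans (c₀.trans (b 0))) := by
    simp only [b, Path.subpath_self, Path.refl_symm]
    exact ((Path.Homotopic.refl_trans _).trans (Path.Homotopic.trans_refl _)).symm
  exact joinedIn_typicalLoops_of_homotopic ht h2

/-- A change of the base point maps the orbit of a loop into the orbit of the image. -/
lemma changeBase_mem_orbit (ht : IsTypicalValue F t₀) (β : Path x y) (hδ : δ ∈ orbit F x γ) :
    changeBase β δ ∈ orbit F y (changeBase β γ) := by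
  have h1 : orbit F x γ ≤ (orbit F y (changeBase β γ)).comap (changeBase β).toMonoidHom := by
    refine Subgroup.normalClosure_le_normal fun γ' hγ' => ?_
    obtain ⟨c, c', hcc', rfl, rfl⟩ := exists_isMonodromy_iff.1 hγ'
    refine Subgroup.subset_normalClosure (exists_isMonodromy_iff.2 ⟨β.symm.trans (c.trans β),
      β.symm.trans (c'.trans β), ?_, rfl, rfl⟩)
    exact ((joinedIn_typicalLoops_slide ht c β).symm.trans hcc').trans
      (joinedIn_typicalLoops_slide ht c' β)
  exact h1 hδ

end Melnikov

end

theorem mainTheorem7 (F : MvPolynomial (Fin 2) ℂ) (η : ℕ → Fin 2 → MvPolynomial (Fin 2) ℂ)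
    (hη : Melnikov.IsConvergentDeformation η)
    (t₀ : ℂ) (ht₀ : Melnikov.IsTypicalValue F t₀)
    (p₀ : Melnikov.Fiber F t₀) (p : ℂ → Melnikov.Plane) (hp : Melnikov.IsTransversal F p₀ p)
    (γ : FundamentalGroup (Melnikov.Fiber F t₀) p₀)
    (Δ : ℂ → ℂ → ℂ) (hΔ : Melnikov.IsDisplacement F η p₀ p γ Δ)
    (μ : ℕ) (hμ : Melnikov.IsFirstNonzero t₀ Δ μ) :
    -- base point independence of the first nonzero Melnikov function
    (∀ (p₁ : Melnikov.Fiber F t₀) (β : Path p₀ p₁) (q : ℂ → Melnikov.Plane),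
      Melnikov.IsTransversal F p₁ q →
      (∃ Δ₁, Melnikov.IsDisplacement F η p₁ q (Melnikov.changeBase β γ) Δ₁) ∧
      ∀ Δ₁, Melnikov.IsDisplacement F η p₁ q (Melnikov.changeBase β γ) Δ₁ →
        Melnikov.IsFirstNonzero t₀ Δ₁ μ ∧
        ∀ᶠ t in 𝓝 t₀, Melnikov.melnikov Δ₁ μ t = Melnikov.melnikov Δ μ t) ∧
    -- the linear functional
    ∃ ℳ : Melnikov.ComplexOrbitH1 (Melnikov.orbit F p₀ γ) →ₗ[ℂ] ℂ,
      Melnikov.IsMelnikovFunctional F η p₀ γ μ ℳ ∧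
      -- it does not depend on the base point
      (∀ (p₁ : Melnikov.Fiber F t₀) (β : Path p₀ p₁),
        ∃ ℳ₁ : Melnikov.ComplexOrbitH1
            (Melnikov.orbit F p₁ (Melnikov.changeBase β γ)) →ₗ[ℂ] ℂ,
          Melnikov.IsMelnikovFunctional F η p₁ (Melnikov.changeBase β γ) μ ℳ₁ ∧
          ∀ δ : Melnikov.orbit F p₀ γ,
            ∃ hδ : Melnikov.changeBase β δ ∈ Melnikov.orbit F p₁ (Melnikov.changeBase β γ),
              ℳ₁ (Melnikov.orbitClass _ ⟨Melnikov.changeBase β δ, hδ⟩) =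
                ℳ (Melnikov.orbitClass _ δ)) ∧
      -- it vanishes on `𝒪 ∩ L_{k+1}`
      ∀ k : ℕ, Melnikov.torsionFreeDepth (Melnikov.orbit F p₀ γ) = k →
        ∀ δ : Melnikov.orbit F p₀ γ,
          (δ : FundamentalGroup (Melnikov.Fiber F t₀) p₀) ∈
            Melnikov.lowerCentral (FundamentalGroup (Melnikov.Fiber F t₀) p₀) (k + 1) →
          ℳ (Melnikov.orbitClass _ δ) = 0 := by
  have hF : Melnikov.IsRegularFiber F η t₀ := ⟨hη, fun x => ht₀.fderiv_ne_zero x⟩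
  have hγ := Melnikov.HasLoopLeadingTerm.of_isFirstNonzero hF hp hΔ hμ
  refine ⟨fun p₁ β q hq => ⟨?_, fun Δ₁ hΔ₁ => ?_⟩, ?_⟩
  · obtain ⟨h, hh⟩ := Melnikov.exists_isHolonomyMap hF (x := p₁) (x' := p₁)
      (Melnikov.changeBase β γ) hq hq
    exact ⟨_, hh.isDisplacement⟩
  · have h1 := (hγ.changeBase hF β).eventually_melnikov hF hq hΔ₁
    have h2 : ∀ᶠ t in 𝓝 t₀, Melnikov.melnikov Δ₁ μ t = Melnikov.melnikov Δ μ t :=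
      h1.mono fun t ht => by rw [ht.2, Pi.neg_apply, neg_neg]
    refine ⟨⟨fun i hi => h1.mono fun t ht => ht.1 i hi, fun h3 => hμ.2 ?_⟩, h2⟩
    filter_upwards [h2, h3] with t e1 e2
    rw [← e1, e2]
  · obtain ⟨ℳ, hℳ, hval⟩ := Melnikov.exists_isMelnikovFunctional hF ⟨_, hγ⟩
    refine ⟨ℳ, hℳ, fun p₁ β => ?_, fun k hk δ hδ => ?_⟩
    · obtain ⟨ℳ₁, hℳ₁, hval₁⟩ :=
        Melnikov.exists_isMelnikovFunctional hF ⟨_, hγ.changeBase hF β⟩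
      refine ⟨ℳ₁, hℳ₁, fun δ => ⟨Melnikov.changeBase_mem_orbit ht₀ β δ.2, ?_⟩⟩
      obtain ⟨m, hm⟩ := Melnikov.exists_hasLoopLeadingTerm_of_mem_orbit hF ⟨_, hγ⟩ δ.2
      rw [hval δ m hm, hval₁ _ m (hm.changeBase hF β)]
    · rw [Melnikov.orbitClass_eq_zero_of_torsionFreeDepth _ hk δ hδ, map_zero]
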